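/- **Conventions.** Let $\Sigma$ be a compact connected Riemann surface and $g_{\rm st}=\frac{4|dw|^2}{(1+|w|^2)^2}$ the standard metric on $\overline{\mathbb C}$. A *spherical metric* $g$ on $\Sigma$ is a conformal metric of constant curvature one with finitely many conical singularities. It represents the divisor $D=\sum_j(\alpha_j-1)p_j$, $\alpha_j>0$, if off the points $p_j$ with $\alpha_j\neq1$ it is a smooth conformal metric and near each such $p_j$, in a coordinate $z$ with $z(p_j)=0$, $g=e^{2\varphi}|dz|^2$ with $\varphi-(\alpha_j-1)\ln|z|$ extending continuously to $p_j$; write $\Sigma^*$ for the complement of the singular points. A *developing map* of $g$ is a multi-valued locally univalent meromorphic function $f$ on $\Sigma^*$ with $g=f^*g_{\rm st}$. The metric is *abelian* if the monodromy of a developing map lies in an abelian group of orientation-preserving isometries of $(\overline{\mathbb C},g_{\rm st})$, and *trivial* if this monodromy is trivial. A *character 1-form* of an abelian metric $g$ is a meromorphic 1-form $df/f$ with $f$ a developing map of $g$, where $f$ is required to have monodromy in ${\rm U}(1)$ (multiplications by unit complex numbers) if $g$ is non-trivial. **Theorem.** Let $\omega$ be a meromorphic 1-form on $\Sigma$ that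 has at least one pole, all of whose poles are simple, whose residues at the poles are nonzero real numbers, and whose real part is exact on the complement of the poles. Fix a base point $x_0\in\Sigma$ that is neither a zero nor a pole of $\omega$. 1. For every $r>0$ there is a unique abelian metric $g$ on $\Sigma$ such that $\omega$ is a character 1-form of $g$ and $g=f^*g_{\rm st}$, where $$f(z)=r\,\exp\Bigl(\int_{x_0}^z\omega\Bigr)$$ is a multi-valued locally univalent meromorphic function on $\Sigma^*$. 2. Conversely, every abelian metric $g$ having $\omega$ as a character 1-form is of this form for exactly one $r>0$, and a developing map $f$ of $g$ with $df/f=\omega$ is unique up to a complex factor of modulus one. 3. Let the divisor of $\omega$ be $(\omega)=\sum_{j}(\alpha_j-1)P_j-\sum_{k}Q_k$ with integers $\alpha_j>1$. Then every abelian metric having $\omega$ as a character 1-form represents the divisor $$D=\sum_{j}(\alpha_j-1)P_j+\sum_{k}\bigl(|{\rm Res}_{Q_k}(\omega)|-1\bigr)Q_k .$$ 4. Every such metric is trivial if and only if the integral of $\omega$ over each loop in $\Sigma\setminus\{\text{poles of }\omega\}$ lies in $2\pi\sqrt{-1}\,\mathbb Z$. In this case each residue of $\omega$ is an integer. -/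

import Mathlib

open Set Filter Topology
open scoped Manifold ContDiff InnerProductSpace

noncomputable section

namespace RSurf

/-- The chart at infinity of the Riemann sphere `OnePoint ℂ`: `w ↦ 1 / w`, with `0 ↦ ∞`. -/
def recip (w : ℂ) : OnePoint ℂ := if w = 0 then OnePoint.infty else ((w⁻¹ : ℂ) : OnePoint ℂ)

/-! ### Meromorphic 1-forms -/

/-- A meromorphic 1-form on a Riemann surface, given by its coefficient functions `coeff e` in the
charts `e` of the atlas (the form is `coeff e z dz` on `e.target`), which transform by the chain
rule. Coefficients are in normal form: holomorphic away from the poles, with the conventional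
value `0` at a pole. Values outside `e.target` carry no meaning. -/
structure MeromorphicForm (X : Type*) [TopologicalSpace X] [ChartedSpace ℂ X] where
  coeff : OpenPartialHomeomorph X ℂ → ℂ → ℂ
  meromorphic : ∀ e ∈ atlas ℂ X, ∀ z ∈ e.target, MeromorphicNFAt (coeff e) z
  transform : ∀ e ∈ atlas ℂ X, ∀ e' ∈ atlas ℂ X, ∀ z ∈ e.target, e.symm z ∈ e'.source →
    coeff e z = coeff e' (e' (e.symm z)) * deriv (fun w => e' (e.symm w)) z

namespace MeromorphicForm

variable {X : Type*} [TopologicalSpace X] [ChartedSpace ℂ X]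

/-- The order of the form at `p`: positive at a zero, negative at a pole. -/
def orderAt (η : MeromorphicForm X) (p : X) : WithTop ℤ :=
  meromorphicOrderAt (η.coeff (chartAt ℂ p)) (chartAt ℂ p p)

def IsPole (η : MeromorphicForm X) (p : X) : Prop := η.orderAt p < 0

/-- An abelian differential of the third kind: every pole is simple. -/
def IsThirdKind (η : MeromorphicForm X) : Prop := ∀ p, (-1 : WithTop ℤ) ≤ η.orderAt p

/-- The residue at a point that is at most a simple pole: the limit of `(z - z₀) * coeff z`. It is
used for differentials of the third kind only. -/
def residue (η : MeromorphicForm X) (p : X) : ℂ :=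
  limUnder (𝓝[≠] (chartAt ℂ p p)) fun z => (z - chartAt ℂ p p) * η.coeff (chartAt ℂ p) z

/-- The real part of the form is exact off the poles: it is `du` for a real function `u` on the
complement of the poles. In a chart, `Re (coeff z dz)` is the real-linear form
`v ↦ Re (coeff z * v)`. -/
def RealPartExact (η : MeromorphicForm X) : Prop :=
  ∃ u : X → ℝ, ∀ e ∈ atlas ℂ X, ∀ z ∈ e.target, ¬ η.IsPole (e.symm z) →
    HasFDerivAt (fun w => u (e.symm w))
      (Complex.reCLM.comp (ContinuousLinearMap.mul ℝ ℂ (η.coeff e z))) z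

/-- `∫_γ η = I` for a continuous path `γ` that avoids the poles: there is a primitive `F` of `η`
along `γ` (locally `F = G ∘ γ` with `dG = η`), and `I` is its increment. Such an `F` exists for
every path that avoids the poles, and is unique up to an additive constant. -/
def HasPathIntegral (η : MeromorphicForm X) (γ : unitInterval → X) (I : ℂ) : Prop :=
  ∃ F : unitInterval → ℂ,
    (∀ t, ∃ e ∈ atlas ℂ X, γ t ∈ e.source ∧ ∃ G : ℂ → ℂ,
      (∀ᶠ z in 𝓝 (e (γ t)), HasDerivAt G (η.coeff e z) z) ∧
      ∀ᶠ s in 𝓝 t, F s = G (e (γ s))) ∧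
    F 1 - F 0 = I

end MeromorphicForm

/-! ### Metrics of constant curvature one with conical singularities -/

/-- A conformal metric of constant Gauss curvature one with finitely many conical singularities.
In a chart `e` it is `(density e z)² |dz|²`; if `density = exp φ`, its curvature is `- e^{-2φ} Δφ`.
The metric represents the divisor `div`: at a point `p` with `div p = α - 1 ≠ 0` it has a conical
singularity of angle `2πα > 0`, which means that `φ - (α - 1) log |z - z(p)|` extends continuously
to `p`. Values of `density e` at singular points or outside `e.target` carry no meaning. -/
structure SphericalMetric (X : Type*) [TopologicalSpace X] [ChartedSpace ℂ X] where
  density : OpenPartialHomeomorph X ℂ → ℂ → ℝ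
  div : X →₀ ℝ
  neg_one_lt_div : ∀ p, -1 < div p
  transform : ∀ e ∈ atlas ℂ X, ∀ e' ∈ atlas ℂ X, ∀ z ∈ e.target, e.symm z ∈ e'.source →
    e.symm z ∉ div.support →
    density e z = density e' (e' (e.symm z)) * ‖deriv (fun w => e' (e.symm w)) z‖
  density_pos : ∀ e ∈ atlas ℂ X, ∀ z ∈ e.target, e.symm z ∉ div.support → 0 < density e z
  smooth : ∀ e ∈ atlas ℂ X, ∀ z ∈ e.target, e.symm z ∉ div.support →
    ContDiffAt ℝ ∞ (density e) z
  curvature_eq_one : ∀ e ∈ atlas ℂ X, ∀ z ∈ e.target, e.symm z ∉ div.support →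
    - (Laplacian.laplacian (fun w => Real.log (density e w)) z) / (density e z) ^ 2 = (1 : ℝ)
  conical : ∀ e ∈ atlas ℂ X, ∀ p ∈ e.source, p ∈ div.support →
    ∃ l : ℝ, Tendsto (fun z => Real.log (density e z) - div p * Real.log ‖z - e p‖)
      (𝓝[≠] (e p)) (𝓝 l)

/-- Two metrics are the same: they have the same singular points and angles and they agree at
every smooth point. -/
def SphericalMetric.Same {X : Type*} [TopologicalSpace X] [ChartedSpace ℂ X]
    (g g' : SphericalMetric X) : Prop :=
  g.div = g'.div ∧ ∀ e ∈ atlas ℂ X, ∀ z ∈ e.target, e.symm z ∉ g.div.support →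
    g.density e z = g'.density e z

/-- The complement of the singular points. -/
abbrev SphericalMetric.Regular {X : Type*} [TopologicalSpace X] [ChartedSpace ℂ X]
    (g : SphericalMetric X) : Type _ := {x : X // x ∉ g.div.support}

/-! ### Multi-valued functions and developing maps -/

/-- A multi-valued function on `Y` with values in the Riemann sphere: a function on the universal
cover of `Y`, that is, a function of paths from a base point that depends only on the homotopy
class of the path (with fixed ends). `f γ` is the value at the end of `γ` of the element obtained
by continuation along `γ`. -/
structure MultiFun (Y : Type*) [TopologicalSpace Y] (y₀ : Y) where
  toFun : ∀ {y : Y}, Path y₀ y → OnePoint ℂ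
  homotopic : ∀ {y : Y} (γ γ' : Path y₀ y), γ.Homotopic γ' → toFun γ = toFun γ'

/-- The monodromy of `f` belongs to the set `H` of self-maps of the sphere: continuation around a
loop `δ` at the base point changes `f` to `L ∘ f` for some `L ∈ H`. -/
def MultiFun.MonodromyIn {Y : Type*} [TopologicalSpace Y] {y₀ : Y} (f : MultiFun Y y₀)
    (H : Set (Equiv.Perm (OnePoint ℂ))) : Prop :=
  ∀ δ : Path y₀ y₀, ∃ L ∈ H, ∀ (y : Y) (γ : Path y₀ y), f.toFun (δ.trans γ) = L (f.toFun γ)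

/-- The orientation-preserving isometries of the round sphere: the fractional linear
transformations given by matrices in `SU(2)`. -/
def rotations : Set (Equiv.Perm (OnePoint ℂ)) :=
  {L | ∃ A : GL (Fin 2) ℂ, (A : Matrix (Fin 2) (Fin 2) ℂ) ∈ Matrix.specialUnitaryGroup (Fin 2) ℂ ∧
    ∀ w, L w = A • w}

/-- The maximal torus `U(1)` of diagonal rotations: the multiplications by unit complex numbers. -/
def diagonalRotations : Set (Equiv.Perm (OnePoint ℂ)) :=
  {L | ∃ u : ℂ, ‖u‖ = 1 ∧ ∀ w, L w = OnePoint.map (fun x => u * x) w}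

namespace SphericalMetric

variable {X : Type*} [TopologicalSpace X] [ChartedSpace ℂ X] {g : SphericalMetric X}
  {x₀ : g.Regular}

/-- Let `ι` be one of the two inverse charts of the sphere, the inclusion of `ℂ` or `recip`. Near
the end of `γ`, the function element of `f` obtained by continuation along `γ` is `ι (F z)` in the
coordinate `z = e`, with `F` holomorphic. -/
def IsBranch (ι : ℂ → OnePoint ℂ) (f : MultiFun g.Regular x₀) {x : g.Regular} (γ : Path x₀ x)
    (e : OpenPartialHomeomorph X ℂ) (F : ℂ → ℂ) : Prop :=
  AnalyticAt ℂ F (e x) ∧ ∃ U ∈ 𝓝 (x : X), ∀ (y : g.Regular) (σ : Path x y),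
    (∀ t, (σ t : X) ∈ U) → f.toFun (γ.trans σ) = ι (F (e y))

/-- `f` is a developing map of `g`: a multi-valued locally univalent meromorphic function on the
complement of the singular points with `g = f^* g_st`, where `g_st = 4 |dw|² / (1 + |w|²)²` on the
sphere. The expression of `g_st` is the same in the coordinates `w` and `1 / w`. -/
def IsDevelopingMap (g : SphericalMetric X) {x₀ : g.Regular} (f : MultiFun g.Regular x₀) : Prop :=
  ∀ (x : g.Regular) (γ : Path x₀ x), ∀ e ∈ atlas ℂ X, (x : X) ∈ e.source →
    ∃ (ι : ℂ → OnePoint ℂ) (F : ℂ → ℂ), (ι = OnePoint.some ∨ ι = recip) ∧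
      IsBranch ι f γ e F ∧ deriv F (e x) ≠ 0 ∧
      g.density e (e x) = 2 * ‖deriv F (e x)‖ / (1 + ‖F (e x)‖ ^ 2)

/-- `η = df / f`: this is required of every function element of `f`, at all points where its value
is neither `0` nor `∞`. -/
def HasLogDifferential (f : MultiFun g.Regular x₀) (η : MeromorphicForm X) : Prop :=
  ∀ (x : g.Regular) (γ : Path x₀ x), ∀ e ∈ atlas ℂ X, (x : X) ∈ e.source →
    ∀ F : ℂ → ℂ, IsBranch OnePoint.some f γ e F → F (e x) ≠ 0 →
      η.coeff e (e x) = deriv F (e x) / F (e x)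

/-- `f = c · exp (∫ η)`, the integral being taken along paths from the base point that avoid the
poles of `η`. -/
def IsExpIntegral (f : MultiFun g.Regular x₀) (η : MeromorphicForm X) (c : ℂ) : Prop :=
  ∀ (x : g.Regular) (γ : Path x₀ x), (∀ t, ¬ η.IsPole (γ t : X)) →
    ∃ I : ℂ, η.HasPathIntegral (fun t => (γ t : X)) I ∧
      f.toFun γ = ((c * Complex.exp I : ℂ) : OnePoint ℂ)

/-- The monodromy of a developing map belongs to an abelian group of rotations. -/
def IsAbelian (g : SphericalMetric X) : Prop :=
  ∃ (x₀ : g.Regular) (f : MultiFun g.Regular x₀), g.IsDevelopingMap f ∧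
    ∃ H : Subgroup (Equiv.Perm (OnePoint ℂ)), (H : Set (Equiv.Perm (OnePoint ℂ))) ⊆ rotations ∧
      (∀ a ∈ H, ∀ b ∈ H, a * b = b * a) ∧ f.MonodromyIn H

/-- The monodromy of a developing map is trivial. -/
def IsTrivial (g : SphericalMetric X) : Prop :=
  ∃ (x₀ : g.Regular) (f : MultiFun g.Regular x₀), g.IsDevelopingMap f ∧ f.MonodromyIn {1}

/-- `η` is a character 1-form of the abelian metric `g`: it is `df / f` for a developing map `f`
of `g`, which has to be multiplicative (with monodromy in `U(1)`) if `g` is non-trivial. -/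
def IsCharacterForm (g : SphericalMetric X) (η : MeromorphicForm X) : Prop :=
  ∃ (x₀ : g.Regular) (f : MultiFun g.Regular x₀), g.IsDevelopingMap f ∧
    (¬ g.IsTrivial → f.MonodromyIn diagonalRotations) ∧ HasLogDifferential f η

/-- `g = f^* g_st` with `f = c · exp (∫_{x₀} η)`, a multi-valued locally univalent meromorphic
function. -/
def IsPullbackExp (g : SphericalMetric X) (η : MeromorphicForm X) (x₀ : X) (c : ℂ) : Prop :=
  ∃ (hx : x₀ ∉ g.div.support) (f : MultiFun g.Regular ⟨x₀, hx⟩),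
    g.IsDevelopingMap f ∧ IsExpIntegral f η c

end SphericalMetric

end RSurf

end

open Set Filter Topology
open scoped Manifold ContDiff InnerProductSpace

noncomputable section

namespace RSurf

/-! ### Punctured discs -/

/-! Let `u` be a real function with `du = Re η` off the poles. A function `f` with `df / f = η` is
multi-valued, but its modulus is not: `|f| = C * exp u` for a constant `C > 0`. With `a` the
coefficient of `η`, the pull-back of the round metric therefore has density `2 |a| C e^u / (1 + C²
e^{2u})`, which involves only `η`, `u` and `C`. This is `HasExpDensity`, and most of the theorem is
read off from it.

Divisor: away from the poles `u` is continuous, so the density behaves like `|a|` and the exponent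
is the order of `η`. At a pole with residue `ρ`, `u` is `ρ log |z|` up to a bounded term and `|a|`
is comparable to `1 / |z|`. Since `R / (1 + R²)` is invariant under `R ↦ 1 / R`, the exponent is
`|ρ| - 1` for either sign of `ρ` (`HasExpDensity.div_eq`). In particular poles with residue `± 1`
are smooth points of the metric, and zeros of `η` are singular points.

Uniqueness: the density off a finite set determines the metric by continuity (`HasExpDensity.same`).
Conversely the metric determines `C`: two constants could give the same density only if `u` were
locally constant, that is, if `η` vanished there (`HasExpDensity.eq`). Evaluation at `x₀` turns `C`
into `r = C * exp (u x₀)`.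

Existence: the density is extended continuously to the smooth points (`IsCharacter.metric`). Near
each of them it is the pull-back of the round metric by an explicit local solution of `dw / w = η`,
so the curvature is one. Two such solutions that induce the same metric differ by a unit factor. The
local solutions thus form a locally constant `U(1)` system, and parallel transport in its covering
space yields a developing map (`exists_parallel_transport`, `exists_multiFun_isElement`). The same
rigidity gives uniqueness of `f` up to a unit factor and monodromy in `U(1)`.

Triviality: continuation along a loop off the poles multiplies `f` by `exp` of the period. If all
periods lie in `2πiℤ`, the monodromy is trivial, once loops have been deformed off the poles with
residue `± 1` (`exists_homotopic_avoiding`). Conversely, trivial monodromy of some developing map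
`k` passes to `f`, because two developing maps of one metric differ by a fractional linear map. That
is proved by polarization, treating `z` and `conj z` as independent variables
(`exists_gl_of_density_eq`). The single-valued `f` then extends across the zeros of `η`, and its
periods can be compared. A small circle about a pole has period `2πi` times the residue. -/

/-- The exponential maps the half-plane `Re z < log ε`, which is convex, onto the punctured disc
about `0`. -/
lemma isPathConnected_ball_diff_center (c : ℂ) {ε : ℝ} (h : 0 < ε) :
    IsPathConnected (Metric.ball c ε \ {c}) := by
  have : Metric.ball c ε \ {c} =
      (fun z : ℂ => c + Complex.exp z) '' {z : ℂ | z.re < Real.log ε} := by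
    ext w
    constructor
    · rintro ⟨hw, hwc⟩
      have hne : w - c ≠ 0 := sub_ne_zero.2 hwc
      refine ⟨Complex.log (w - c), ?_, by simp [Complex.exp_log hne]⟩
      simp only [mem_ofPred_eq, Complex.log_re]
      exact Real.log_lt_log (norm_pos_iff.2 hne) (by simpa [dist_eq_norm] using hw)
    · rintro ⟨z, hz, rfl⟩
      refine ⟨?_, by simp [Complex.exp_ne_zero]⟩
      simp only [Metric.mem_ball, dist_eq_norm, add_sub_cancel_left, Complex.norm_exp]
      exact (Real.lt_log_iff_exp_lt h).1 hz
  rw [this]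
  refine ((convex_halfSpace_re_lt _).isPathConnected ⟨((Real.log ε - 1 : ℝ) : ℂ), ?_⟩).image
    (by fun_prop)
  simp

lemma isPreconnected_ball_diff_center (c : ℂ) (ε : ℝ) :
    IsPreconnected (Metric.ball c ε \ {c}) := by
  rcases le_or_gt ε 0 with h | h
  · simp [Metric.ball_eq_empty.2 h, isPreconnected_empty]
  · exact (isPathConnected_ball_diff_center c h).isConnected.isPreconnected

lemma isOpen_ball_diff_center (c : ℂ) (ε : ℝ) : IsOpen (Metric.ball c ε \ {c}) :=
  Metric.isOpen_ball.sdiff isClosed_singleton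

lemma eventually_punctured_iff {p : ℂ → Prop} {c : ℂ} :
    (∀ᶠ z in 𝓝[≠] c, p z) ↔ ∃ ε > 0, ∀ z ∈ Metric.ball c ε \ {c}, p z := by
  rw [eventually_nhdsWithin_iff, Metric.eventually_nhds_iff_ball]
  exact exists_congr fun ε => and_congr_right fun _ =>
    ⟨fun h z hz => h z hz.1 hz.2, fun h z hz hz' => h z ⟨hz, hz'⟩⟩

lemma ball_diff_center_mem_nhds {c z : ℂ} {ε : ℝ} (hz : z ∈ Metric.ball c ε \ {c}) :
    Metric.ball c ε \ {c} ∈ 𝓝 z := (isOpen_ball_diff_center c ε).mem_nhds hz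

lemma eventually_eventually_punctured {p : ℂ → Prop} {c : ℂ} (h : ∀ᶠ z in 𝓝[≠] c, p z) :
    ∀ᶠ z in 𝓝[≠] c, ∀ᶠ w in 𝓝 z, p w := by
  obtain ⟨ε, hε, h⟩ := eventually_punctured_iff.1 h
  refine eventually_punctured_iff.2 ⟨ε, hε, fun z hz => ?_⟩
  filter_upwards [ball_diff_center_mem_nhds hz] using h

/-! ### Functions with values in the sphere -/

/-- Equality across the two charts becomes an equation between holomorphic functions, to which the
classical identity theorem applies; the case `b = 0` needs no separate treatment there. -/
lemma some_eq_recip_iff {a b : ℂ} : (a : OnePoint ℂ) = recip b ↔ a * b = 1 := by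
  unfold recip
  split_ifs with h
  · simp [h]
  · rw [OnePoint.coe_eq_coe, ← one_div, eq_div_iff h]

lemma recip_injective : Function.Injective recip := by
  intro a b h
  by_cases ha : a = 0
  · by_contra hb
    subst ha
    have : b ≠ 0 := fun h' => hb h'.symm
    simp [recip, this] at h
  · have : ((a⁻¹ : ℂ) : OnePoint ℂ) = recip b := by rw [← h]; simp [recip, ha]
    rw [some_eq_recip_iff] at this
    field_simp at this
    exact this.symm

lemma recip_eq_some_inv {a : ℂ} (h : a ≠ 0) : recip a = ((a⁻¹ : ℂ) : OnePoint ℂ) := by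
  simp [recip, h]

/-- The function is given near `z` by a holomorphic function in one of the charts of the sphere. -/
def SphereAnalyticAt (φ : ℂ → OnePoint ℂ) (z : ℂ) : Prop :=
  ∃ (ι : ℂ → OnePoint ℂ) (F : ℂ → ℂ), (ι = OnePoint.some ∨ ι = recip) ∧ AnalyticAt ℂ F z ∧
    φ =ᶠ[𝓝 z] fun w => ι (F w)

lemma SphereAnalyticAt.congr {φ ψ : ℂ → OnePoint ℂ} {z : ℂ} (h : SphereAnalyticAt φ z)
    (h' : ψ =ᶠ[𝓝 z] φ) : SphereAnalyticAt ψ z := by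
  obtain ⟨ι, F, hι, hF, e⟩ := h
  exact ⟨ι, F, hι, hF, h'.trans e⟩

lemma SphereAnalyticAt.eventually {φ : ℂ → OnePoint ℂ} {z : ℂ} (h : SphereAnalyticAt φ z) :
    ∀ᶠ w in 𝓝 z, SphereAnalyticAt φ w := by
  obtain ⟨ι, F, hι, hF, e⟩ := h
  filter_upwards [hF.eventually_analyticAt, e.eventually_nhds] with w h1 h2
  exact ⟨ι, F, hι, h1, h2⟩

lemma SphereAnalyticAt.comp {φ : ℂ → OnePoint ℂ} {g : ℂ → ℂ} {z : ℂ}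
    (h : SphereAnalyticAt φ (g z)) (hg : AnalyticAt ℂ g z) :
    SphereAnalyticAt (fun w => φ (g w)) z := by
  obtain ⟨ι, F, hι, hF, e⟩ := h
  exact ⟨ι, fun w => F (g w), hι, hF.comp hg, hg.continuousAt.eventually e⟩

lemma eventuallyEq_of_frequently_some_recip {F G : ℂ → ℂ} {z : ℂ} (hF : AnalyticAt ℂ F z)
    (hG : AnalyticAt ℂ G z) (h : ∃ᶠ w in 𝓝[≠] z, ((F w : ℂ) : OnePoint ℂ) = recip (G w)) :
    ∀ᶠ w in 𝓝 z, ((F w : ℂ) : OnePoint ℂ) = recip (G w) := by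
  simp only [some_eq_recip_iff] at h ⊢
  exact ((hF.mul hG).frequently_eq_iff_eventually_eq analyticAt_const).1 h

/-- The identity theorem for functions with values in the sphere. -/
lemma SphereAnalyticAt.eventuallyEq_of_frequently {φ ψ : ℂ → OnePoint ℂ} {z : ℂ}
    (hφ : SphereAnalyticAt φ z) (hψ : SphereAnalyticAt ψ z)
    (h : ∃ᶠ w in 𝓝[≠] z, φ w = ψ w) : φ =ᶠ[𝓝 z] ψ := by
  obtain ⟨ι, F, hι, hF, e⟩ := hφ
  obtain ⟨ι', G, hι', hG, e'⟩ := hψ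
  have h' : ∃ᶠ w in 𝓝[≠] z, ι (F w) = ι' (G w) := by
    refine (h.and_eventually (nhdsWithin_le_nhds (e.and e'))).mono ?_
    rintro w ⟨h1, h2, h3⟩
    exact h2.symm.trans (h1.trans h3)
  suffices ∀ᶠ w in 𝓝 z, ι (F w) = ι' (G w) by
    filter_upwards [e, e', this] with w h1 h2 h3
    rw [h1, h2, h3]
  rcases hι with rfl | rfl <;> rcases hι' with rfl | rfl
  · have := (hF.frequently_eq_iff_eventually_eq hG).1
      (h'.mono fun w hw => OnePoint.coe_injective hw)
    exact this.mono fun w hw => congrArg OnePoint.some hw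
  · exact eventuallyEq_of_frequently_some_recip hF hG h'
  · exact (eventuallyEq_of_frequently_some_recip hG hF (h'.mono fun w hw => hw.symm)).mono
      fun w hw => hw.symm
  · have := (hF.frequently_eq_iff_eventually_eq hG).1 (h'.mono fun w hw => recip_injective hw)
    exact this.mono fun w hw => congrArg recip hw

/-! ### Fractional linear transformations -/

def swapGL : GL (Fin 2) ℂ := Matrix.GeneralLinearGroup.mkOfDetNeZero !![0, 1; 1, 0] (by simp)

lemma swapGL_smul_some (w : ℂ) : swapGL • (w : OnePoint ℂ) = recip w := by
  rw [OnePoint.smul_some_eq_ite]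
  simp [swapGL, Matrix.GeneralLinearGroup.mkOfDetNeZero, recip]

def diagGL (c : ℂ) (hc : c ≠ 0) : GL (Fin 2) ℂ :=
  Matrix.GeneralLinearGroup.mkOfDetNeZero !![c, 0; 0, 1] (by simpa using hc)

lemma diagGL_smul (c : ℂ) (hc : c ≠ 0) (w : OnePoint ℂ) :
    diagGL c hc • w = OnePoint.map (fun x => c * x) w := by
  induction w using OnePoint.rec with
  | infty =>
    rw [OnePoint.smul_infty_eq_ite]
    simp [diagGL, Matrix.GeneralLinearGroup.mkOfDetNeZero]
  | coe w =>
    rw [OnePoint.smul_some_eq_ite]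
    simp [diagGL, Matrix.GeneralLinearGroup.mkOfDetNeZero]

lemma map_mul_map_mul (a b : ℂ) (w : OnePoint ℂ) : OnePoint.map (fun x => a * x)
    (OnePoint.map (fun x => b * x) w) = OnePoint.map (fun x => a * b * x) w := by
  induction w using OnePoint.rec with
  | infty => rfl
  | coe w => simp [mul_assoc]

lemma map_one_mul (w : OnePoint ℂ) : OnePoint.map (fun x : ℂ => 1 * x) w = w := by
  induction w using OnePoint.rec with
  | infty => rfl
  | coe w => simp

lemma map_mul_recip {c : ℂ} (hc : c ≠ 0) (w : ℂ) :
    OnePoint.map (fun x => c * x) (recip w) = recip (c⁻¹ * w) := by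
  unfold recip
  by_cases h : w = 0
  · simp [h]
  · simp [h, hc, mul_comm]

/-- The determinant is nonzero, so numerator and denominator have no common zero: where the
denominator vanishes, the inverted quotient is holomorphic and serves in the chart at infinity. -/
lemma SphereAnalyticAt.smul_some {F : ℂ → ℂ} {z : ℂ} (hF : AnalyticAt ℂ F z) (A : GL (Fin 2) ℂ) :
    SphereAnalyticAt (fun w => A • ((F w : ℂ) : OnePoint ℂ)) z := by
  have hd : A 0 0 * A 1 1 - A 0 1 * A 1 0 ≠ 0 := by
    have := A.det_ne_zero
    rwa [Matrix.det_fin_two] at this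
  have hden : AnalyticAt ℂ (fun w => A 1 0 * F w + A 1 1) z := by fun_prop
  have hnum : AnalyticAt ℂ (fun w => A 0 0 * F w + A 0 1) z := by fun_prop
  by_cases h : A 1 0 * F z + A 1 1 = 0
  · have h' : A 0 0 * F z + A 0 1 ≠ 0 := by
      intro h'
      apply hd
      by_cases h10 : A 1 0 = 0
      · have h11 : A 1 1 = 0 := by simpa [h10] using h
        simp [h10, h11]
      · have : F z = - A 1 1 / A 1 0 := by
          field_simp; linear_combination h
        rw [this] at h'
        field_simp at h'
        linear_combination -h'
    refine ⟨recip, _, Or.inr rfl, hden.div hnum h', ?_⟩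
    filter_upwards [hnum.continuousAt.eventually_ne h'] with w hw
    rw [OnePoint.smul_some_eq_ite]
    split_ifs with h1
    · simp [h1, recip]
    · exact ((recip_eq_some_inv (div_ne_zero h1 hw)).trans (by rw [inv_div])).symm
  · refine ⟨OnePoint.some, _, Or.inl rfl, hnum.div hden h, ?_⟩
    filter_upwards [hden.continuousAt.eventually_ne h] with w hw
    rw [OnePoint.smul_some_eq_ite, if_neg hw]
    rfl

/-- The chart `recip` is itself the action of the matrix `swapGL`, which reduces the second chart to
the first. -/
lemma SphereAnalyticAt.smul {φ : ℂ → OnePoint ℂ} {z : ℂ} (h : SphereAnalyticAt φ z)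
    (A : GL (Fin 2) ℂ) : SphereAnalyticAt (fun w => A • φ w) z := by
  obtain ⟨ι, F, rfl | rfl, hF, e⟩ := h
  · exact (SphereAnalyticAt.smul_some hF A).congr (e.mono fun w hw => congrArg (A • ·) hw)
  · refine (SphereAnalyticAt.smul_some hF (A * swapGL)).congr (e.mono fun w hw => ?_)
    simp only [hw, mul_smul, swapGL_smul_some]

lemma SphereAnalyticAt.map_mul {φ : ℂ → OnePoint ℂ} {z : ℂ} (h : SphereAnalyticAt φ z)
    {c : ℂ} (hc : c ≠ 0) : SphereAnalyticAt (fun w => OnePoint.map (fun x => c * x) (φ w)) z := by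
  simpa only [diagGL_smul] using h.smul (diagGL c hc)

/-! ### The pullback of the round metric -/

/-- The function is locally univalent at `z`, and the pullback of the round metric has density `d`
there. -/
def HasSphereDensity (φ : ℂ → OnePoint ℂ) (z : ℂ) (d : ℝ) : Prop :=
  ∃ (ι : ℂ → OnePoint ℂ) (F : ℂ → ℂ), (ι = OnePoint.some ∨ ι = recip) ∧ AnalyticAt ℂ F z ∧
    φ =ᶠ[𝓝 z] (fun w => ι (F w)) ∧ deriv F z ≠ 0 ∧ d = 2 * ‖deriv F z‖ / (1 + ‖F z‖ ^ 2)

/-- The map `w ↦ 1 / w` is an isometry of the round metric. -/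
lemma sphereDensity_of_mul_eq_one {F G : ℂ → ℂ} {z : ℂ} (hF : AnalyticAt ℂ F z)
    (h : ∀ᶠ w in 𝓝 z, F w * G w = 1) (h' : deriv F z ≠ 0) :
    deriv G z ≠ 0 ∧
      2 * ‖deriv F z‖ / (1 + ‖F z‖ ^ 2) = 2 * ‖deriv G z‖ / (1 + ‖G z‖ ^ 2) := by
  have h0 : F z ≠ 0 := left_ne_zero_of_mul (h.self_of_nhds.trans_ne one_ne_zero)
  have e : G =ᶠ[𝓝 z] fun w => (F w)⁻¹ := h.mono fun w hw => eq_inv_of_mul_eq_one_right hw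
  have hd : deriv G z = - deriv F z / F z ^ 2 := by
    rw [e.deriv_eq]
    exact (hF.differentiableAt.hasDerivAt.inv h0).deriv
  have hG : G z = (F z)⁻¹ := e.self_of_nhds
  refine ⟨by rw [hd]; exact div_ne_zero (neg_ne_zero.2 h') (pow_ne_zero _ h0), ?_⟩
  rw [hd, hG]
  have : ‖F z‖ ≠ 0 := norm_ne_zero_iff.2 h0
  simp only [norm_div, norm_neg, norm_pow, norm_inv]
  field_simp
  ring

/-- `HasSphereDensity` only asserts that some chart of the sphere works; this passes to any chart
expression of `φ`. The mixed cases rest on the isometry `w ↦ 1 / w`. -/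
lemma HasSphereDensity.eq_of_eventuallyEq {φ : ℂ → OnePoint ℂ} {z : ℂ} {d : ℝ}
    (h : HasSphereDensity φ z d) {ι : ℂ → OnePoint ℂ} {F : ℂ → ℂ}
    (hι : ι = OnePoint.some ∨ ι = recip) (e : φ =ᶠ[𝓝 z] fun w => ι (F w)) :
    deriv F z ≠ 0 ∧ d = 2 * ‖deriv F z‖ / (1 + ‖F z‖ ^ 2) := by
  obtain ⟨ι', G, hι', hG, e', hd, rfl⟩ := h
  have e2 : ∀ᶠ w in 𝓝 z, ι' (G w) = ι (F w) := by
    filter_upwards [e, e'] with w h1 h2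
    rw [← h1, h2]
  rcases hι with rfl | rfl <;> rcases hι' with rfl | rfl
  · have e3 : G =ᶠ[𝓝 z] F := e2.mono fun w hw => OnePoint.coe_injective hw
    rw [← e3.deriv_eq, ← e3.self_of_nhds]
    exact ⟨hd, rfl⟩
  · refine sphereDensity_of_mul_eq_one hG (e2.mono fun w hw => ?_) hd
    rw [mul_comm]
    exact some_eq_recip_iff.1 hw.symm
  · exact sphereDensity_of_mul_eq_one hG (e2.mono fun w hw => some_eq_recip_iff.1 hw) hd
  · have e3 : G =ᶠ[𝓝 z] F := e2.mono fun w hw => recip_injective hw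
    rw [← e3.deriv_eq, ← e3.self_of_nhds]
    exact ⟨hd, rfl⟩

lemma HasSphereDensity.sphereAnalyticAt {φ : ℂ → OnePoint ℂ} {z : ℂ} {d : ℝ}
    (h : HasSphereDensity φ z d) : SphereAnalyticAt φ z := by
  obtain ⟨ι, F, hι, hF, e, -, -⟩ := h
  exact ⟨ι, F, hι, hF, e⟩

/-- In the chart at infinity, multiplication by `c` becomes multiplication by `c⁻¹`, again of
modulus one. -/
lemma HasSphereDensity.map_mul {φ : ℂ → OnePoint ℂ} {z : ℂ} {d : ℝ}
    (h : HasSphereDensity φ z d) {c : ℂ} (hc : ‖c‖ = 1) :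
    HasSphereDensity (fun w => OnePoint.map (fun x => c * x) (φ w)) z d := by
  have hc0 : c ≠ 0 := by rintro rfl; simp at hc
  obtain ⟨ι, F, hι, hF, e, h1, rfl⟩ := h
  have h6 : ∃ b : ℂ, ‖b‖ = 1 ∧ ∀ w, OnePoint.map (fun w => c * w) (ι w) = ι (b * w) := by
    rcases hι with rfl | rfl
    · exact ⟨c, hc, fun w => rfl⟩
    · exact ⟨c⁻¹, by simp [hc], map_mul_recip hc0⟩
  obtain ⟨b, hb, h7⟩ := h6
  have hb0 : b ≠ 0 := by rintro rfl; simp at hb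
  have h4 : deriv (fun z => b * F z) z = b * deriv F z :=
    (hF.differentiableAt.hasDerivAt.const_mul b).deriv
  refine ⟨ι, fun z => b * F z, hι, analyticAt_const.mul hF, ?_, ?_, ?_⟩
  · filter_upwards [e] with w hw
    rw [hw, h7]
  · rw [h4]; exact mul_ne_zero hb0 h1
  · rw [h4, norm_mul, norm_mul, hb, one_mul, one_mul]

/-! ### Solutions of `dw / w = a dz` -/

/-- Near `z` the function is finite and nonzero, and its logarithmic derivative at `z` is `a z`. -/
def LogSol (a : ℂ → ℂ) (φ : ℂ → OnePoint ℂ) (z : ℂ) : Prop :=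
  ∃ w : ℂ → ℂ, (∀ᶠ y in 𝓝 z, φ y = (w y : OnePoint ℂ)) ∧ w z ≠ 0 ∧ HasDerivAt w (a z * w z) z

lemma LogSol.congr {a : ℂ → ℂ} {φ ψ : ℂ → OnePoint ℂ} {z : ℂ} (h : LogSol a φ z)
    (e : ψ =ᶠ[𝓝 z] φ) : LogSol a ψ z := by
  obtain ⟨w, h1, h2, h3⟩ := h
  exact ⟨w, by filter_upwards [e, h1] with y h4 h5; rw [h4, h5], h2, h3⟩

lemma LogSol.comp {a b : ℂ → ℂ} {φ : ℂ → OnePoint ℂ} {g : ℂ → ℂ} {z : ℂ}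
    (h : LogSol b φ (g z)) (hg : DifferentiableAt ℂ g z) (hab : a z = b (g z) * deriv g z) :
    LogSol a (fun y => φ (g y)) z := by
  obtain ⟨w, h1, h2, h3⟩ := h
  refine ⟨fun y => w (g y), hg.continuousAt.eventually h1, h2, ?_⟩
  have := h3.comp z hg.hasDerivAt
  refine this.congr_deriv ?_
  rw [hab]; ring

/-- The finite part of a point of the sphere, with the value `0` at infinity. -/
def finitePart (x : OnePoint ℂ) : ℂ := OnePoint.elim x 0 id

@[simp] lemma finitePart_some (w : ℂ) : finitePart (w : OnePoint ℂ) = w := rfl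

lemma LogSol.finitePart_spec {a : ℂ → ℂ} {φ : ℂ → OnePoint ℂ} {z : ℂ} (h : LogSol a φ z) :
    φ z = (finitePart (φ z) : OnePoint ℂ) ∧ finitePart (φ z) ≠ 0 ∧
      HasDerivAt (fun y => finitePart (φ y)) (a z * finitePart (φ z)) z := by
  obtain ⟨w, h1, h2, h3⟩ := h
  have h0 := h1.self_of_nhds
  refine ⟨by rw [h0]; rfl, by rw [h0]; exact h2, ?_⟩
  have e : (fun y => finitePart (φ y)) =ᶠ[𝓝 z] w := h1.mono fun y hy => congrArg finitePart hy
  rw [h0]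
  exact h3.congr_of_eventuallyEq e

/-- Two solutions on a connected open set are proportional. -/
lemma LogSol.exists_const_mul {a : ℂ → ℂ} {φ ψ : ℂ → OnePoint ℂ} {s : Set ℂ} (hs : IsOpen s)
    (hs' : IsPreconnected s) (hφ : ∀ z ∈ s, LogSol a φ z) (hψ : ∀ z ∈ s, LogSol a ψ z)
    (hne : s.Nonempty) :
    ∃ c : ℂ, c ≠ 0 ∧ ∀ z ∈ s, ψ z = OnePoint.map (fun x => c * x) (φ z) := by
  have hd : ∀ z ∈ s, HasDerivAt (fun y => finitePart (ψ y) / finitePart (φ y)) 0 z := by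
    intro z hz
    obtain ⟨-, h1, h2⟩ := (hφ z hz).finitePart_spec
    obtain ⟨-, h3, h4⟩ := (hψ z hz).finitePart_spec
    refine (h4.div h2 h1).congr_deriv ?_
    field_simp
    ring
  obtain ⟨c, hc⟩ := hs.exists_is_const_of_deriv_eq_zero hs'
    (fun z hz => (hd z hz).differentiableAt.differentiableWithinAt)
    (fun z hz => (hd z hz).deriv)
  have key : ∀ z ∈ s, finitePart (ψ z) = c * finitePart (φ z) := fun z hz => by
    rw [← hc z hz, div_mul_cancel₀ _ (hφ z hz).finitePart_spec.2.1]
  refine ⟨c, ?_, fun z hz => ?_⟩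
  · rintro rfl
    obtain ⟨z, hz⟩ := hne
    exact (hψ z hz).finitePart_spec.2.1 (by simp [key z hz])
  · rw [(hφ z hz).finitePart_spec.1, (hψ z hz).finitePart_spec.1, key z hz]
    rfl

/-- Two solutions on a punctured neighbourhood are proportional. -/
lemma LogSol.exists_const_mul_punctured {a : ℂ → ℂ} {φ ψ : ℂ → OnePoint ℂ} {z : ℂ}
    (hφ : ∀ᶠ y in 𝓝[≠] z, LogSol a φ y) (hψ : ∀ᶠ y in 𝓝[≠] z, LogSol a ψ y) :
    ∃ c : ℂ, c ≠ 0 ∧ ∀ᶠ y in 𝓝[≠] z, ψ y = OnePoint.map (fun x => c * x) (φ y) := by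
  obtain ⟨ε, hε, h⟩ := eventually_punctured_iff.1 (hφ.and hψ)
  have hne : (Metric.ball z ε \ {z}).Nonempty := by
    have : ∀ᶠ y in 𝓝[≠] z, y ∈ Metric.ball z ε \ {z} :=
      eventually_punctured_iff.2 ⟨ε, hε, fun _ h => h⟩
    exact this.exists
  obtain ⟨c, hc, h'⟩ := LogSol.exists_const_mul (isOpen_ball_diff_center z ε)
    (isPreconnected_ball_diff_center z ε) (fun y hy => (h y hy).1) (fun y hy => (h y hy).2) hne
  exact ⟨c, hc, eventually_punctured_iff.2 ⟨ε, hε, h'⟩⟩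

/-- A meromorphic solution of `dw / w = a dz` near `z`. -/
def LogGerm (a : ℂ → ℂ) (φ : ℂ → OnePoint ℂ) (z : ℂ) : Prop :=
  SphereAnalyticAt φ z ∧ ∀ᶠ y in 𝓝[≠] z, LogSol a φ y

lemma LogGerm.congr {a : ℂ → ℂ} {φ ψ : ℂ → OnePoint ℂ} {z : ℂ} (h : LogGerm a φ z)
    (e : ψ =ᶠ[𝓝 z] φ) : LogGerm a ψ z := by
  refine ⟨h.1.congr e, ?_⟩
  filter_upwards [h.2, eventually_eventually_punctured (nhdsWithin_le_nhds e)] with y h1 h2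
  exact h1.congr h2

/-- The ratio is constant on a punctured neighbourhood, where both functions are finite and nonzero.
The identity theorem on the sphere carries the relation across `z`, where they may be `0` or `∞`. -/
lemma LogGerm.exists_const_mul {a : ℂ → ℂ} {φ ψ : ℂ → OnePoint ℂ} {z : ℂ}
    (hφ : LogGerm a φ z) (hψ : LogGerm a ψ z) :
    ∃ c : ℂ, c ≠ 0 ∧ ∀ᶠ y in 𝓝 z, ψ y = OnePoint.map (fun x => c * x) (φ y) := by
  obtain ⟨c, hc, h⟩ := LogSol.exists_const_mul_punctured hφ.2 hψ.2
  exact ⟨c, hc, hψ.1.eventuallyEq_of_frequently (hφ.1.map_mul hc) h.frequently⟩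

lemma LogGerm.eventually {a : ℂ → ℂ} {φ : ℂ → OnePoint ℂ} {z : ℂ} (h : LogGerm a φ z) :
    ∀ᶠ y in 𝓝 z, LogGerm a φ y := by
  have h2 : ∀ᶠ y in 𝓝 z, y ∈ ({z}ᶜ : Set ℂ) → ∀ᶠ w in 𝓝 y, LogSol a φ w :=
    eventually_nhdsWithin_iff.1 (eventually_eventually_punctured h.2)
  filter_upwards [h.1.eventually, h2] with y h3 h4
  refine ⟨h3, ?_⟩
  by_cases hy : y = z
  · rw [hy]; exact h.2
  · exact nhdsWithin_le_nhds (h4 hy)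

lemma LogSol.map_mul {a : ℂ → ℂ} {φ : ℂ → OnePoint ℂ} {z : ℂ} (h : LogSol a φ z) {c : ℂ}
    (hc : c ≠ 0) : LogSol a (fun y => OnePoint.map (fun x => c * x) (φ y)) z := by
  obtain ⟨w, h1, h2, h3⟩ := h
  refine ⟨fun y => c * w y, h1.mono fun y hy => congrArg _ hy, mul_ne_zero hc h2, ?_⟩
  exact (h3.const_mul c).congr_deriv (by ring)

lemma LogGerm.map_mul {a : ℂ → ℂ} {φ : ℂ → OnePoint ℂ} {z : ℂ} (h : LogGerm a φ z) {c : ℂ}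
    (hc : c ≠ 0) : LogGerm a (fun y => OnePoint.map (fun x => c * x) (φ y)) z :=
  ⟨h.1.map_mul hc, h.2.mono fun _ hy => hy.map_mul hc⟩

lemma eventually_punctured_comp {g : ℂ → ℂ} {z : ℂ} (hg : AnalyticAt ℂ g z) (hg' : deriv g z ≠ 0)
    {p : ℂ → Prop} (h : ∀ᶠ y in 𝓝[≠] (g z), p y) : ∀ᶠ y in 𝓝[≠] z, p (g y) := by
  have : Tendsto g (𝓝[≠] z) (𝓝[≠] (g z)) :=
    hg.differentiableAt.hasDerivAt.tendsto_nhdsNE hg'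
  exact this.eventually h

lemma LogGerm.comp {a b : ℂ → ℂ} {φ : ℂ → OnePoint ℂ} {g : ℂ → ℂ} {z : ℂ}
    (h : LogGerm b φ (g z)) (hg : AnalyticAt ℂ g z) (hg' : deriv g z ≠ 0)
    (hab : ∀ᶠ y in 𝓝 z, a y = b (g y) * deriv g y) : LogGerm a (fun y => φ (g y)) z := by
  refine ⟨h.1.comp hg, ?_⟩
  filter_upwards [eventually_punctured_comp hg hg' h.2, nhdsWithin_le_nhds hab,
    nhdsWithin_le_nhds hg.eventually_analyticAt] with y h1 h2 h3
  exact h1.comp h3.differentiableAt h2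

lemma logSol_some {a w : ℂ → ℂ} {z : ℂ} (h : w z ≠ 0) (h' : HasDerivAt w (a z * w z) z) :
    LogSol a (fun y => (w y : OnePoint ℂ)) z :=
  ⟨w, Eventually.of_forall fun _ => rfl, h, h'⟩

lemma logSol_recip {a w : ℂ → ℂ} {z : ℂ} (h : w z ≠ 0) (h' : HasDerivAt w (-a z * w z) z) :
    LogSol a (fun y => recip (w y)) z := by
  refine ⟨fun y => (w y)⁻¹, ?_, inv_ne_zero h, ?_⟩
  · filter_upwards [h'.continuousAt.eventually_ne h] with y hy
    exact recip_eq_some_inv hy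
  · refine (h'.inv h).congr_deriv ?_
    field_simp

/-! ### Local normal forms of the coefficient -/

/-- A function with a primitive near `z`, up to a simple pole at `z` with residue `ρ`. -/
def HasSimplePoleExpansion (a : ℂ → ℂ) (ρ : ℂ) (K : ℂ → ℂ) (z : ℂ) : Prop :=
  AnalyticAt ℂ K z ∧ ∀ᶠ y in 𝓝[≠] z, a y = ρ / (y - z) + deriv K y

lemma exists_primitive_of_analyticAt {k : ℂ → ℂ} {z : ℂ} (hk : AnalyticAt ℂ k z) :
    ∃ K : ℂ → ℂ, AnalyticAt ℂ K z ∧ ∀ᶠ y in 𝓝 z, HasDerivAt K (k y) y := by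
  obtain ⟨ε, hε, h⟩ := Metric.eventually_nhds_iff_ball.1 hk.eventually_analyticAt
  have hd : DifferentiableOn ℂ k (Metric.ball z ε) := fun y hy =>
    (h y hy).differentiableAt.differentiableWithinAt
  obtain ⟨K, hK⟩ := hd.isExactOn_ball
  have hb := Metric.ball_mem_nhds z hε
  refine ⟨K, ?_, ?_⟩
  · rw [Complex.analyticAt_iff_eventually_differentiableAt]
    filter_upwards [hb] with y hy using (hK y hy).differentiableAt
  · filter_upwards [hb] with y hy using hK y hy

/-- By hypothesis `(y - z) * a y` extends holomorphically to `z` with value `ρ`. Its difference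
quotient at `z` is `a y - ρ / (y - z)`, which is thus holomorphic and has a primitive `K`. -/
lemma exists_simplePoleExpansion {a : ℂ → ℂ} {ρ z : ℂ} (ha : MeromorphicAt a z)
    (h : Tendsto (fun y => (y - z) * a y) (𝓝[≠] z) (𝓝 ρ)) :
    ∃ K, HasSimplePoleExpansion a ρ K z := by
  set q : ℂ → ℂ := Function.update (fun y => (y - z) * a y) z ρ with hq
  have e : q =ᶠ[𝓝[≠] z] fun y => (y - z) * a y := by
    filter_upwards [self_mem_nhdsWithin] with y hy
    exact Function.update_of_ne hy _ _
  have hqm : MeromorphicAt q z :=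
    (((analyticAt_id.sub analyticAt_const).meromorphicAt.mul ha).congr e.symm)
  have hqc : ContinuousAt q z := continuousAt_update_same.2 h
  have hqa : AnalyticAt ℂ q z := hqm.analyticAt hqc
  have hk : AnalyticAt ℂ (dslope q z) z := by
    rw [Complex.analyticAt_iff_eventually_differentiableAt]
    obtain ⟨ε, hε, hb⟩ := Metric.eventually_nhds_iff_ball.1 hqa.eventually_analyticAt
    have : DifferentiableOn ℂ (dslope q z) (Metric.ball z ε) :=
      (Complex.differentiableOn_dslope (Metric.ball_mem_nhds z hε)).2 fun y hy =>
        (hb y hy).differentiableAt.differentiableWithinAt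
    filter_upwards [Metric.ball_mem_nhds z hε] with y hy
    exact this.differentiableAt (Metric.isOpen_ball.mem_nhds hy)
  obtain ⟨K, hK, hK'⟩ := exists_primitive_of_analyticAt hk
  refine ⟨K, hK, ?_⟩
  filter_upwards [nhdsWithin_le_nhds hK', e, self_mem_nhdsWithin] with y h1 h2 h3
  have h4 : y - z ≠ 0 := sub_ne_zero.2 h3
  rw [h1.deriv, dslope_of_ne _ h3, slope_def_field, h2]
  simp only [hq, Function.update_self]
  field_simp
  ring

/-- This is `d log |W| = Re (dW / W)`, computed through `log |W|² / 2` because `|W|²` is smooth. -/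
lemma hasFDerivAt_log_norm {W : ℂ → ℂ} {W' z : ℂ} (h : HasDerivAt W W' z) (h0 : W z ≠ 0) :
    HasFDerivAt (fun y => Real.log ‖W y‖)
      (Complex.reCLM.comp (ContinuousLinearMap.mul ℝ ℂ (W' / W z))) z := by
  have h1 : HasFDerivAt W (ContinuousLinearMap.mul ℝ ℂ W') z := by
    have := h.hasFDerivAt.restrictScalars ℝ
    refine this.congr_fderiv ?_
    ext
    simp [mul_comm]
  have h2 := (h1.norm_sq.log (by positivity)).const_mul (1 / 2 : ℝ)
  have e : (fun y => (1 / 2 : ℝ) * Real.log (‖W y‖ ^ 2)) = fun y => Real.log ‖W y‖ := by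
    funext y
    rw [Real.log_pow]; push_cast; ring
  rw [e] at h2
  refine h2.congr_fderiv ?_
  ext v
  have h3 : (‖W z‖ ^ 2 : ℝ) = Complex.normSq (W z) := by rw [Complex.normSq_eq_norm_sq]
  simp [h3, Complex.div_re, Complex.div_im, Complex.mul_re]
  ring

/-- Evaluate at `1` and at `I`. A holomorphic form is determined by its real part; this is how `df /
f` is recovered from `log |f|`. -/
lemma reCLM_comp_mul_injective {a b : ℂ}
    (h : Complex.reCLM.comp (ContinuousLinearMap.mul ℝ ℂ a) =
      Complex.reCLM.comp (ContinuousLinearMap.mul ℝ ℂ b)) : a = b := by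
  have h1 := DFunLike.congr_fun h 1
  have h2 := DFunLike.congr_fun h Complex.I
  apply Complex.ext
  · simpa using h1
  · simpa using h2

lemma reCLM_comp_mul_add (a b : ℂ) : Complex.reCLM.comp (ContinuousLinearMap.mul ℝ ℂ (a + b)) =
    Complex.reCLM.comp (ContinuousLinearMap.mul ℝ ℂ a) +
      Complex.reCLM.comp (ContinuousLinearMap.mul ℝ ℂ b) := by
  ext v; simp

lemma hasFDerivAt_re_of_hasDerivAt {K : ℂ → ℂ} {k z : ℂ} (h : HasDerivAt K k z) :
    HasFDerivAt (fun y => (K y).re) (Complex.reCLM.comp (ContinuousLinearMap.mul ℝ ℂ k)) z := by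
  have h1 : HasFDerivAt K (ContinuousLinearMap.mul ℝ ℂ k) z := by
    refine (h.hasFDerivAt.restrictScalars ℝ).congr_fderiv ?_
    ext
    simp [mul_comm]
  exact Complex.reCLM.hasFDerivAt.comp z h1

/-- A real primitive of `Re (a dz)` near a simple pole with real residue. -/
lemma HasSimplePoleExpansion.exists_re {a K : ℂ → ℂ} {ρ : ℝ} {z : ℂ} {u : ℂ → ℝ}
    (h : HasSimplePoleExpansion a ρ K z)
    (hu : ∀ᶠ y in 𝓝[≠] z,
      HasFDerivAt u (Complex.reCLM.comp (ContinuousLinearMap.mul ℝ ℂ (a y))) y) :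
    ∃ c : ℝ, ∀ᶠ y in 𝓝[≠] z, u y = ρ * Real.log ‖y - z‖ + (K y).re + c := by
  obtain ⟨ε, hε, hb⟩ := eventually_punctured_iff.1
    ((hu.and h.2).and (nhdsWithin_le_nhds h.1.eventually_analyticAt))
  have hd : ∀ y ∈ Metric.ball z ε \ {z},
      HasFDerivAt (fun y => u y - (ρ * Real.log ‖y - z‖ + (K y).re)) (0 : ℂ →L[ℝ] ℝ) y := by
    intro y hy
    obtain ⟨⟨h1, h2⟩, h3⟩ := hb y hy
    have h4 : y - z ≠ 0 := sub_ne_zero.2 hy.2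
    have h5 := (hasFDerivAt_log_norm ((hasDerivAt_id y).sub_const z) h4).const_mul ρ
    have h6 := hasFDerivAt_re_of_hasDerivAt h3.differentiableAt.hasDerivAt
    refine (h1.sub (h5.add h6)).congr_fderiv ?_
    rw [h2]
    ext v
    have : (ρ / (y - z) * v : ℂ) = ρ * (1 / (y - z) * v) := by ring
    simp only [id, reCLM_comp_mul_add, sub_apply, add_apply,
      ContinuousLinearMap.comp_apply, ContinuousLinearMap.mul_apply', smul_apply,
      Complex.reCLM_apply, zero_apply, this, Complex.re_ofReal_mul, smul_eq_mul]
    ring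
  obtain ⟨c, hc⟩ := (isOpen_ball_diff_center z ε).exists_is_const_of_fderiv_eq_zero
    (isPreconnected_ball_diff_center z ε)
    (fun y hy => (hd y hy).differentiableAt.differentiableWithinAt)
    (fun y hy => (hd y hy).fderiv)
  refine ⟨c, eventually_punctured_iff.2 ⟨ε, hε, fun y hy => ?_⟩⟩
  have := hc y hy
  linarith

/-! ### The density of `exp (∫ η)` -/

/-- The density `2 |w'| / (1 + |w|²)` if `|w' / w| = A` and `|w| = R`. -/
def expDensity (A R : ℝ) : ℝ := 2 * A * R / (1 + R ^ 2)

/-- The metric side of the isometry `w ↦ 1 / w`; it lets a pole of `f` be treated as a zero of `1 /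
f`. -/
lemma expDensity_inv (A : ℝ) {R : ℝ} (hR : R ≠ 0) : expDensity A R⁻¹ = expDensity A R := by
  unfold expDensity
  field_simp
  ring

lemma sphereDensity_eq_expDensity {F : ℂ → ℂ} {z b : ℂ} (h : deriv F z = b * F z) :
    2 * ‖deriv F z‖ / (1 + ‖F z‖ ^ 2) = expDensity ‖b‖ ‖F z‖ := by
  rw [h, norm_mul, expDensity]; ring

lemma log_expDensity_exp {A : ℝ} (hA : 0 < A) (U : ℝ) :
    Real.log (expDensity A (Real.exp U)) =
      Real.log 2 + Real.log A + (U - Real.log (1 + Real.exp (2 * U))) := by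
  unfold expDensity
  have : Real.exp U ^ 2 = Real.exp (2 * U) := by rw [← Real.exp_nat_mul]; norm_num
  rw [this, Real.log_div (by positivity) (by positivity), Real.log_mul (by positivity)
    (by positivity), Real.log_mul (by positivity) hA.ne', Real.log_exp]
  ring

/-- The symmetry `R ↦ 1 / R` for `R = exp U`. It is the source of the absolute value of the residue
in the cone angle. -/
lemma sub_log_one_add_exp_neg (U : ℝ) :
    U - Real.log (1 + Real.exp (2 * U)) = -U - Real.log (1 + Real.exp (2 * -U)) := by
  have : 1 + Real.exp (2 * U) = Real.exp (2 * U) * (1 + Real.exp (2 * -U)) := by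
    rw [mul_add, ← Real.exp_add]; simp [add_comm]
  rw [this, Real.log_mul (by positivity) (by positivity), Real.log_exp]
  ring

lemma tendsto_log_norm_sub (z : ℂ) : Tendsto (fun y => Real.log ‖y - z‖) (𝓝[≠] z) atBot :=
  Real.tendsto_log_nhdsNE_zero.comp (tendsto_norm_sub_self_nhdsNE z |>.mono_right
    (nhdsWithin_mono _ fun _ (hx : (0 : ℝ) < _) => ne_of_gt hx))

/-- For `ρ > 0` the function `U` tends to `-∞`, so the logarithmic correction tends to `0`. -/
lemma tendsto_sub_log_one_add_exp_of_pos {z : ℂ} {ρ h₀ : ℝ} (hρ : 0 < ρ) {U h : ℂ → ℝ}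
    (hU : ∀ᶠ y in 𝓝[≠] z, U y = ρ * Real.log ‖y - z‖ + h y) (hh : Tendsto h (𝓝[≠] z) (𝓝 h₀)) :
    Tendsto (fun y => U y - Real.log (1 + Real.exp (2 * U y)) - ρ * Real.log ‖y - z‖)
      (𝓝[≠] z) (𝓝 h₀) := by
  have hU' : Tendsto U (𝓝[≠] z) atBot :=
    (((tendsto_log_norm_sub z).const_mul_atBot hρ).atBot_add hh).congr'
      (hU.mono fun y hy => hy.symm)
  have h1 : Tendsto (fun y => Real.log (1 + Real.exp (2 * U y))) (𝓝[≠] z) (𝓝 0) := by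
    have := Real.tendsto_exp_atBot.comp (hU'.const_mul_atBot (two_pos (α := ℝ)))
    have := (this.const_add 1).log (by norm_num)
    simpa using this
  have h2 := hh.sub h1
  rw [sub_zero] at h2
  refine h2.congr' (hU.mono fun y hy => ?_)
  have : h y = U y - ρ * Real.log ‖y - z‖ := by linarith
  rw [this]; ring

/-- The asymptotics of the density at a simple pole. -/
lemma exists_tendsto_log_expDensity_pole {z : ℂ} {ρ h₀ : ℝ} {ρ' : ℂ} (hρ : ρ ≠ 0) (hρ' : ρ' ≠ 0)
    {U h : ℂ → ℝ} {a : ℂ → ℂ}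
    (ha : Tendsto (fun y => (y - z) * a y) (𝓝[≠] z) (𝓝 ρ'))
    (hU : ∀ᶠ y in 𝓝[≠] z, U y = ρ * Real.log ‖y - z‖ + h y) (hh : Tendsto h (𝓝[≠] z) (𝓝 h₀)) :
    ∃ l, Tendsto (fun y => Real.log (expDensity ‖a y‖ (Real.exp (U y))) -
      (|ρ| - 1) * Real.log ‖y - z‖) (𝓝[≠] z) (𝓝 l) := by
  have h1 : ∃ l, Tendsto (fun y => U y - Real.log (1 + Real.exp (2 * U y)) -
      |ρ| * Real.log ‖y - z‖) (𝓝[≠] z) (𝓝 l) := by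
    rcases lt_or_gt_of_ne hρ with hneg | hpos
    · have h2 := tendsto_sub_log_one_add_exp_of_pos (neg_pos.2 hneg) (U := fun y => -U y)
        (h := fun y => - h y) (hU.mono fun y hy => by rw [hy]; ring) hh.neg
      rw [abs_of_neg hneg]
      refine ⟨_, h2.congr fun y => ?_⟩
      rw [sub_log_one_add_exp_neg (U y)]
    · rw [abs_of_pos hpos]
      exact ⟨_, tendsto_sub_log_one_add_exp_of_pos hpos hU hh⟩
  obtain ⟨l, hl⟩ := h1
  -- Hence `log |a y|` is `- log |y - z|` up to a convergent term; this contributes the `- 1` in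
  -- `|ρ| - 1`.
  have h2 : Tendsto (fun y => Real.log ‖(y - z) * a y‖) (𝓝[≠] z) (𝓝 (Real.log ‖ρ'‖)) :=
    ha.norm.log (norm_ne_zero_iff.2 hρ')
  refine ⟨_, ((hl.add h2).const_add (Real.log 2)).congr' ?_⟩
  filter_upwards [ha.eventually_ne hρ', self_mem_nhdsWithin] with y hy hyz
  have ha0 : a y ≠ 0 := right_ne_zero_of_mul hy
  have hy0 : y - z ≠ 0 := sub_ne_zero.2 hyz
  rw [log_expDensity_exp (norm_pos_iff.2 ha0), norm_mul,
    Real.log_mul (norm_ne_zero_iff.2 hy0) (norm_ne_zero_iff.2 ha0)]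
  ring

/-- The asymptotics of the density at a zero, and at points that are neither zeros nor poles. -/
lemma exists_tendsto_log_expDensity {z : ℂ} {k : ℤ} {U₀ : ℝ} {U : ℂ → ℝ} {a : ℂ → ℂ}
    (ha : MeromorphicAt a z) (hk : meromorphicOrderAt a z = k)
    (hU : Tendsto U (𝓝[≠] z) (𝓝 U₀)) :
    ∃ l, Tendsto (fun y => Real.log (expDensity ‖a y‖ (Real.exp (U y))) -
      k * Real.log ‖y - z‖) (𝓝[≠] z) (𝓝 l) := by
  obtain ⟨g, hg, hg0, he⟩ := (meromorphicOrderAt_eq_int_iff ha).1 hk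
  have h1 : Tendsto (fun y => U y - Real.log (1 + Real.exp (2 * U y))) (𝓝[≠] z)
      (𝓝 (U₀ - Real.log (1 + Real.exp (2 * U₀)))) :=
    hU.sub ((((hU.const_mul 2).rexp).const_add 1).log (by positivity))
  have hgc : Tendsto g (𝓝[≠] z) (𝓝 (g z)) := hg.continuousAt.tendsto.mono_left nhdsWithin_le_nhds
  have h2 : Tendsto (fun y => Real.log ‖g y‖) (𝓝[≠] z) (𝓝 (Real.log ‖g z‖)) :=
    hgc.norm.log (norm_ne_zero_iff.2 hg0)
  refine ⟨_, ((h1.add h2).const_add (Real.log 2)).congr' ?_⟩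
  filter_upwards [he, hgc.eventually_ne hg0, self_mem_nhdsWithin] with y hy hy1 hyz
  have hy0 : y - z ≠ 0 := sub_ne_zero.2 hyz
  have ha0 : a y ≠ 0 := by rw [hy]; exact smul_ne_zero (zpow_ne_zero _ hy0) hy1
  rw [log_expDensity_exp (norm_pos_iff.2 ha0), hy, norm_smul, norm_zpow,
    Real.log_mul (zpow_ne_zero _ (norm_ne_zero_iff.2 hy0)) (norm_ne_zero_iff.2 hy1), Real.log_zpow]
  ring

/-- The exponent of a conical singularity is determined by the density. -/
lemma exponent_unique {z : ℂ} {D : ℂ → ℝ} {α β l l' : ℝ}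
    (h : Tendsto (fun y => D y - α * Real.log ‖y - z‖) (𝓝[≠] z) (𝓝 l))
    (h' : Tendsto (fun y => D y - β * Real.log ‖y - z‖) (𝓝[≠] z) (𝓝 l')) : α = β := by
  by_contra hne
  have h1 : Tendsto (fun y => (β - α) * Real.log ‖y - z‖) (𝓝[≠] z) (𝓝 (l - l')) :=
    (h.sub h').congr fun y => by ring
  have h2 : Tendsto (fun y => Real.log ‖y - z‖) (𝓝[≠] z) (𝓝 ((β - α)⁻¹ * (l - l'))) :=
    (h1.const_mul (β - α)⁻¹).congr fun y => by
      rw [inv_mul_cancel_left₀ (sub_ne_zero.2 (Ne.symm hne))]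
  exact not_tendsto_nhds_of_tendsto_atBot (tendsto_log_norm_sub z) _ h2

/-! ### Local models at the poles with residue `± 1` and away from the poles -/

lemma logSol_exp {a K : ℂ → ℂ} {z : ℂ} (h : HasDerivAt K (a z) z) :
    LogSol a (fun y => ((Complex.exp (K y) : ℂ) : OnePoint ℂ)) z :=
  logSol_some (Complex.exp_ne_zero _) (h.cexp.congr_deriv (mul_comm _ _))

lemma logGerm_exp {a K : ℂ → ℂ} {z : ℂ} (h : ∀ᶠ y in 𝓝 z, HasDerivAt K (a y) y) :
    LogGerm a (fun y => ((Complex.exp (K y) : ℂ) : OnePoint ℂ)) z := by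
  have hK : AnalyticAt ℂ K z := by
    rw [Complex.analyticAt_iff_eventually_differentiableAt]
    exact h.mono fun y hy => hy.differentiableAt
  exact ⟨⟨_, _, Or.inl rfl, hK.cexp, EventuallyEq.rfl⟩,
    nhdsWithin_le_nhds (h.mono fun y hy => logSol_exp hy)⟩

/-- The exponential of a primitive is a reference solution; the nonzero factor relating `φ` to it is
absorbed as `log c`. -/
lemma LogGerm.exists_eq_exp {a : ℂ → ℂ} {φ : ℂ → OnePoint ℂ} {z : ℂ} (h : LogGerm a φ z)
    (ha : AnalyticAt ℂ a z) : ∃ K : ℂ → ℂ, (∀ᶠ y in 𝓝 z, HasDerivAt K (a y) y) ∧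
      ∀ᶠ y in 𝓝 z, φ y = ((Complex.exp (K y) : ℂ) : OnePoint ℂ) := by
  obtain ⟨K, hK, hK'⟩ := exists_primitive_of_analyticAt ha
  obtain ⟨c, hc, h1⟩ := (logGerm_exp hK').exists_const_mul h
  refine ⟨fun y => Complex.log c + K y, hK'.mono fun y hy => hy.const_add _, h1.mono fun y hy => ?_⟩
  rw [hy, Complex.exp_add, Complex.exp_log hc]
  rfl

lemma hasDerivAt_mul_exp {K : ℂ → ℂ} {C z y : ℂ} {k : ℂ} (hK : HasDerivAt K k y) (hy : y ≠ z) :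
    HasDerivAt (fun y => C * ((y - z) * Complex.exp (K y)))
      ((1 / (y - z) + k) * (C * ((y - z) * Complex.exp (K y)))) y := by
  have h0 : y - z ≠ 0 := sub_ne_zero.2 hy
  refine ((((hasDerivAt_id y).sub_const z).mul hK.cexp).const_mul C).congr_deriv ?_
  simp only [id]
  field_simp

lemma deriv_mul_exp_center {K : ℂ → ℂ} {C z : ℂ} (hK : AnalyticAt ℂ K z) :
    deriv (fun y => C * ((y - z) * Complex.exp (K y))) z = C * Complex.exp (K z) := by
  have := (((hasDerivAt_id z).sub_const z).mul hK.differentiableAt.hasDerivAt.cexp).const_mul C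
  refine this.deriv.trans ?_
  simp

lemma analyticAt_mul_exp {K : ℂ → ℂ} {C z : ℂ} (hK : AnalyticAt ℂ K z) :
    AnalyticAt ℂ (fun y => C * ((y - z) * Complex.exp (K y))) z :=
  analyticAt_const.mul ((analyticAt_id.sub analyticAt_const).mul hK.cexp)

/-- For residue one, `exp (∫ dy / (y - z))` is the single-valued function `y - z`, up to a constant.
The solution extends over the pole of the form with a simple zero. -/
lemma HasSimplePoleExpansion.logGerm_one {a K : ℂ → ℂ} {z : ℂ}
    (h : HasSimplePoleExpansion a 1 K z) {C : ℂ} (hC : C ≠ 0) :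
    LogGerm a (fun y => ((C * ((y - z) * Complex.exp (K y)) : ℂ) : OnePoint ℂ)) z := by
  refine ⟨⟨_, _, Or.inl rfl, analyticAt_mul_exp h.1, EventuallyEq.rfl⟩, ?_⟩
  filter_upwards [h.2, nhdsWithin_le_nhds h.1.eventually_analyticAt, self_mem_nhdsWithin]
    with y h1 h2 h3
  refine logSol_some (mul_ne_zero hC (mul_ne_zero (sub_ne_zero.2 h3) (Complex.exp_ne_zero _))) ?_
  rw [h1]
  exact hasDerivAt_mul_exp h2.differentiableAt.hasDerivAt h3

/-- Now the solution has a simple pole. Its reciprocal solves the equation for `-a`, whose residue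
is one and whose regular part has primitive `-K`. -/
lemma HasSimplePoleExpansion.logGerm_neg_one {a K : ℂ → ℂ} {z : ℂ}
    (h : HasSimplePoleExpansion a (-1) K z) {C : ℂ} (hC : C ≠ 0) :
    LogGerm a (fun y => recip (C * ((y - z) * Complex.exp (-K y)))) z := by
  refine ⟨⟨_, _, Or.inr rfl, analyticAt_mul_exp h.1.neg, EventuallyEq.rfl⟩, ?_⟩
  filter_upwards [h.2, nhdsWithin_le_nhds h.1.eventually_analyticAt, self_mem_nhdsWithin]
    with y h1 h2 h3
  refine logSol_recip (mul_ne_zero hC (mul_ne_zero (sub_ne_zero.2 h3) (Complex.exp_ne_zero _))) ?_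
  refine (hasDerivAt_mul_exp (K := fun y => -K y) h2.differentiableAt.hasDerivAt.neg h3).congr_deriv ?_
  rw [h1]; ring

/-! ### Curvature -/

/-- Reduces directional derivatives to derivatives of functions of one real variable; the Laplacian
below is computed by applying this twice. -/
lemma fderiv_apply_eq_of_hasDerivAt_line {g : ℂ → ℝ} {w v : ℂ} {d : ℝ}
    (hg : DifferentiableAt ℝ g w) (h : HasDerivAt (fun t : ℝ => g (w + t * v)) d 0) :
    fderiv ℝ g w v = d := by
  have h1 : HasDerivAt (fun t : ℝ => w + t * v) v 0 := by
    simpa using ((Complex.ofRealCLM.hasDerivAt (x := (0 : ℝ))).mul_const v).const_add w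
  have h2 : HasFDerivAt g (fderiv ℝ g w) (w + ((0 : ℝ) : ℂ) * v) := by
    simpa using hg.hasFDerivAt
  exact (h2.comp_hasDerivAt 0 h1).unique h

lemma hasDerivAt_comp_line {F : ℂ → ℂ} {w v F' : ℂ} (h : HasDerivAt F F' w) :
    HasDerivAt (fun t : ℝ => F (w + t * v)) (F' * v) 0 := by
  have h1 : HasDerivAt (fun t : ℝ => w + t * v) v 0 := by
    simpa using ((Complex.ofRealCLM.hasDerivAt (x := (0 : ℝ))).mul_const v).const_add w
  have h2 : HasDerivAt F F' (w + ((0 : ℝ) : ℂ) * v) := by simpa using h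
  exact h2.comp 0 h1

lemma contDiffAt_one_add_norm_sq {F : ℂ → ℂ} {z : ℂ} (hF : AnalyticAt ℂ F z) :
    ContDiffAt ℝ ∞ (fun w => 1 + ‖F w‖ ^ 2) z :=
  contDiffAt_const.add ((hF.contDiffAt (n := ∞)).restrict_scalars ℝ |>.norm_sq ℝ)

/-- Add the second derivatives in the directions `1` and `I`. The terms with the second derivative
of `F` cancel since `I² = -1`, and the squared inner products add up to `|F|² |F'|²`. -/
lemma laplacian_log_one_add_norm_sq {F : ℂ → ℂ} {z : ℂ} (hF : AnalyticAt ℂ F z) :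
    Laplacian.laplacian (fun w => Real.log (1 + ‖F w‖ ^ 2)) z =
      4 * ‖deriv F z‖ ^ 2 / (1 + ‖F z‖ ^ 2) ^ 2 := by
  set L : ℂ → ℝ := fun w => Real.log (1 + ‖F w‖ ^ 2) with hL
  have hLs : ContDiffAt ℝ ∞ L z := (contDiffAt_one_add_norm_sq hF).log (by positivity)
  have hfd : ∀ v : ℂ, ∀ᶠ w in 𝓝 z, fderiv ℝ L w v =
      2 * inner ℝ (F w) (deriv F w * v) / (1 + ‖F w‖ ^ 2) := by
    intro v
    filter_upwards [hF.eventually_analyticAt] with w hw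
    have hLw : ContDiffAt ℝ ∞ L w := (contDiffAt_one_add_norm_sq hw).log (by positivity)
    refine fderiv_apply_eq_of_hasDerivAt_line (hLw.differentiableAt (by simp)) ?_
    have h1 := hasDerivAt_comp_line (v := v) hw.differentiableAt.hasDerivAt
    have h2 := (h1.norm_sq.const_add 1).log (by positivity)
    simpa using h2
  have hdiff : DifferentiableAt ℝ (fderiv ℝ L) z :=
    (hLs.fderiv_right (m := 1) (by norm_cast)).differentiableAt (by simp)
  have hsecond : ∀ v : ℂ, iteratedFDeriv ℝ 2 L z ![v, v] =
      2 * (‖deriv F z * v‖ ^ 2 + inner ℝ (F z) (deriv (deriv F) z * v * v)) / (1 + ‖F z‖ ^ 2)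
        - (2 * inner ℝ (F z) (deriv F z * v)) ^ 2 / (1 + ‖F z‖ ^ 2) ^ 2 := by
    intro v
    rw [iteratedFDeriv_two_apply]
    simp only [Matrix.cons_val_zero, Matrix.cons_val_one]
    have h1 : fderiv ℝ (fderiv ℝ L) z v v = fderiv ℝ (fun w => fderiv ℝ L w v) z v := by
      rw [fderiv_clm_apply hdiff (differentiableAt_const v)]
      simp
    rw [h1]
    refine fderiv_apply_eq_of_hasDerivAt_line (hdiff.clm_apply (differentiableAt_const v)) ?_
    have hline : Tendsto (fun t : ℝ => z + t * v) (𝓝 0) (𝓝 z) := by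
      have : Continuous (fun t : ℝ => z + t * v) := by fun_prop
      simpa using this.tendsto 0
    have h2 := hasDerivAt_comp_line (v := v) hF.differentiableAt.hasDerivAt
    have h3 := (hasDerivAt_comp_line (v := v) hF.deriv.differentiableAt.hasDerivAt).mul_const v
    have h4 := ((h2.inner ℝ h3).const_mul 2).div (h2.norm_sq.const_add 1) (by positivity)
    refine (h4.congr_of_eventuallyEq ((hline.eventually (hfd v)).mono fun t ht => ht)).congr_deriv ?_
    simp only [Complex.ofReal_zero, zero_mul, add_zero, real_inner_self_eq_norm_sq]
    have : (1 + ‖F z‖ ^ 2 : ℝ) ≠ 0 := by positivity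
    field_simp
    ring
  rw [InnerProductSpace.laplacian_eq_iteratedFDeriv_complexPlane]
  simp only [hsecond]
  have hn : ∀ w : ℂ, ‖w‖ ^ 2 = w.re ^ 2 + w.im ^ 2 := fun w => by
    rw [← Complex.normSq_eq_norm_sq, Complex.normSq_apply]; ring
  have h0 : (1 + ‖F z‖ ^ 2 : ℝ) ≠ 0 := by positivity
  rw [hn] at h0
  simp only [hn, Complex.inner, Complex.mul_re, Complex.mul_im, Complex.I_re, Complex.I_im,
    Complex.conj_re, Complex.conj_im, Complex.one_re, Complex.one_im]
  field_simp
  ring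

lemma contDiffAt_sphereDensity {F : ℂ → ℂ} {z : ℂ} (hF : AnalyticAt ℂ F z) (h : deriv F z ≠ 0) :
    ContDiffAt ℝ ∞ (fun w => 2 * ‖deriv F w‖ / (1 + ‖F w‖ ^ 2)) z := by
  have h1 : ContDiffAt ℝ ∞ (deriv F) z := (hF.deriv.contDiffAt (n := ∞)).restrict_scalars ℝ
  exact (contDiffAt_const.mul (h1.norm ℝ h)).div (contDiffAt_one_add_norm_sq hF) (by positivity)

/-- The pullback of the round metric has curvature one. -/
lemma curvature_sphereDensity {F : ℂ → ℂ} {z : ℂ} (hF : AnalyticAt ℂ F z) (h : deriv F z ≠ 0) :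
    - Laplacian.laplacian (fun w => Real.log (2 * ‖deriv F w‖ / (1 + ‖F w‖ ^ 2))) z /
      (2 * ‖deriv F z‖ / (1 + ‖F z‖ ^ 2)) ^ 2 = 1 := by
  -- As `log |F'|` is harmonic, only `- log (1 + |F|²)` contributes to the Laplacian.
  have hh := hF.deriv.harmonicAt_log_norm h
  have hLs : ContDiffAt ℝ 2 (fun w => Real.log (1 + ‖F w‖ ^ 2)) z :=
    ((contDiffAt_one_add_norm_sq hF).log (by positivity)).of_le (by norm_cast)
  have e : (fun w => Real.log (2 * ‖deriv F w‖ / (1 + ‖F w‖ ^ 2))) =ᶠ[𝓝 z]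
      ((fun _ => Real.log 2) + fun w => Real.log ‖deriv F w‖) -
        fun w => Real.log (1 + ‖F w‖ ^ 2) := by
    filter_upwards [hF.deriv.continuousAt.eventually_ne h] with w hw
    have := norm_ne_zero_iff.2 hw
    simp only [Pi.sub_apply, Pi.add_apply]
    rw [Real.log_div (by positivity) (by positivity), Real.log_mul (by norm_num) this]
  have hc : ContDiffAt ℝ 2 (fun _ : ℂ => Real.log 2) z := contDiffAt_const
  rw [(InnerProductSpace.laplacian_congr_nhds e).self_of_nhds,
    ContDiffAt.laplacian_sub (f₁ := (fun _ => Real.log 2) + fun w => Real.log ‖deriv F w‖)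
      (hc.add hh.1) hLs, hc.laplacian_add hh.1,
    InnerProductSpace.laplacian_const, hh.2.self_of_nhds, laplacian_log_one_add_norm_sq hF]
  have := norm_ne_zero_iff.2 h
  simp only [Pi.zero_apply]
  have h0 : (1 + ‖F z‖ ^ 2 : ℝ) ≠ 0 := by positivity
  field_simp
  ring

/-! ### Rigidity: local isometries of the sphere -/

lemma eqOn_zero_of_forall_real {g : ℂ → ℂ} {δ : ℝ}
    (hg : DifferentiableOn ℂ g (Metric.ball 0 δ)) (h : ∀ t : ℝ, |t| < δ → g t = 0) :
    ∀ w ∈ Metric.ball (0 : ℂ) δ, g w = 0 := by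
  intro w hw
  have hδ : 0 < δ := Metric.pos_of_mem_ball hw
  have hfreq : ∃ᶠ w in 𝓝[≠] (0 : ℂ), g w = 0 := by
    have ht : Tendsto (fun t : ℝ => (t : ℂ)) (𝓝[≠] 0) (𝓝[≠] 0) := by
      refine tendsto_nhdsWithin_iff.2 ⟨?_, ?_⟩
      · exact (Complex.continuous_ofReal.tendsto' 0 0 (by simp)).mono_left nhdsWithin_le_nhds
      · filter_upwards [self_mem_nhdsWithin] with t ht
        simpa using ht
    refine ht.frequently (Eventually.frequently ?_)
    filter_upwards [nhdsWithin_le_nhds (Metric.ball_mem_nhds (0 : ℝ) hδ)] with t ht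
    exact h t (by simpa using ht)
  exact (hg.analyticOnNhd Metric.isOpen_ball).eqOn_zero_of_preconnected_of_frequently_eq_zero
    (convex_ball _ _).isPreconnected (Metric.mem_ball_self hδ) hfreq hw

/-- A holomorphic function of two variables that vanishes on `v = conj z` vanishes. -/
lemma polarization {Φ : ℂ × ℂ → ℂ} {z₀ : ℂ} {ε : ℝ} (hε : 0 < ε)
    (hΦ : DifferentiableOn ℂ Φ (Metric.ball z₀ ε ×ˢ Metric.ball (starRingEnd ℂ z₀) ε))
    (h : ∀ z ∈ Metric.ball z₀ ε, Φ (z, starRingEnd ℂ z) = 0) :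
    ∀ᶠ z in 𝓝 z₀, Φ (z, starRingEnd ℂ z₀) = 0 := by
  -- In these linear coordinates the locus `v = conj z` is the set where `a` and `b` are both real.
  -- The vanishing extends from real to complex values in one variable at a time.
  set P : ℂ → ℂ → ℂ × ℂ := fun a b =>
    (z₀ + (a + Complex.I * b), starRingEnd ℂ z₀ + (a - Complex.I * b)) with hP
  have hmem : ∀ a ∈ Metric.ball (0 : ℂ) (ε / 2), ∀ b ∈ Metric.ball (0 : ℂ) (ε / 2),
      P a b ∈ Metric.ball z₀ ε ×ˢ Metric.ball (starRingEnd ℂ z₀) ε := by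
    intro a ha b hb
    rw [mem_ball_zero_iff] at ha hb
    constructor
    · simp only [hP, Metric.mem_ball, dist_eq_norm, add_sub_cancel_left]
      refine (norm_add_le _ _).trans_lt ?_
      simp only [norm_mul, Complex.norm_I, one_mul]
      linarith
    · simp only [hP, Metric.mem_ball, dist_eq_norm, add_sub_cancel_left]
      refine (norm_sub_le _ _).trans_lt ?_
      simp only [norm_mul, Complex.norm_I, one_mul]
      linarith
  have hreal : ∀ s t : ℝ, |s| < ε / 2 → |t| < ε / 2 → Φ (P s t) = 0 := by
    intro s t hs ht
    have h1 : P s t = (z₀ + (s + Complex.I * t),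
        starRingEnd ℂ (z₀ + (s + Complex.I * t))) := by
      simp only [hP, map_add, map_mul, Complex.conj_I, Complex.conj_ofReal]
      ring_nf
    have h2 := (hmem s (by simpa using hs) t (by simpa using ht)).1
    rw [h1] at h2 ⊢
    exact h _ h2
  have hone : ∀ b : ℝ, |b| < ε / 2 → ∀ a ∈ Metric.ball (0 : ℂ) (ε / 2), Φ (P a b) = 0 := by
    intro b hb
    refine eqOn_zero_of_forall_real (g := fun a => Φ (P a b)) ?_ fun t ht => hreal t b ht hb
    refine hΦ.comp ?_ fun a ha => hmem a ha b (by simpa using hb)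
    simp only [hP]
    fun_prop
  have htwo : ∀ a ∈ Metric.ball (0 : ℂ) (ε / 2), ∀ b ∈ Metric.ball (0 : ℂ) (ε / 2),
      Φ (P a b) = 0 := by
    intro a ha
    refine eqOn_zero_of_forall_real (g := fun b => Φ (P a b)) ?_ fun t ht => hone t ht a ha
    refine hΦ.comp ?_ fun b hb => hmem a ha b hb
    simp only [hP]
    fun_prop
  filter_upwards [Metric.ball_mem_nhds z₀ hε] with z hz
  rw [Metric.mem_ball, dist_eq_norm] at hz
  -- These values solve `a + I b = z - z₀` and `a - I b = 0`, so that `P a b = (z, conj z₀)`.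
  have h1 := htwo ((z - z₀) / 2) (by rw [mem_ball_zero_iff, norm_div, Complex.norm_two]; linarith)
    ((z - z₀) / (2 * Complex.I)) (by
      rw [mem_ball_zero_iff, norm_div, norm_mul, Complex.norm_two, Complex.norm_I]; linarith)
  have h2 : Complex.I * ((z - z₀) / (2 * Complex.I)) = (z - z₀) / 2 := by
    field_simp [Complex.I_ne_zero]
  simp only [hP, h2] at h1
  convert h1 using 3 <;> ring

/-- A positive multiple of a matrix in `SU(2)`, hence a rotation of the sphere; it moves `a` to `0`.
-/
def rotationGL (a : ℂ) : GL (Fin 2) ℂ :=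
  Matrix.GeneralLinearGroup.mkOfDetNeZero !![1, -a; starRingEnd ℂ a, 1] (by
    rw [Matrix.det_fin_two_of]
    have : (1 * 1 - -a * starRingEnd ℂ a : ℂ) = ((1 + Complex.normSq a : ℝ) : ℂ) := by
      rw [neg_mul, Complex.mul_conj]; push_cast; ring
    rw [this]
    exact_mod_cast (add_pos_of_pos_of_nonneg one_pos (Complex.normSq_nonneg a)).ne')

lemma rotationGL_smul {a w : ℂ} (h : 1 + starRingEnd ℂ a * w ≠ 0) :
    rotationGL a • (w : OnePoint ℂ) =
      (((w - a) / (1 + starRingEnd ℂ a * w) : ℂ) : OnePoint ℂ) := by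
  rw [OnePoint.smul_some_eq_ite]
  rw [add_comm] at h
  simp [rotationGL, Matrix.GeneralLinearGroup.mkOfDetNeZero, h, sub_eq_add_neg, add_comm (1 : ℂ)]

lemma one_add_conj_mul_self_ne_zero (a : ℂ) : 1 + starRingEnd ℂ a * a ≠ 0 := by
  rw [mul_comm, Complex.mul_conj]
  exact_mod_cast (add_pos_of_pos_of_nonneg one_pos (Complex.normSq_nonneg a)).ne'

lemma ofReal_one_add_norm_sq (w : ℂ) : ((1 + ‖w‖ ^ 2 : ℝ) : ℂ) = 1 + w * starRingEnd ℂ w := by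
  rw [Complex.mul_conj, Complex.normSq_eq_norm_sq]; push_cast; ring

lemma hasDerivAt_rotation {F : ℂ → ℂ} {a z : ℂ} (hF : DifferentiableAt ℂ F z)
    (h : 1 + starRingEnd ℂ a * F z ≠ 0) :
    HasDerivAt (fun y => (F y - a) / (1 + starRingEnd ℂ a * F y))
      (deriv F z * (1 + starRingEnd ℂ a * a) / (1 + starRingEnd ℂ a * F z) ^ 2) z := by
  refine ((hF.hasDerivAt.sub_const a).div ((hF.hasDerivAt.const_mul _).const_add 1) h).congr_deriv ?_
  congr 1
  ring

/-- Two holomorphic functions that induce the same metric differ by a fractional linear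
transformation. -/
lemma exists_gl_of_density_eq {F H : ℂ → ℂ} {z₀ : ℂ} (hF : AnalyticAt ℂ F z₀)
    (hH : AnalyticAt ℂ H z₀) (hF' : deriv F z₀ ≠ 0) (hH' : deriv H z₀ ≠ 0)
    (h : ∀ᶠ z in 𝓝 z₀, 2 * ‖deriv F z‖ / (1 + ‖F z‖ ^ 2) = 2 * ‖deriv H z‖ / (1 + ‖H z‖ ^ 2)) :
    ∃ A : GL (Fin 2) ℂ, ∀ᶠ z in 𝓝 z₀, (F z : OnePoint ℂ) = A • (H z : OnePoint ℂ) := by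
  set conj := starRingEnd ℂ with hconj
  obtain ⟨ε, hε, hb⟩ := Metric.eventually_nhds_iff_ball.1
    ((hF.eventually_analyticAt.and hH.eventually_analyticAt).and h)
  -- The squared equality of densities is an identity in `z` and `conj z`. By polarization, `conj z`
  -- may be frozen at `conj z₀` while `z` varies.
  have hpol : ∀ᶠ z in 𝓝 z₀, deriv F z * conj (deriv F z₀) * (1 + H z * conj (H z₀)) ^ 2 -
      deriv H z * conj (deriv H z₀) * (1 + F z * conj (F z₀)) ^ 2 = 0 := by
    have key := polarization (z₀ := z₀) hε (Φ := fun p =>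
      deriv F p.1 * conj (deriv F (conj p.2)) * (1 + H p.1 * conj (H (conj p.2))) ^ 2 -
        deriv H p.1 * conj (deriv H (conj p.2)) * (1 + F p.1 * conj (F (conj p.2))) ^ 2) ?_ ?_
    · simpa [hconj] using key
    · have h1 : ∀ G : ℂ → ℂ, (∀ z ∈ Metric.ball z₀ ε, AnalyticAt ℂ G z) →
          DifferentiableOn ℂ (fun p : ℂ × ℂ => G p.1)
            (Metric.ball z₀ ε ×ˢ Metric.ball (conj z₀) ε) := fun G hG p hp =>
        ((hG p.1 hp.1).differentiableAt.comp p differentiableAt_fst).differentiableWithinAt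
      -- The function `v ↦ conj (G (conj v))` is holomorphic.
      have h2 : ∀ G : ℂ → ℂ, (∀ z ∈ Metric.ball z₀ ε, AnalyticAt ℂ G z) →
          DifferentiableOn ℂ (fun p : ℂ × ℂ => conj (G (conj p.2)))
            (Metric.ball z₀ ε ×ˢ Metric.ball (conj z₀) ε) := by
        intro G hG p hp
        have h3 : conj p.2 ∈ Metric.ball z₀ ε := by
          have := hp.2
          rw [Metric.mem_ball, dist_eq_norm] at this ⊢
          rw [← Complex.norm_conj, map_sub, hconj, Complex.conj_conj]
          exact this
        have h4 := (hG _ h3).differentiableAt.conj_conj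
        rw [hconj, Complex.conj_conj] at h4
        exact (DifferentiableAt.comp p (g := fun v => conj (G (conj v))) h4
          differentiableAt_snd).differentiableWithinAt
      have hFa := fun z hz => (hb z hz).1.1
      have hHa := fun z hz => (hb z hz).1.2
      exact (((h1 _ fun z hz => (hFa z hz).deriv).mul (h2 _ fun z hz => (hFa z hz).deriv)).mul
        (((differentiableOn_const 1).add ((h1 _ hHa).mul (h2 _ hHa))).pow 2)).sub
        (((h1 _ fun z hz => (hHa z hz).deriv).mul (h2 _ fun z hz => (hHa z hz).deriv)).mul
        (((differentiableOn_const 1).add ((h1 _ hFa).mul (h2 _ hFa))).pow 2))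
    · intro z hz
      have h1 := (hb z hz).2
      rw [div_eq_div_iff (by positivity) (by positivity)] at h1
      have h2 : ‖deriv F z‖ ^ 2 * (1 + ‖H z‖ ^ 2) ^ 2 =
          ‖deriv H z‖ ^ 2 * (1 + ‖F z‖ ^ 2) ^ 2 := by
        have h3 : ‖deriv F z‖ * (1 + ‖H z‖ ^ 2) = ‖deriv H z‖ * (1 + ‖F z‖ ^ 2) := by linarith
        rw [← mul_pow, ← mul_pow, h3]
      have h3 := congrArg (fun t : ℝ => (t : ℂ)) h2
      simp only [Complex.ofReal_mul, Complex.ofReal_pow, ofReal_one_add_norm_sq] at h3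
      simp only [hconj, Complex.conj_conj]
      simp only [Complex.mul_conj, Complex.normSq_eq_norm_sq] at h3 ⊢
      push_cast at h3 ⊢
      rw [h3]; ring
  set a := F z₀ with ha
  set b := H z₀ with hb'
  have hFn : ∀ᶠ z in 𝓝 z₀, 1 + conj a * F z ≠ 0 :=
    (continuousAt_const.add (continuousAt_const.mul hF.continuousAt)).eventually_ne
      (one_add_conj_mul_self_ne_zero a)
  have hHn : ∀ᶠ z in 𝓝 z₀, 1 + conj b * H z ≠ 0 :=
    (continuousAt_const.add (continuousAt_const.mul hH.continuousAt)).eventually_ne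
      (one_add_conj_mul_self_ne_zero b)
  have hcF : conj (deriv F z₀) ≠ 0 := (map_ne_zero conj).2 hF'
  have hcH : conj (deriv H z₀) ≠ 0 := (map_ne_zero conj).2 hH'
  have hna := one_add_conj_mul_self_ne_zero a
  have hnb := one_add_conj_mul_self_ne_zero b
  -- Rotate so that `F` and `H` both vanish at `z₀`. The polarized identity then says that the
  -- derivatives of the rotated functions have the constant ratio `k`, so the functions themselves
  -- do.
  set k : ℂ := conj (deriv H z₀) * (1 + conj a * a) / (conj (deriv F z₀) * (1 + conj b * b)) with hk
  have hk0 : k ≠ 0 := div_ne_zero (mul_ne_zero hcH hna) (mul_ne_zero hcF hnb)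
  have hder : ∀ᶠ z in 𝓝 z₀, HasDerivAt (fun y => (F y - a) / (1 + conj a * F y) -
      k * ((H y - b) / (1 + conj b * H y))) 0 z := by
    filter_upwards [hpol, hFn, hHn, hF.eventually_analyticAt, hH.eventually_analyticAt]
      with z h1 h2 h3 h4 h5
    refine ((hasDerivAt_rotation h4.differentiableAt h2).sub
      ((hasDerivAt_rotation h5.differentiableAt h3).const_mul k)).congr_deriv ?_
    rw [← hconj, sub_eq_zero, hk, ← mul_div_assoc, div_mul_eq_mul_div, div_div,
      div_eq_div_iff (pow_ne_zero _ h2)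
        (mul_ne_zero (mul_ne_zero hcF hnb) (pow_ne_zero _ h3))]
    linear_combination (1 + conj a * a) * (1 + conj b * b) * h1
  obtain ⟨δ, hδ, hd⟩ := Metric.eventually_nhds_iff_ball.1 hder
  obtain ⟨c, hc⟩ := Metric.isOpen_ball.exists_is_const_of_deriv_eq_zero
    (convex_ball z₀ δ).isPreconnected
    (fun z hz => (hd z hz).differentiableAt.differentiableWithinAt) (fun z hz => (hd z hz).deriv)
  have hc0 : c = 0 := by
    rw [← hc z₀ (Metric.mem_ball_self hδ)]
    simp [← ha, ← hb']
  refine ⟨(rotationGL a)⁻¹ * diagGL k hk0 * rotationGL b, ?_⟩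
  filter_upwards [Metric.ball_mem_nhds z₀ hδ, hFn, hHn] with z hz h1 h2
  have h3 := hc z hz
  rw [hc0, sub_eq_zero] at h3
  rw [mul_smul, mul_smul, rotationGL_smul h2, diagGL_smul, OnePoint.map_some, eq_inv_smul_iff,
    rotationGL_smul h1]
  exact congrArg _ h3

/-- Two developing maps of the same metric differ by a fractional linear transformation. -/
lemma exists_gl_of_hasSphereDensity {φ ψ : ℂ → OnePoint ℂ} {z₀ : ℂ} {d : ℂ → ℝ}
    (hφ : ∀ᶠ z in 𝓝 z₀, HasSphereDensity φ z (d z))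
    (hψ : ∀ᶠ z in 𝓝 z₀, HasSphereDensity ψ z (d z)) :
    ∃ A : GL (Fin 2) ℂ, ∀ᶠ z in 𝓝 z₀, φ z = A • ψ z := by
  obtain ⟨ι, F, hι, hF, e⟩ := hφ.self_of_nhds.sphereAnalyticAt
  obtain ⟨ι', H, hι', hH, e'⟩ := hψ.self_of_nhds.sphereAnalyticAt
  have h1 : ∀ᶠ z in 𝓝 z₀, deriv F z ≠ 0 ∧ d z = 2 * ‖deriv F z‖ / (1 + ‖F z‖ ^ 2) := by
    filter_upwards [hφ, e.eventually_nhds] with z h1 h2 using h1.eq_of_eventuallyEq hι h2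
  have h2 : ∀ᶠ z in 𝓝 z₀, deriv H z ≠ 0 ∧ d z = 2 * ‖deriv H z‖ / (1 + ‖H z‖ ^ 2) := by
    filter_upwards [hψ, e'.eventually_nhds] with z h1 h2 using h1.eq_of_eventuallyEq hι' h2
  obtain ⟨A, hA⟩ := exists_gl_of_density_eq hF hH h1.self_of_nhds.1 h2.self_of_nhds.1
    (by filter_upwards [h1, h2] with z h3 h4 using h3.2.symm.trans h4.2)
  have aux : ∀ {ι : ℂ → OnePoint ℂ}, (ι = OnePoint.some ∨ ι = recip) →
      ∃ S : GL (Fin 2) ℂ, ∀ w : ℂ, ι w = S • (w : OnePoint ℂ) := by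
    rintro ι (rfl | rfl)
    · exact ⟨1, fun w => by rw [one_smul]⟩
    · exact ⟨swapGL, fun w => (swapGL_smul_some w).symm⟩
  obtain ⟨S, hS⟩ := aux hι
  obtain ⟨S', hS'⟩ := aux hι'
  refine ⟨S * A * S'⁻¹, ?_⟩
  filter_upwards [e, e', hA] with z h3 h4 h5
  rw [h3, h4, hS, hS', h5, mul_smul, mul_smul, inv_smul_smul]

/-! ### Charts -/

section Charts

variable {X : Type*} [TopologicalSpace X]

lemma eventually_symm {e : OpenPartialHomeomorph X ℂ} {p : X} (hp : p ∈ e.source) {P : X → Prop}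
    (h : ∀ᶠ y in 𝓝 p, P y) : ∀ᶠ z in 𝓝 (e p), P (e.symm z) :=
  (e.eventually_nhds' P hp).2 h

lemma eventually_chart {e : OpenPartialHomeomorph X ℂ} {p : X} (hp : p ∈ e.source) {P : ℂ → Prop}
    (h : ∀ᶠ z in 𝓝 (e p), P z) : ∀ᶠ y in 𝓝 p, P (e y) :=
  (e.continuousAt hp).eventually h

lemma eventually_symm_punctured {e : OpenPartialHomeomorph X ℂ} {p : X} (hp : p ∈ e.source)
    {P : X → Prop} (h : ∀ᶠ y in 𝓝[≠] p, P y) : ∀ᶠ z in 𝓝[≠] (e p), P (e.symm z) := by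
  rw [eventually_nhdsWithin_iff] at h ⊢
  filter_upwards [eventually_symm hp h, e.open_target.mem_nhds (e.map_source hp)] with z h1 h2 h3
  refine h1 fun h4 => h3 ?_
  rw [← e.right_inv h2, show e.symm z = p from h4]
  rfl

lemma eventually_chart_punctured {e : OpenPartialHomeomorph X ℂ} {p : X} (hp : p ∈ e.source)
    {P : ℂ → Prop} (h : ∀ᶠ z in 𝓝[≠] (e p), P z) : ∀ᶠ y in 𝓝[≠] p, P (e y) := by
  rw [eventually_nhdsWithin_iff] at h ⊢
  filter_upwards [eventually_chart hp h, e.open_source.mem_nhds hp] with y h1 h2 h3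
  exact h1 fun h4 => h3 (e.injOn h2 hp h4)

lemma eventually_transition {e e' : OpenPartialHomeomorph X ℂ} {p : X} (hp : p ∈ e.source) (hp' : p ∈ e'.source) :
    ∀ᶠ w in 𝓝 (e p), w ∈ e.target ∧ e.symm w ∈ e'.source := by
  have h1 : ∀ᶠ y in 𝓝 p, y ∈ e'.source := e'.open_source.mem_nhds hp'
  filter_upwards [e.open_target.mem_nhds (e.map_source hp), eventually_symm hp h1] with w h2 h3
  exact ⟨h2, h3⟩

lemma eventually_notMem_finite [T1Space X] {S : Set X} (hS : S.Finite) (p : X) :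
    ∀ᶠ y in 𝓝[≠] p, y ∉ S := by
  have h : (S \ {p})ᶜ ∈ 𝓝 p :=
    (hS.subset sdiff_subset).isClosed.isOpen_compl.mem_nhds (by simp)
  filter_upwards [nhdsWithin_le_nhds h, self_mem_nhdsWithin] with y h1 h2 h3
  exact h1 ⟨h3, h2⟩

variable [ChartedSpace ℂ X]

lemma nhdsNE_neBot (p : X) : (𝓝[≠] p).NeBot := by
  refine ⟨fun h => ?_⟩
  have h1 : ∀ᶠ y in 𝓝[≠] p, False := by rw [h]; trivial
  exact (eventually_symm_punctured (mem_chart_source ℂ p) h1).exists.elim fun _ h => h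

variable [IsManifold 𝓘(ℂ) ω X] {e e' : OpenPartialHomeomorph X ℂ}

lemma analyticAt_transition (he : e ∈ atlas ℂ X) (he' : e' ∈ atlas ℂ X) {z : ℂ}
    (hz : z ∈ e.target) (hz' : e.symm z ∈ e'.source) :
    AnalyticAt ℂ (fun w => e' (e.symm w)) z := by
  have h := HasGroupoid.compatible (G := contDiffGroupoid ω 𝓘(ℂ)) he he'
  rw [contDiffGroupoid, mem_groupoid_of_pregroupoid] at h
  have h1 : ContDiffOn ℂ ω (e.symm.trans e') (e.symm.trans e').source := by
    simpa [contDiffPregroupoid] using! h.1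
  have h2 : (e.symm.trans e').source ∈ 𝓝 z :=
    (e.symm.trans e').open_source.mem_nhds (by simp [hz, hz'])
  exact (h1.contDiffAt h2).analyticAt

lemma deriv_transition_ne_zero (he : e ∈ atlas ℂ X) (he' : e' ∈ atlas ℂ X) {z : ℂ}
    (hz : z ∈ e.target) (hz' : e.symm z ∈ e'.source) :
    deriv (fun w => e' (e.symm w)) z ≠ 0 := by
  have h1 := (analyticAt_transition he he' hz hz').differentiableAt.hasDerivAt
  have hs : e'.symm (e' (e.symm z)) = e.symm z := e'.left_inv hz'
  have h2 := (analyticAt_transition he' he (e'.map_source hz')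
    (by rw [hs]; exact e.map_target hz)).differentiableAt.hasDerivAt
  have h3 := h2.comp z h1
  have h4 : (fun w => e (e'.symm w)) ∘ (fun w => e' (e.symm w)) =ᶠ[𝓝 z] id := by
    filter_upwards [e.open_target.mem_nhds hz,
      (e.symm.trans e').open_source.mem_nhds (by simp [hz, hz'] : z ∈ (e.symm.trans e').source)]
      with w h5 h6
    have h7 : e.symm w ∈ e'.source := by simpa [h5] using h6
    simp [e'.left_inv h7, e.right_inv h5]
  have h5 := h3.unique ((hasDerivAt_id z).congr_of_eventuallyEq h4)
  intro h6
  rw [h6, mul_zero] at h5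
  exact zero_ne_one h5

end Charts

/-! ### Orders, poles and residues of a meromorphic form -/

namespace MeromorphicForm

variable {X : Type*} [TopologicalSpace X] [ChartedSpace ℂ X] {e e' : OpenPartialHomeomorph X ℂ}

lemma meromorphicNFAt (η : MeromorphicForm X) (he : e ∈ atlas ℂ X) {p : X} (hp : p ∈ e.source) :
    MeromorphicNFAt (η.coeff e) (e p) := η.meromorphic e he _ (e.map_source hp)

lemma IsPole.orderAt_ne_zero {η : MeromorphicForm X} {p : X} (h : η.IsPole p) :
    η.orderAt p ≠ 0 := ne_of_lt h

/-- `η = du + i (...)` with `u` the real part of a primitive. -/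
def IsRealPrimitive (η : MeromorphicForm X) (u : X → ℝ) : Prop :=
  ∀ e ∈ atlas ℂ X, ∀ z ∈ e.target, ¬ η.IsPole (e.symm z) →
    HasFDerivAt (fun w => u (e.symm w))
      (Complex.reCLM.comp (ContinuousLinearMap.mul ℝ ℂ (η.coeff e z))) z

lemma IsRealPrimitive.hasFDerivAt {η : MeromorphicForm X} {u : X → ℝ} (hu : η.IsRealPrimitive u)
    (he : e ∈ atlas ℂ X) {p : X} (hp : p ∈ e.source) (h : ¬ η.IsPole p) :
    HasFDerivAt (fun w => u (e.symm w))
      (Complex.reCLM.comp (ContinuousLinearMap.mul ℝ ℂ (η.coeff e (e p)))) (e p) :=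
  hu e he _ (e.map_source hp) (by rwa [e.left_inv hp])

lemma coeff_eventually_eq (η : MeromorphicForm X) (he : e ∈ atlas ℂ X) (he' : e' ∈ atlas ℂ X)
    {p : X} (hp : p ∈ e.source) (hp' : p ∈ e'.source) :
    ∀ᶠ z in 𝓝 (e p), η.coeff e z =
      η.coeff e' (e' (e.symm z)) * deriv (fun w => e' (e.symm w)) z := by
  filter_upwards [eventually_transition hp hp'] with z hz
  exact η.transform e he e' he' z hz.1 hz.2

variable [IsManifold 𝓘(ℂ) ω X]

/-- The order does not depend on the chart: the derivative of a transition map is holomorphic and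
nonzero, so it contributes order zero. -/
lemma orderAt_eq (η : MeromorphicForm X) (he : e ∈ atlas ℂ X) {p : X} (hp : p ∈ e.source) :
    η.orderAt p = meromorphicOrderAt (η.coeff e) (e p) := by
  unfold orderAt
  set e' := chartAt ℂ p
  have he' : e' ∈ atlas ℂ X := chart_mem_atlas ℂ p
  have hp' : p ∈ e'.source := mem_chart_source ℂ p
  have hz := e.map_source hp
  have hz' : e.symm (e p) ∈ e'.source := by rw [e.left_inv hp]; exact hp'
  have h1 := analyticAt_transition he he' hz hz'
  have h2 := deriv_transition_ne_zero he he' hz hz'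
  rw [meromorphicOrderAt_congr (nhdsWithin_le_nhds (coeff_eventually_eq η he he' hp hp'))]
  have h3 : e' (e.symm (e p)) = e' p := by rw [e.left_inv hp]
  have h4 := meromorphicOrderAt_comp_of_deriv_ne_zero (f := η.coeff e') h1 h2
  rw [h3] at h4
  rw [← h4]
  have h5 : (fun z => η.coeff e' (e' (e.symm z)) * deriv (fun w => e' (e.symm w)) z) =
    (fun z => deriv (fun w => e' (e.symm w)) z) * (η.coeff e' ∘ fun z => e' (e.symm z)) := by
    funext z; simp [mul_comm]
  rw [h5, meromorphicOrderAt_mul_of_ne_zero h1.deriv h2]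

lemma analyticAt_coeff (η : MeromorphicForm X) (he : e ∈ atlas ℂ X) {p : X} (hp : p ∈ e.source)
    (h : ¬ η.IsPole p) : AnalyticAt ℂ (η.coeff e) (e p) := by
  rw [IsPole, η.orderAt_eq he hp, not_lt] at h
  exact (η.meromorphicNFAt he hp).meromorphicOrderAt_nonneg_iff_analyticAt.1 h

lemma not_isPole_of_analyticAt (η : MeromorphicForm X) (he : e ∈ atlas ℂ X) {p : X}
    (hp : p ∈ e.source) (h : AnalyticAt ℂ (η.coeff e) (e p)) : ¬ η.IsPole p := by
  rw [IsPole, η.orderAt_eq he hp, not_lt]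
  exact h.meromorphicOrderAt_nonneg

lemma orderAt_eq_zero_iff (η : MeromorphicForm X) (he : e ∈ atlas ℂ X) {p : X} (hp : p ∈ e.source) :
    η.orderAt p = 0 ↔ η.coeff e (e p) ≠ 0 := by
  rw [η.orderAt_eq he hp, (η.meromorphicNFAt he hp).meromorphicOrderAt_eq_zero_iff]

lemma eventually_not_isPole (η : MeromorphicForm X) (p : X) : ∀ᶠ y in 𝓝[≠] p, ¬ η.IsPole y := by
  have hp := mem_chart_source ℂ p
  have he := chart_mem_atlas ℂ p
  have h1 := (η.meromorphicNFAt he hp).meromorphicAt.eventually_analyticAt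
  filter_upwards [eventually_chart_punctured hp h1,
    nhdsWithin_le_nhds ((chartAt ℂ p).open_source.mem_nhds hp)] with y h2 h3
  exact η.not_isPole_of_analyticAt he h3 h2

lemma eventually_orderAt_eq_zero (η : MeromorphicForm X) {p : X} (h : η.orderAt p ≠ ⊤) :
    ∀ᶠ y in 𝓝[≠] p, η.orderAt y = 0 := by
  have hp := mem_chart_source ℂ p
  have he := chart_mem_atlas ℂ p
  have h1 := (meromorphicOrderAt_ne_top_iff_eventually_ne_zero
    (η.meromorphicNFAt he hp).meromorphicAt).1 h
  filter_upwards [eventually_chart_punctured hp h1,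
    nhdsWithin_le_nhds ((chartAt ℂ p).open_source.mem_nhds hp)] with y h2 h3
  exact (η.orderAt_eq_zero_iff he h3).2 h2

lemma eventually_orderAt_eq_top (η : MeromorphicForm X) {p : X} (h : η.orderAt p = ⊤) :
    ∀ᶠ y in 𝓝 p, η.orderAt y = ⊤ := by
  have hp := mem_chart_source ℂ p
  have he := chart_mem_atlas ℂ p
  have h1 : ∀ᶠ z in 𝓝[≠] (chartAt ℂ p p), η.coeff (chartAt ℂ p) z = 0 :=
    meromorphicOrderAt_eq_top_iff.1 h
  have h2 := eventually_nhdsWithin_iff.1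
    (eventually_chart_punctured hp (eventually_eventually_punctured h1))
  filter_upwards [h2, (chartAt ℂ p).open_source.mem_nhds hp] with y h3 h4
  by_cases hy : y = p
  · rw [hy]; exact h
  · rw [η.orderAt_eq he h4, meromorphicOrderAt_eq_top_iff]
    exact nhdsWithin_le_nhds (h3 hy)

/-- On a connected surface, a form that does not vanish near one point vanishes nowhere
identically. -/
lemma orderAt_ne_top [PreconnectedSpace X] (η : MeromorphicForm X) {x₀ : X}
    (h₀ : η.orderAt x₀ ≠ ⊤) (p : X) : η.orderAt p ≠ ⊤ := by
  have h : ∀ x y : X, η.orderAt x = ⊤ ↔ η.orderAt y = ⊤ := by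
    refine PreconnectedSpace.induction₂' _ (fun x => ?_) ⟨fun _ _ _ h1 h2 => h1.trans h2⟩
    suffices ∀ᶠ y in 𝓝 x, (η.orderAt x = ⊤ ↔ η.orderAt y = ⊤) from this.mono fun y hy => ⟨hy, hy.symm⟩
    by_cases hx : η.orderAt x = ⊤
    · exact (η.eventually_orderAt_eq_top hx).mono fun y hy => by simp [hx, hy]
    · filter_upwards [eventually_nhdsWithin_iff.1 (η.eventually_orderAt_eq_zero hx)] with y hy
      by_cases hyx : y = x
      · rw [hyx]
      · simp [hx, hy hyx]
  exact fun hp => h₀ ((h p x₀).1 hp)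

/-- Otherwise compactness would give an accumulation point, while zeros and poles are isolated. -/
lemma finite_orderAt_ne_zero [CompactSpace X] [PreconnectedSpace X] (η : MeromorphicForm X)
    {x₀ : X} (h₀ : η.orderAt x₀ ≠ ⊤) : {p | η.orderAt p ≠ 0}.Finite := by
  by_contra hinf
  obtain ⟨x, hx⟩ := Set.Infinite.exists_accPt_principal hinf
  rw [accPt_iff_frequently_nhdsNE] at hx
  exact hx ((η.eventually_orderAt_eq_zero (η.orderAt_ne_top h₀ x)).mono fun y hy => by simp [hy])

/-- The residue does not depend on the chart. For a transition map `τ`, the product in the new chart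
is the old one times `τ'` over the difference quotient of `τ`, and this ratio tends to one. -/
lemma tendsto_residue (η : MeromorphicForm X) (h3 : η.IsThirdKind) (he : e ∈ atlas ℂ X) {p : X}
    (hp : p ∈ e.source) :
    Tendsto (fun z => (z - e p) * η.coeff e z) (𝓝[≠] (e p)) (𝓝 (η.residue p)) := by
  set e' := chartAt ℂ p with he'def
  have he' : e' ∈ atlas ℂ X := chart_mem_atlas ℂ p
  have hp' : p ∈ e'.source := mem_chart_source ℂ p
  have hlim : Tendsto (fun z => (z - e' p) * η.coeff e' z) (𝓝[≠] (e' p)) (𝓝 (η.residue p)) := by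
    have hm := (η.meromorphicNFAt he' hp').meromorphicAt
    have hm1 : MeromorphicAt (fun z => z - e' p) (e' p) :=
      (analyticAt_id.sub analyticAt_const).meromorphicAt
    have hord : 0 ≤ meromorphicOrderAt (fun z => (z - e' p) * η.coeff e' z) (e' p) := by
      have h4 := h3 p
      rw [η.orderAt_eq he' hp'] at h4
      rw [fun_meromorphicOrderAt_mul hm1 hm, meromorphicOrderAt_id_sub_const]
      calc (0 : WithTop ℤ) = 1 + (-1 : WithTop ℤ) := by rfl
        _ ≤ _ := by gcongr
    exact tendsto_nhds_limUnder (tendsto_nhds_of_meromorphicOrderAt_nonneg (hm1.mul hm) hord)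
  have hz := e.map_source hp
  have hz' : e.symm (e p) ∈ e'.source := by rw [e.left_inv hp]; exact hp'
  set τ : ℂ → ℂ := fun w => e' (e.symm w) with hτ
  have h1 : AnalyticAt ℂ τ (e p) := analyticAt_transition he he' hz hz'
  have h2 : deriv τ (e p) ≠ 0 := deriv_transition_ne_zero he he' hz hz'
  have hτp : τ (e p) = e' p := by simp [hτ, e.left_inv hp]
  have h4 : Tendsto τ (𝓝[≠] (e p)) (𝓝[≠] (e' p)) := by
    rw [← hτp]; exact h1.differentiableAt.hasDerivAt.tendsto_nhdsNE h2
  have h5 := hlim.comp h4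
  have h6 : Tendsto (fun z => (slope τ (e p) z)⁻¹) (𝓝[≠] (e p)) (𝓝 (deriv τ (e p))⁻¹) :=
    (hasDerivAt_iff_tendsto_slope.1 h1.differentiableAt.hasDerivAt).inv₀ h2
  have h7 : Tendsto (deriv τ) (𝓝[≠] (e p)) (𝓝 (deriv τ (e p))) :=
    h1.deriv.continuousAt.tendsto.mono_left nhdsWithin_le_nhds
  have h8 := (h5.mul h6).mul h7
  rw [mul_assoc, inv_mul_cancel₀ h2, mul_one] at h8
  refine h8.congr' ?_
  filter_upwards [nhdsWithin_le_nhds (η.coeff_eventually_eq he he' hp hp'), self_mem_nhdsWithin,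
    h4.eventually self_mem_nhdsWithin] with z h9 h10 h11
  have h12 : z - e p ≠ 0 := sub_ne_zero.2 h10
  have h13 : τ z - e' p ≠ 0 := sub_ne_zero.2 h11
  rw [h9]
  simp only [Function.comp, slope_def_field, hτp]
  change (τ z - e' p) * η.coeff e' (τ z) * _ * _ = _ * (η.coeff e' (τ z) * deriv τ z)
  field_simp

lemma exists_expansion (η : MeromorphicForm X) (h3 : η.IsThirdKind) (he : e ∈ atlas ℂ X) {p : X}
    (hp : p ∈ e.source) :
    ∃ K, HasSimplePoleExpansion (η.coeff e) (η.residue p) K (e p) :=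
  exists_simplePoleExpansion (η.meromorphicNFAt he hp).meromorphicAt (η.tendsto_residue h3 he hp)

lemma IsRealPrimitive.eventually_hasFDerivAt {η : MeromorphicForm X} {u : X → ℝ}
    (hu : η.IsRealPrimitive u) (he : e ∈ atlas ℂ X) {p : X} (hp : p ∈ e.source) :
    ∀ᶠ z in 𝓝[≠] (e p), HasFDerivAt (fun w => u (e.symm w))
      (Complex.reCLM.comp (ContinuousLinearMap.mul ℝ ℂ (η.coeff e z))) z := by
  filter_upwards [eventually_symm_punctured hp (η.eventually_not_isPole p),
    nhdsWithin_le_nhds (e.open_target.mem_nhds (e.map_source hp))] with z h1 h2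
  exact hu e he z h2 h1

end MeromorphicForm

/-! ### Paths in the complement of a finite set -/

section Paths

variable {X : Type*} [TopologicalSpace X]

lemma exists_path_of_joinedIn {S : Finset X} {V : Set X} {y₁ y₂ : {x : X // x ∉ S}}
    (hV : ∀ x ∈ V, x ∉ S) (h : JoinedIn V (y₁ : X) y₂) :
    ∃ σ : Path y₁ y₂, ∀ t, (σ t : X) ∈ V :=
  ⟨{ toFun := fun t => ⟨h.somePath t, hV _ (h.somePath_mem t)⟩
     continuous_toFun := h.somePath.continuous.subtype_mk _
     source' := Subtype.ext h.somePath.source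
     target' := Subtype.ext h.somePath.target }, fun t => h.somePath_mem t⟩

/-- A coordinate disc that avoids `S` and meets `T` at most at its centre. -/
structure IsDisc (S T : Finset X) (e : OpenPartialHomeomorph X ℂ) (c : ℂ) (ε : ℝ) : Prop where
  pos : 0 < ε
  subset : Metric.ball c ε ⊆ e.target
  notMem : ∀ z ∈ Metric.ball c ε, e.symm z ∉ S
  notMem_punctured : ∀ z ∈ Metric.ball c ε, z ≠ c → e.symm z ∉ T

lemma exists_isDisc [T1Space X] (S T : Finset X) {e : OpenPartialHomeomorph X ℂ} {x : X}
    (hx : x ∈ e.source) (hS : x ∉ S) {U : Set X} (hU : U ∈ 𝓝 x) :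
    ∃ ε, IsDisc S T e (e x) ε ∧ e.symm '' Metric.ball (e x) ε ⊆ U := by
  have h1 : ∀ᶠ y in 𝓝 x, y ∉ S :=
    S.finite_toSet.isClosed.isOpen_compl.mem_nhds (by simpa using hS)
  have h2 := eventually_symm_punctured hx (eventually_notMem_finite T.finite_toSet x)
  have h3 := eventually_symm hx (h1.and hU)
  obtain ⟨ε, hε, h⟩ := Metric.eventually_nhds_iff_ball.1
    ((h3.and (eventually_nhdsWithin_iff.1 h2)).and (e.open_target.mem_nhds (e.map_source hx)))
  refine ⟨ε, ⟨hε, fun z hz => (h z hz).2, fun z hz => (h z hz).1.1.1,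
    fun z hz hne => (h z hz).1.2 hne⟩, ?_⟩
  rintro _ ⟨z, hz, rfl⟩
  exact (h z hz).1.1.2

namespace IsDisc

variable {S T : Finset X} {e : OpenPartialHomeomorph X ℂ} {c : ℂ} {ε : ℝ}

lemma symm_mem_nhds (h : IsDisc S T e c ε) {z : ℂ} (hz : z ∈ Metric.ball c ε) :
    e.symm '' Metric.ball c ε ∈ 𝓝 (e.symm z) :=
  (e.symm.isOpen_image_of_subset_source Metric.isOpen_ball h.subset).mem_nhds ⟨z, hz, rfl⟩

lemma mem_nhds (h : IsDisc S T e c ε) {x : X} (hx : x ∈ e.symm '' Metric.ball c ε) :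
    e.symm '' Metric.ball c ε ∈ 𝓝 x := by
  obtain ⟨z, hz, rfl⟩ := hx
  exact h.symm_mem_nhds hz

lemma mem_source (h : IsDisc S T e c ε) {x : X} (hx : x ∈ e.symm '' Metric.ball c ε) :
    x ∈ e.source ∧ e x ∈ Metric.ball c ε := by
  obtain ⟨z, hz, rfl⟩ := hx
  exact ⟨e.map_target (h.subset hz), by rwa [e.right_inv (h.subset hz)]⟩

lemma mem_of_mem_source (_h : IsDisc S T e c ε) {x : X} (hx : x ∈ e.source)
    (hx' : e x ∈ Metric.ball c ε) : x ∈ e.symm '' Metric.ball c ε := ⟨e x, hx', e.left_inv hx⟩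

lemma joinedIn_image (h : IsDisc S T e c ε) {W : Set ℂ} (hW : IsPathConnected W)
    (hWb : W ⊆ Metric.ball c ε) {z₁ z₂ : ℂ} (h₁ : z₁ ∈ W) (h₂ : z₂ ∈ W) :
    JoinedIn (e.symm '' W) (e.symm z₁) (e.symm z₂) :=
  (hW.image' (e.continuousOn_symm.mono (hWb.trans h.subset))).joinedIn _ ⟨z₁, h₁, rfl⟩ _
    ⟨z₂, h₂, rfl⟩

lemma joinedIn (h : IsDisc S T e c ε) {y₁ y₂ : X} (h₁ : y₁ ∈ e.symm '' Metric.ball c ε)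
    (h₂ : y₂ ∈ e.symm '' Metric.ball c ε) : JoinedIn (e.symm '' Metric.ball c ε) y₁ y₂ := by
  obtain ⟨z₁, hz₁, rfl⟩ := h₁
  obtain ⟨z₂, hz₂, rfl⟩ := h₂
  exact h.joinedIn_image ((convex_ball c ε).isPathConnected ⟨z₁, hz₁⟩) subset_rfl hz₁ hz₂

lemma joinedIn_diff (h : IsDisc S T e c ε) {y₁ y₂ : X} (h₁ : y₁ ∈ e.symm '' Metric.ball c ε)
    (h₂ : y₂ ∈ e.symm '' Metric.ball c ε) (h₁' : y₁ ∉ T) (h₂' : y₂ ∉ T) :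
    JoinedIn (e.symm '' Metric.ball c ε \ T) y₁ y₂ := by
  by_cases hc : e.symm c ∈ T
  · obtain ⟨z₁, hz₁, rfl⟩ := h₁
    obtain ⟨z₂, hz₂, rfl⟩ := h₂
    refine (h.joinedIn_image (isPathConnected_ball_diff_center c h.pos) sdiff_subset
      (z₁ := z₁) (z₂ := z₂) ⟨hz₁, ?_⟩ ⟨hz₂, ?_⟩).mono ?_
    · rintro rfl; exact h₁' hc
    · rintro rfl; exact h₂' hc
    · rintro _ ⟨z, hz, rfl⟩
      exact ⟨⟨z, hz.1, rfl⟩, h.notMem_punctured z hz.1 hz.2⟩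
  · refine (h.joinedIn h₁ h₂).mono ?_
    rintro _ ⟨z, hz, rfl⟩
    refine ⟨⟨z, hz, rfl⟩, ?_⟩
    by_cases hzc : z = c
    · rw [hzc]; exact hc
    · exact h.notMem_punctured z hz hzc

lemma exists_path (h : IsDisc S T e c ε) {y₁ y₂ : {x : X // x ∉ S}}
    (h₁ : (y₁ : X) ∈ e.symm '' Metric.ball c ε) (h₂ : (y₂ : X) ∈ e.symm '' Metric.ball c ε) :
    ∃ σ : Path y₁ y₂, ∀ t, (σ t : X) ∈ e.symm '' Metric.ball c ε := by
  refine exists_path_of_joinedIn ?_ (h.joinedIn h₁ h₂)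
  rintro _ ⟨z, hz, rfl⟩
  exact h.notMem z hz

lemma exists_path_diff (h : IsDisc S T e c ε) {y₁ y₂ : {x : X // x ∉ S}}
    (h₁ : (y₁ : X) ∈ e.symm '' Metric.ball c ε) (h₂ : (y₂ : X) ∈ e.symm '' Metric.ball c ε)
    (h₁' : (y₁ : X) ∉ T) (h₂' : (y₂ : X) ∉ T) :
    ∃ σ : Path y₁ y₂, ∀ t, (σ t : X) ∈ e.symm '' Metric.ball c ε ∧ (σ t : X) ∉ T := by
  refine exists_path_of_joinedIn ?_ (h.joinedIn_diff h₁ h₂ h₁' h₂')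
  rintro _ ⟨⟨z, hz, rfl⟩, -⟩
  exact h.notMem z hz

/-- A disc is simply connected. -/
lemma homotopic (h : IsDisc S T e c ε) {y₁ y₂ : {x : X // x ∉ S}} (σ τ : Path y₁ y₂)
    (hσ : ∀ t, (σ t : X) ∈ e.symm '' Metric.ball c ε)
    (hτ : ∀ t, (τ t : X) ∈ e.symm '' Metric.ball c ε) : σ.Homotopic τ := by
  set L : unitInterval × unitInterval → ℂ := fun p =>
    (1 - (p.1 : ℝ)) • e (σ p.2) + (p.1 : ℝ) • e (τ p.2) with hL
  have hmem : ∀ p, L p ∈ Metric.ball c ε := fun p =>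
    (convex_ball c ε) (h.mem_source (hσ p.2)).2 (h.mem_source (hτ p.2)).2
      (sub_nonneg.2 p.1.2.2) p.1.2.1 (by ring)
  have hcont : ∀ ρ : Path y₁ y₂, (∀ t, (ρ t : X) ∈ e.symm '' Metric.ball c ε) →
      Continuous fun t => e (ρ t) := fun ρ hρ =>
    e.continuousOn.comp_continuous (continuous_subtype_val.comp ρ.continuous)
      fun t => (h.mem_source (hρ t)).1
  have hLc : Continuous L := by
    have h1 := (hcont σ hσ).comp (continuous_snd (X := unitInterval) (Y := unitInterval))
    have h2 := (hcont τ hτ).comp (continuous_snd (X := unitInterval) (Y := unitInterval))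
    have h3 : Continuous fun p : unitInterval × unitInterval => (p.1 : ℝ) := by fun_prop
    exact ((continuous_const.sub h3).smul h1).add (h3.smul h2)
  have hinv : ∀ ρ : Path y₁ y₂, (∀ t, (ρ t : X) ∈ e.symm '' Metric.ball c ε) →
      ∀ t, e.symm (e (ρ t)) = ρ t := fun ρ hρ t => e.left_inv (h.mem_source (hρ t)).1
  refine ⟨{ toFun := fun p => ⟨e.symm (L p), h.notMem _ (hmem p)⟩
            continuous_toFun := (e.continuousOn_symm.comp_continuous hLc
              fun p => h.subset (hmem p)).subtype_mk _
            map_zero_left := fun t => ?_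
            map_one_left := fun t => ?_
            prop' := ?_ }⟩
  · apply Subtype.ext
    simp [hL, hinv σ hσ]
  · apply Subtype.ext
    simp [hL, hinv τ hτ]
  · rintro s t (rfl | rfl)
    · apply Subtype.ext
      have := hinv σ hσ 0
      simp only [Path.source] at this
      simp [hL, ← add_mul, this]
    · apply Subtype.ext
      have := hinv σ hσ 1
      simp only [Path.target] at this
      simp [hL, ← add_mul, this]

end IsDisc

/-- The initial part of a path. -/
def pathPrefix {Y : Type*} [TopologicalSpace Y] {a b : Y} (γ : Path a b) (t : unitInterval) :
    Path a (γ t) := (γ.subpath 0 t).cast γ.source.symm rfl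

/-- This holds for `s < t` too: the subpath then runs backwards and cancels the end of the prefix.
Both orders are needed to vary `s` in a full neighbourhood of `t`. -/
lemma pathPrefix_trans_subpath {Y : Type*} [TopologicalSpace Y] {a b : Y} (γ : Path a b)
    (t s : unitInterval) :
    ((pathPrefix γ t).trans (γ.subpath t s)).Homotopic (pathPrefix γ s) :=
  Path.Homotopic.pathCast ⟨Path.Homotopy.subpathTransSubpath γ 0 t s⟩ γ.source.symm rfl

lemma subpath_mem {Y : Type*} [TopologicalSpace Y] {a b : Y} (γ : Path a b) {W : Set Y}
    {t s : unitInterval} (h : ∀ r ∈ uIcc t s, γ r ∈ W) (r : unitInterval) :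
    γ.subpath t s r ∈ W := by
  have : γ.subpath t s r ∈ γ '' uIcc t s := γ.range_subpath t s ▸ mem_range_self r
  obtain ⟨q, hq, hq'⟩ := this
  rw [← hq']; exact h q hq

lemma eventually_uIcc_subset {Y : Type*} [TopologicalSpace Y] {a b : Y} (γ : Path a b) {W : Set Y}
    {t : unitInterval} (hW : W ∈ 𝓝 (γ t)) :
    ∀ᶠ s in 𝓝 t, ∀ r ∈ uIcc t s, γ r ∈ W := by
  have h : γ ⁻¹' W ∈ 𝓝 t := γ.continuous.continuousAt hW
  have hb : Tendsto (fun s => uIcc t s) (𝓝 t) (𝓝 t).smallSets :=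
    tendsto_const_nhds.uIcc tendsto_id
  exact hb (eventually_smallSets.2 ⟨_, h, fun _ hs => hs⟩)

lemma pathPrefix_zero {Y : Type*} [TopologicalSpace Y] {a b : Y} (γ : Path a b) :
    pathPrefix γ 0 = (Path.refl a).cast rfl γ.source := by
  ext; simp [pathPrefix]

lemma pathPrefix_one {Y : Type*} [TopologicalSpace Y] {a b : Y} (γ : Path a b) :
    pathPrefix γ 1 = γ.cast rfl γ.target := by
  ext; simp [pathPrefix]

/-- Continuation along paths: a property of paths that is locally constant under prolongation
holds for all paths if it holds for the constant one. -/
lemma path_induction {S : Finset X} {y₀ : {x : X // x ∉ S}}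
    (P : ∀ {y : {x : X // x ∉ S}}, Path y₀ y → Prop)
    (hom : ∀ {y} (γ γ' : Path y₀ y), γ.Homotopic γ' → P γ → P γ')
    (hopen : ∀ {x} (γ : Path y₀ x), P γ → ∃ U ∈ 𝓝 (x : X), ∀ {y} (σ : Path x y),
      (∀ t, (σ t : X) ∈ U) → P (γ.trans σ))
    (hclosed : ∀ {x} (γ : Path y₀ x), (∀ U ∈ 𝓝 (x : X), ∃ y, ∃ σ : Path x y,
      (∀ t, (σ t : X) ∈ U) ∧ P (γ.trans σ)) → P γ)
    (h₀ : P (Path.refl y₀)) {y : {x : X // x ∉ S}} (γ : Path y₀ y) : P γ := by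
  have hcast : ∀ {y y' : {x : X // x ∉ S}} (h : y' = y) (γ : Path y₀ y),
      P (γ.cast rfl h) ↔ P γ := by
    rintro y _ rfl γ
    exact Iff.rfl
  have hnear : ∀ {t : unitInterval} {U : Set X}, U ∈ 𝓝 (γ t : X) → ∀ᶠ s in 𝓝 t,
      (∀ r, (γ.subpath t s r : X) ∈ U) := by
    intro t U hU
    have : (Subtype.val ⁻¹' U : Set {x : X // x ∉ S}) ∈ 𝓝 (γ t) :=
      continuous_subtype_val.continuousAt hU
    exact (eventually_uIcc_subset γ this).mono fun s hs r => subpath_mem γ hs r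
  -- The set of parameters whose prefix satisfies `P` is clopen and contains `0`, and the interval
  -- is connected.
  have hall : {t | P (pathPrefix γ t)} = univ := by
    refine IsClopen.eq_univ ⟨?_, ?_⟩ ⟨0, ?_⟩
    · rw [isClosed_iff_frequently]
      intro t ht
      refine hclosed _ fun U hU => ?_
      obtain ⟨s, hs, hs'⟩ := (ht.and_eventually (hnear hU)).exists
      exact ⟨_, γ.subpath t s, hs', hom _ _ (pathPrefix_trans_subpath γ t s).symm hs⟩
    · rw [isOpen_iff_mem_nhds]
      intro t ht
      obtain ⟨U, hU, h⟩ := hopen _ ht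
      filter_upwards [hnear hU] with s hs
      exact hom _ _ (pathPrefix_trans_subpath γ t s) (h _ hs)
    · change P _
      rw [pathPrefix_zero]
      exact (hcast _ _).2 h₀
  have h1 : P (pathPrefix γ 1) := by
    have : (1 : unitInterval) ∈ {t | P (pathPrefix γ t)} := by rw [hall]; exact mem_univ _
    exact this
  rw [pathPrefix_one] at h1
  exact (hcast _ _).1 h1

lemma homotopic_trans_assoc {Y : Type*} [TopologicalSpace Y] {a b c d : Y} (p : Path a b)
    (q : Path b c) (r : Path c d) : ((p.trans q).trans r).Homotopic (p.trans (q.trans r)) :=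
  ⟨Path.Homotopy.transAssoc p q r⟩

lemma trans_mem {Y : Type*} [TopologicalSpace Y] {a b c : Y} {p : Path a b} {q : Path b c}
    {W : Y → Prop} (hp : ∀ t, W (p t)) (hq : ∀ t, W (q t)) (t : unitInterval) :
    W (p.trans q t) := by
  have : p.trans q t ∈ range p ∪ range q := by
    rw [← Path.trans_range]; exact mem_range_self t
  rcases this with ⟨s, hs⟩ | ⟨s, hs⟩
  · rw [← hs]; exact hp s
  · rw [← hs]; exact hq s

variable [ChartedSpace ℂ X] [T1Space X]

/-- A path can be moved off a finite set by a homotopy. -/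
lemma exists_homotopic_avoiding {S : Finset X} (T : Finset X) {y₀ y : {x : X // x ∉ S}}
    (h₀ : (y₀ : X) ∉ T) (h : (y : X) ∉ T) (γ : Path y₀ y) :
    ∃ γ' : Path y₀ y, γ'.Homotopic γ ∧ ∀ t, (γ' t : X) ∉ T := by
  -- The end of an intermediate path may lie in `T`, so the induction concerns all short
  -- prolongations that end off `T` rather than the path itself.
  let P : ∀ {x : {x : X // x ∉ S}}, Path y₀ x → Prop := fun {x} γ =>
    ∃ U : Set X, IsOpen U ∧ (x : X) ∈ U ∧ ∀ {y : {x : X // x ∉ S}} (σ : Path x y),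
      (∀ t, (σ t : X) ∈ U) → (y : X) ∉ T →
      ∃ γ' : Path y₀ y, γ'.Homotopic (γ.trans σ) ∧ ∀ t, (γ' t : X) ∉ T
  have main : P γ := by
    refine path_induction P ?_ ?_ ?_ ?_ γ
    · rintro x γ γ' hγ ⟨U, hU, hxU, h⟩
      refine ⟨U, hU, hxU, fun σ hσ hy => ?_⟩
      obtain ⟨γ'', h1, h2⟩ := h σ hσ hy
      exact ⟨γ'', h1.trans (hγ.hcomp (.refl σ)), h2⟩
    · rintro x γ ⟨U, hU, hxU, h⟩
      refine ⟨U, hU.mem_nhds hxU, fun {y} σ hσ => ⟨U, hU, ?_, fun τ hτ hy => ?_⟩⟩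
      · simpa using hσ 1
      · obtain ⟨γ'', h1, h2⟩ := h (σ.trans τ)
          (trans_mem (W := fun x : {x : X // x ∉ S} => (x : X) ∈ U) hσ hτ) hy
        exact ⟨γ'', h1.trans (homotopic_trans_assoc γ σ τ).symm, h2⟩
    · intro x γ hcl
      set e := chartAt ℂ (x : X)
      have hxe : (x : X) ∈ e.source := mem_chart_source ℂ (x : X)
      obtain ⟨ε, hD, -⟩ := exists_isDisc S T hxe x.2 univ_mem
      set D := e.symm '' Metric.ball (e x) ε with hDdef
      have hxD : (x : X) ∈ D := hD.mem_of_mem_source hxe (Metric.mem_ball_self hD.pos)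
      obtain ⟨y₁, σ₁, hσ₁, U, hU, hyU, hP⟩ := hcl D (hD.mem_nhds hxD)
      have hy₁ : (y₁ : X) ∈ D := by simpa using hσ₁ 1
      have hy₁e := (hD.mem_source hy₁).1
      obtain ⟨δ, hδ, hδU⟩ := exists_isDisc S T hy₁e y₁.2
        (inter_mem (hU.mem_nhds hyU) (hD.mem_nhds hy₁))
      have hz : e y₁ + (δ / 2 : ℝ) ∈ Metric.ball (e y₁) δ := by
        simp [dist_eq_norm, abs_of_pos hδ.pos, hδ.pos]
      -- The point `y₁` may lie in `T`; a small shift gives a point `y₂` off `T`, from which one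
      -- continues inside the punctured disc.
      have hzne : e y₁ + (δ / 2 : ℝ) ≠ e y₁ := by
        simp [hδ.pos.ne']
      set y₂ : {x : X // x ∉ S} := ⟨e.symm (e y₁ + (δ / 2 : ℝ)), hδ.notMem _ hz⟩
      have hy₂T : (y₂ : X) ∉ T := hδ.notMem_punctured _ hz hzne
      obtain ⟨τ, hτ⟩ := hδ.exists_path (y₁ := y₁) (y₂ := y₂)
        (hδ.mem_of_mem_source hy₁e (Metric.mem_ball_self hδ.pos)) ⟨_, hz, rfl⟩
      obtain ⟨γ', hγ', hγ'T⟩ := hP τ (fun t => (hδU (hτ t)).1) hy₂T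
      refine ⟨D, hD.mem_nhds hxD |> fun _ =>
        e.symm.isOpen_image_of_subset_source Metric.isOpen_ball hD.subset, hxD,
        fun {y} σ hσ hyT => ?_⟩
      have hyD : (y : X) ∈ D := by simpa using hσ 1
      have hy₂D : (y₂ : X) ∈ D := by
        have := (hδU (hτ 1)).2
        rwa [Path.target] at this
      obtain ⟨κ, hκ⟩ := hD.exists_path_diff hy₂D hyD hy₂T hyT
      refine ⟨γ'.trans κ, ?_, trans_mem (W := fun x : {x : X // x ∉ S} => (x : X) ∉ T) hγ'T fun t => (hκ t).2⟩
      -- The detour through `y₁` and `y₂` stays in the simply connected disc `D`, so it is homotopic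
      -- to `σ`.
      have h1 : ((σ₁.trans τ).trans κ).Homotopic σ := hD.homotopic _ _
        (trans_mem (W := fun x : {x : X // x ∉ S} => (x : X) ∈ D)
          (trans_mem (W := fun x : {x : X // x ∉ S} => (x : X) ∈ D) hσ₁ fun t => (hδU (hτ t)).2) fun t => (hκ t).1) hσ
      have h2 : (γ'.trans κ).Homotopic (((γ.trans σ₁).trans τ).trans κ) := hγ'.hcomp (.refl κ)
      exact h2.trans (((homotopic_trans_assoc γ σ₁ τ).hcomp (.refl κ)).trans
        ((homotopic_trans_assoc γ (σ₁.trans τ) κ).trans ((Path.Homotopic.refl γ).hcomp h1)))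
    · set e := chartAt ℂ (y₀ : X)
      have hxe : (y₀ : X) ∈ e.source := mem_chart_source ℂ (y₀ : X)
      obtain ⟨ε, hD, -⟩ := exists_isDisc S T hxe y₀.2 univ_mem
      have hxD := hD.mem_of_mem_source hxe (Metric.mem_ball_self hD.pos)
      refine ⟨_, e.symm.isOpen_image_of_subset_source Metric.isOpen_ball hD.subset, hxD,
        fun {y} σ hσ hyT => ?_⟩
      obtain ⟨κ, hκ⟩ := hD.exists_path_diff hxD (by simpa using hσ 1) h₀ hyT
      refine ⟨κ, (hD.homotopic κ σ (fun t => (hκ t).1) hσ).trans ?_, fun t => (hκ t).2⟩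
      exact ⟨(Path.Homotopy.reflTrans σ).symm⟩
  obtain ⟨U, hU, hyU, hP⟩ := main
  obtain ⟨γ', h1, h2⟩ := hP (Path.refl y) (fun _ => hyU) h
  exact ⟨γ', h1.trans ⟨Path.Homotopy.transRefl γ⟩, h2⟩

/-- The complement of a finite set is path connected. -/
lemma joinedIn_compl_finset [PreconnectedSpace X] (T : Finset X) {a b : X} (ha : a ∉ T)
    (hb : b ∉ T) : JoinedIn {x | x ∉ T} a b := by
  -- Phrased with neighbourhoods so that `x` and `y` may lie in `T`. Transitivity uses an
  -- intermediate point off `T`, available because `T` is finite and points are not isolated.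
  have h : ∀ x y : X, ∃ U ∈ 𝓝 x, ∃ V ∈ 𝓝 y, ∀ a ∈ U, ∀ b ∈ V, a ∉ T → b ∉ T →
      JoinedIn {x | x ∉ T} a b := by
    refine PreconnectedSpace.induction₂' _ (fun x => ?_) ⟨?_⟩
    · have hxe := mem_chart_source ℂ x
      obtain ⟨ε, hD, -⟩ := exists_isDisc ∅ T hxe (by simp) univ_mem
      have hxD := hD.mem_of_mem_source hxe (Metric.mem_ball_self hD.pos)
      have hj : ∀ a ∈ (chartAt ℂ x).symm '' Metric.ball (chartAt ℂ x x) ε,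
          ∀ b ∈ (chartAt ℂ x).symm '' Metric.ball (chartAt ℂ x x) ε, a ∉ T → b ∉ T →
          JoinedIn {x | x ∉ T} a b := fun a ha b hb haT hbT =>
        (hD.joinedIn_diff ha hb haT hbT).mono fun z hz => hz.2
      filter_upwards [hD.mem_nhds hxD] with y hy
      exact ⟨⟨_, hD.mem_nhds hxD, _, hD.mem_nhds hy, hj⟩, ⟨_, hD.mem_nhds hy, _, hD.mem_nhds hxD, hj⟩⟩
    · rintro x y z ⟨U, hU, V, hV, h1⟩ ⟨V', hV', W, hW, h2⟩
      refine ⟨U, hU, W, hW, fun a ha b hb haT hbT => ?_⟩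
      have := nhdsNE_neBot y
      obtain ⟨c, ⟨hc1, hc2⟩, hc3⟩ := (Eventually.and (nhdsWithin_le_nhds (inter_mem hV hV'))
        (eventually_notMem_finite T.finite_toSet y)).exists
      exact (h1 a ha c hc1 haT hc3).trans (h2 c hc2 b hb hc3 hbT)
  obtain ⟨U, hU, V, hV, h1⟩ := h a b
  exact h1 a (mem_of_mem_nhds hU) b (mem_of_mem_nhds hV) ha hb

lemma exists_path_avoiding [PreconnectedSpace X] {S : Finset X} (T : Finset X)
    {a b : {x : X // x ∉ S}} (ha : (a : X) ∉ T) (hb : (b : X) ∉ T) :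
    ∃ γ : Path a b, ∀ t, (γ t : X) ∉ T := by
  classical
  have h := joinedIn_compl_finset (S ∪ T) (a := a) (b := b) (by simp [a.2, ha]) (by simp [b.2, hb])
  obtain ⟨γ, hγ⟩ := exists_path_of_joinedIn (S := S) (fun x hx => by
    simp only [Finset.mem_union, not_or, mem_ofPred_eq] at hx; exact hx.1) h
  exact ⟨γ, fun t => by
    have := hγ t
    simp only [Finset.mem_union, not_or, mem_ofPred_eq] at this
    exact this.2⟩

end Paths

/-! ### Function elements of multi-valued functions -/

namespace MultiFun

variable {Y : Type*} [TopologicalSpace Y] {y₀ : Y}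

/-- The same multi-valued function, seen from another base point. -/
def shift (f : MultiFun Y y₀) {y₁ : Y} (δ : Path y₀ y₁) : MultiFun Y y₁ where
  toFun γ := f.toFun (δ.trans γ)
  homotopic _ _ h := f.homotopic _ _ ((Path.Homotopic.refl δ).hcomp h)

def comp (L : OnePoint ℂ → OnePoint ℂ) (f : MultiFun Y y₀) : MultiFun Y y₀ where
  toFun γ := L (f.toFun γ)
  homotopic γ γ' h := congrArg L (f.homotopic γ γ' h)

lemma toFun_assoc (f : MultiFun Y y₀) {a b c : Y} (p : Path y₀ a) (q : Path a b) (r : Path b c) :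
    f.toFun ((p.trans q).trans r) = f.toFun (p.trans (q.trans r)) :=
  f.homotopic _ _ (homotopic_trans_assoc p q r)

lemma toFun_trans_refl (f : MultiFun Y y₀) {a : Y} (p : Path y₀ a) :
    f.toFun (p.trans (Path.refl a)) = f.toFun p :=
  f.homotopic _ _ ⟨Path.Homotopy.transRefl p⟩

end MultiFun

section Elements

variable {X : Type*} [TopologicalSpace X] {S : Finset X} {y₀ : {x : X // x ∉ S}}
  {e e' : OpenPartialHomeomorph X ℂ}

/-- The function `φ` of the coordinate `e` is the element of `f` at the end of `γ`. -/
def Represents (f : MultiFun {x : X // x ∉ S} y₀) {x : {x : X // x ∉ S}} (γ : Path y₀ x)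
    (e : OpenPartialHomeomorph X ℂ) (φ : ℂ → OnePoint ℂ) : Prop :=
  ∃ U ∈ 𝓝 (x : X), ∀ (y : {x : X // x ∉ S}) (σ : Path x y), (∀ t, (σ t : X) ∈ U) →
    f.toFun (γ.trans σ) = φ (e y)

lemma eventually_exists_path [T1Space X] (x : {x : X // x ∉ S}) {U : Set X} (hU : U ∈ 𝓝 (x : X))
    (hx : (x : X) ∈ e.source) : ∀ᶠ z in 𝓝 (e x), z ∈ e.target ∧
      ∃ y : {x : X // x ∉ S}, (y : X) = e.symm z ∧ ∃ σ : Path x y, ∀ t, (σ t : X) ∈ U := by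
  obtain ⟨ε, hD, hDU⟩ := exists_isDisc S ∅ hx x.2 hU
  filter_upwards [Metric.ball_mem_nhds _ hD.pos] with z hz
  refine ⟨hD.subset hz, ⟨e.symm z, hD.notMem z hz⟩, rfl, ?_⟩
  obtain ⟨σ, hσ⟩ := hD.exists_path (y₁ := x) (y₂ := ⟨e.symm z, hD.notMem z hz⟩)
    (hD.mem_of_mem_source hx (Metric.mem_ball_self hD.pos)) ⟨z, hz, rfl⟩
  exact ⟨σ, fun t => hDU (hσ t)⟩

namespace Represents

variable {f : MultiFun {x : X // x ∉ S} y₀} {x : {x : X // x ∉ S}} {γ : Path y₀ x}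
  {φ ψ : ℂ → OnePoint ℂ}

lemma trans (h : Represents f γ e φ) : ∃ U ∈ 𝓝 (x : X), ∀ {y : {x : X // x ∉ S}} (σ : Path x y),
    (∀ t, (σ t : X) ∈ U) → Represents f (γ.trans σ) e φ := by
  obtain ⟨U, hU, h⟩ := h
  refine ⟨interior U, interior_mem_nhds.2 hU, fun {y} σ hσ => ⟨interior U,
    isOpen_interior.mem_nhds (by simpa using hσ 1), fun y' τ hτ => ?_⟩⟩
  rw [f.toFun_assoc]
  exact h y' _ (trans_mem (W := fun x : {x : X // x ∉ S} => (x : X) ∈ U)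
    (fun t => interior_subset (hσ t)) fun t => interior_subset (hτ t))

lemma apply (h : Represents f γ e φ) : f.toFun γ = φ (e x) := by
  obtain ⟨U, hU, h⟩ := h
  rw [← f.toFun_trans_refl, h x (Path.refl x) fun _ => mem_of_mem_nhds hU]

lemma congr (h : Represents f γ e φ) (hx : (x : X) ∈ e.source) (he : ψ =ᶠ[𝓝 (e x)] φ) :
    Represents f γ e ψ := by
  obtain ⟨U, hU, h⟩ := h
  have h1 := eventually_chart hx he
  refine ⟨_, inter_mem hU h1, fun y σ hσ => ?_⟩
  rw [h y σ fun t => (hσ t).1]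
  have : ψ (e y) = φ (e y) := by simpa using (hσ 1).2
  exact this.symm

lemma eventuallyEq [T1Space X] (h : Represents f γ e φ) (h' : Represents f γ e ψ)
    (hx : (x : X) ∈ e.source) : φ =ᶠ[𝓝 (e x)] ψ := by
  obtain ⟨U, hU, h⟩ := h
  obtain ⟨U', hU', h'⟩ := h'
  filter_upwards [eventually_exists_path x (inter_mem hU hU') hx]
  rintro z ⟨hz, y, hy, σ, hσ⟩
  have h1 := h y σ fun t => (hσ t).1
  rw [h' y σ fun t => (hσ t).2, hy, e.right_inv hz] at h1
  exact h1.symm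

lemma eventually_trans [T1Space X] (h : Represents f γ e φ) (hx : (x : X) ∈ e.source)
    {U : Set X} (hU : U ∈ 𝓝 (x : X)) :
    ∀ᶠ z in 𝓝 (e x), z ∈ e.target ∧ ∃ y : {x : X // x ∉ S}, (y : X) = e.symm z ∧
      ∃ σ : Path x y, (∀ t, (σ t : X) ∈ U) ∧ Represents f (γ.trans σ) e φ := by
  obtain ⟨V, hV, h⟩ := h.trans
  refine (eventually_exists_path x (inter_mem hU hV) hx).mono ?_
  rintro z ⟨hz, y, hy, σ, hσ⟩
  exact ⟨hz, y, hy, σ, fun t => (hσ t).1, h σ fun t => (hσ t).2⟩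

lemma shift {y₁ : {x : X // x ∉ S}} {δ : Path y₀ y₁} {γ : Path y₁ x} :
    Represents (f.shift δ) γ e φ ↔ Represents f (δ.trans γ) e φ := by
  simp only [Represents, MultiFun.shift, f.toFun_assoc]

lemma comp (h : Represents f γ e φ) (L : OnePoint ℂ → OnePoint ℂ) :
    Represents (f.comp L) γ e fun z => L (φ z) := by
  obtain ⟨U, hU, h⟩ := h
  exact ⟨U, hU, fun y σ hσ => congrArg L (h y σ hσ)⟩

end Represents

/-- All function elements are meromorphic. -/
def IsSphereAnalytic (f : MultiFun {x : X // x ∉ S} y₀) [ChartedSpace ℂ X] : Prop :=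
  ∀ (x : {x : X // x ∉ S}) (γ : Path y₀ x), ∃ φ, Represents f γ (chartAt ℂ (x : X)) φ ∧
    SphereAnalyticAt φ (chartAt ℂ (x : X) x)

/-- The identity theorem for multi-valued functions. -/
lemma IsSphereAnalytic.eq [T1Space X] [ChartedSpace ℂ X] {f f' : MultiFun {x : X // x ∉ S} y₀}
    (hf : IsSphereAnalytic f) (hf' : IsSphereAnalytic f') {φ φ' : ℂ → OnePoint ℂ}
    (h : Represents f (Path.refl y₀) e φ) (h' : Represents f' (Path.refl y₀) e φ')
    (h0 : (y₀ : X) ∈ e.source) (hφ : φ =ᶠ[𝓝 (e y₀)] φ') {y : {x : X // x ∉ S}} (γ : Path y₀ y) :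
    f.toFun γ = f'.toFun γ := by
  let P : ∀ {x : {x : X // x ∉ S}}, Path y₀ x → Prop := fun {x} γ =>
    ∃ U ∈ 𝓝 (x : X), ∀ {y : {x : X // x ∉ S}} (σ : Path x y),
      (∀ t, (σ t : X) ∈ U) → f.toFun (γ.trans σ) = f'.toFun (γ.trans σ)
  have main : P γ := by
    refine path_induction P ?_ ?_ ?_ ?_ γ
    · rintro x γ γ' hγ ⟨U, hU, h⟩
      refine ⟨U, hU, fun σ hσ => ?_⟩
      have h1 := hγ.symm.hcomp (Path.Homotopic.refl σ)
      rw [f.homotopic _ _ h1, f'.homotopic _ _ h1, h σ hσ]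
    · rintro x γ ⟨U, hU, h⟩
      refine ⟨interior U, interior_mem_nhds.2 hU, fun {y} σ hσ => ⟨interior U,
        isOpen_interior.mem_nhds (by simpa using hσ 1), fun τ hτ => ?_⟩⟩
      rw [f.toFun_assoc, f'.toFun_assoc]
      exact h _ (trans_mem (W := fun x : {x : X // x ∉ S} => (x : X) ∈ U)
        (fun t => interior_subset (hσ t)) fun t => interior_subset (hτ t))
    · intro x γ hcl
      set e := chartAt ℂ (x : X)
      have hxe : (x : X) ∈ e.source := mem_chart_source ℂ (x : X)
      obtain ⟨φ, hr, hs⟩ := hf x γ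
      obtain ⟨φ', hr', hs'⟩ := hf' x γ
      -- Arbitrarily close to `x` there is a point near which the two continuations agree. Its
      -- neighbourhood contains points other than `x`, so agreement cannot fail on a whole punctured
      -- neighbourhood of `x`.
      have hfreq : ∃ᶠ z in 𝓝[≠] (e x), φ z = φ' z := by
        intro hne
        obtain ⟨U, hU, hrU⟩ := hr
        obtain ⟨U', hU', hrU'⟩ := hr'
        have hne' := eventually_chart hxe (eventually_nhdsWithin_iff.1 hne)
        obtain ⟨y, σ, hσ, V, hV, hfV⟩ := hcl _ (inter_mem (inter_mem hU hU')
          (inter_mem (interior_mem_nhds.2 (inter_mem (inter_mem hU hU') hne'))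
            (e.open_source.mem_nhds hxe)))
        have hy := hσ 1
        simp only [Path.target] at hy
        have h1 := eventually_exists_path (S := S) (e := e) y (inter_mem hV
          (inter_mem (isOpen_interior.mem_nhds hy.2.1) (e.open_source.mem_nhds hy.2.2))) hy.2.2
        have h2 : ∀ᶠ z in 𝓝[≠] (e y), z ≠ e x := by
          filter_upwards [eventually_notMem_finite (finite_singleton (e x)) (e y)] with z hz
          simpa using hz
        obtain ⟨z, ⟨hz, y', hy', τ, hτ⟩, hzx⟩ := (Filter.Eventually.and (nhdsWithin_le_nhds h1) h2).exists
        have h3 := hτ 1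
        simp only [Path.target] at h3
        have hez : e y' = z := by rw [hy', e.right_inv hz]
        have h4 := (interior_subset h3.2.1).2 (by simpa [hez] using hzx)
        refine h4 ?_
        have hW : ∀ t, ((σ.trans τ) t : X) ∈ U ∩ U' :=
          trans_mem (W := fun x : {x : X // x ∉ S} => (x : X) ∈ U ∩ U')
            (fun t => (hσ t).1) (fun t => (interior_subset (hτ t).2.1).1)
        rw [← hrU y' (σ.trans τ) fun t => (hW t).1, ← hrU' y' (σ.trans τ) fun t => (hW t).2,
          ← f.toFun_assoc, ← f'.toFun_assoc]
        exact hfV τ fun t => (hτ t).1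
      obtain ⟨U, hU, h1⟩ := hr.congr hxe (hs.eventuallyEq_of_frequently hs' hfreq).symm
      obtain ⟨U', hU', h2⟩ := hr'
      exact ⟨U ∩ U', inter_mem hU hU', fun {y} σ hσ =>
        (h1 y σ fun t => (hσ t).1).trans (h2 y σ fun t => (hσ t).2).symm⟩
    · obtain ⟨U, hU, h1⟩ := h.congr h0 hφ.symm
      obtain ⟨U', hU', h2⟩ := h'
      exact ⟨U ∩ U', inter_mem hU hU', fun {y} σ hσ =>
        (h1 y σ fun t => (hσ t).1).trans (h2 y σ fun t => (hσ t).2).symm⟩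
  obtain ⟨U, hU, hU'⟩ := main
  have := hU' (Path.refl y) fun _ => mem_of_mem_nhds hU
  rwa [f.toFun_trans_refl, f'.toFun_trans_refl] at this

end Elements

/-! ### Developing maps -/

/-- Equality of the densities of `F` and `c F` amounts to `(|c| - 1) (1 - |c| |F|²) = 0`. If `|c| ≠
1`, then `|F|` is constant, hence `F' = 0`, against local univalence. In the chart at infinity the
factor is `c⁻¹`. -/
lemma norm_eq_one_of_hasSphereDensity {φ : ℂ → OnePoint ℂ} {d : ℂ → ℝ} {c z₀ : ℂ} (hc : c ≠ 0)
    (h : ∀ᶠ z in 𝓝 z₀, HasSphereDensity φ z (d z))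
    (h' : ∀ᶠ z in 𝓝 z₀, HasSphereDensity (fun y => OnePoint.map (fun x => c * x) (φ y)) z (d z)) :
    ‖c‖ = 1 := by
  have main : ∀ {F : ℂ → ℂ} {c : ℂ}, AnalyticAt ℂ F z₀ → c ≠ 0 → (∀ᶠ z in 𝓝 z₀, deriv F z ≠ 0 ∧
      2 * ‖deriv F z‖ / (1 + ‖F z‖ ^ 2) =
        2 * ‖deriv (fun y => c * F y) z‖ / (1 + ‖c * F z‖ ^ 2)) → ‖c‖ = 1 := by
    intro F c hF hc h
    by_contra hne
    have hc0 := norm_ne_zero_iff.2 hc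
    have h1 : ∀ᶠ z in 𝓝 z₀, ‖F z‖ ^ 2 = ‖c‖⁻¹ := by
      filter_upwards [h, hF.eventually_analyticAt] with z hz hFz
      have h2 : deriv (fun y => c * F y) z = c * deriv F z :=
        (hFz.differentiableAt.hasDerivAt.const_mul c).deriv
      obtain ⟨h3, h4⟩ := hz
      rw [h2, norm_mul, norm_mul, div_eq_div_iff (by positivity) (by positivity)] at h4
      have h5 : ‖deriv F z‖ ≠ 0 := norm_ne_zero_iff.2 h3
      have h6 : (‖c‖ - 1) * (1 - ‖c‖ * ‖F z‖ ^ 2) = 0 := by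
        have : 2 * ‖deriv F z‖ * ((‖c‖ - 1) * (1 - ‖c‖ * ‖F z‖ ^ 2)) = 0 := by linarith
        exact (mul_eq_zero.1 this).resolve_left (mul_ne_zero two_ne_zero h5)
      have h7 := (mul_eq_zero.1 h6).resolve_left (sub_ne_zero.2 hne)
      rw [← one_div, eq_div_iff hc0]
      linarith
    have hF0 : F z₀ ≠ 0 := by
      intro h0
      have := h1.self_of_nhds
      rw [h0] at this
      simp at this
      exact hc0 this.symm
    have h2 := hasFDerivAt_log_norm hF.differentiableAt.hasDerivAt hF0
    have h3 : HasFDerivAt (fun y => Real.log ‖F y‖)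
        (Complex.reCLM.comp (ContinuousLinearMap.mul ℝ ℂ 0)) z₀ := by
      have : (fun y => Real.log ‖F y‖) =ᶠ[𝓝 z₀] fun _ => Real.log ‖c‖⁻¹ / 2 := by
        filter_upwards [h1] with z hz
        rw [← hz, Real.log_pow]; push_cast; ring
      refine HasFDerivAt.congr_of_eventuallyEq ?_ this
      simpa using hasFDerivAt_const (Real.log ‖c‖⁻¹ / 2) z₀
    have h4 := reCLM_comp_mul_injective (h2.unique h3)
    exact h.self_of_nhds.1 ((div_eq_zero_iff.1 h4).resolve_right hF0)
  obtain ⟨ι, F, hι, hF, e⟩ := h.self_of_nhds.sphereAnalyticAt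
  rcases hι with rfl | rfl
  · refine main hF hc ?_
    filter_upwards [h, h', e.eventually_nhds] with z h1 h2 h3
    have h4 := h1.eq_of_eventuallyEq (Or.inl rfl) h3
    have h5 := h2.eq_of_eventuallyEq (F := fun y => c * F y) (Or.inl rfl)
      (h3.mono fun y hy => congrArg _ hy)
    exact ⟨h4.1, h4.2.symm.trans h5.2⟩
  · have := main hF (inv_ne_zero hc) ?_
    · rwa [norm_inv, inv_eq_one] at this
    filter_upwards [h, h', e.eventually_nhds] with z h1 h2 h3
    have h4 := h1.eq_of_eventuallyEq (Or.inr rfl) h3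
    have h5 := h2.eq_of_eventuallyEq (F := fun y => c⁻¹ * F y) (Or.inr rfl)
      (h3.mono fun y hy => (congrArg _ hy).trans (map_mul_recip hc _))
    exact ⟨h4.1, h4.2.symm.trans h5.2⟩

namespace SphericalMetric

variable {X : Type*} [TopologicalSpace X] [ChartedSpace ℂ X] {g : SphericalMetric X}
  {y₀ : g.Regular} {f f' : MultiFun g.Regular y₀} {e : OpenPartialHomeomorph X ℂ}
  {η : MeromorphicForm X}

lemma isDevelopingMap_of_represents
    (h : ∀ (x : g.Regular) (γ : Path y₀ x), ∀ e ∈ atlas ℂ X, (x : X) ∈ e.source →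
      ∃ φ, Represents f γ e φ ∧ HasSphereDensity φ (e x) (g.density e (e x))) :
    g.IsDevelopingMap f := by
  intro x γ e he hx
  obtain ⟨φ, h1, ι, F, hι, hF, h2, h3, h4⟩ := h x γ e he hx
  exact ⟨ι, F, hι, ⟨hF, h1.congr hx h2.symm⟩, h3, h4⟩

lemma IsDevelopingMap.shift (hf : g.IsDevelopingMap f) {y₁ : g.Regular} (δ : Path y₀ y₁) :
    g.IsDevelopingMap (f.shift δ) := by
  intro x γ e he hx
  obtain ⟨ι, F, hι, ⟨hF, h1⟩, h2⟩ := hf x (δ.trans γ) e he hx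
  exact ⟨ι, F, hι, ⟨hF, (Represents.shift (φ := fun z => ι (F z))).2 h1⟩, h2⟩

lemma HasLogDifferential.shift (hf : HasLogDifferential f η) {y₁ : g.Regular} (δ : Path y₀ y₁) :
    HasLogDifferential (f.shift δ) η := by
  intro x γ e he hx F hF
  exact hf x (δ.trans γ) e he hx F ⟨hF.1,
    (Represents.shift (φ := fun z => ((F z : ℂ) : OnePoint ℂ))).1 hF.2⟩

variable [T1Space X]

/-- The definition compares densities at one point, with an `F` depending on that point. Function
elements at nearby points agree as germs, so a single `φ` has the right density on a neighbourhood.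
-/
lemma IsDevelopingMap.exists_represents (hf : g.IsDevelopingMap f) {x : g.Regular}
    (γ : Path y₀ x) (he : e ∈ atlas ℂ X) (hx : (x : X) ∈ e.source) :
    ∃ φ, Represents f γ e φ ∧ ∀ᶠ z in 𝓝 (e x), HasSphereDensity φ z (g.density e z) := by
  have key : ∀ {x : g.Regular} (γ : Path y₀ x), (x : X) ∈ e.source →
      ∃ φ, Represents f γ e φ ∧ HasSphereDensity φ (e x) (g.density e (e x)) := by
    intro x γ hx
    obtain ⟨ι, F, hι, ⟨hF, h1⟩, h2, h3⟩ := hf x γ e he hx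
    exact ⟨fun z => ι (F z), h1, ι, F, hι, hF, EventuallyEq.rfl, h2, h3⟩
  obtain ⟨φ, h1, -⟩ := key γ hx
  refine ⟨φ, h1, ?_⟩
  filter_upwards [h1.eventually_trans hx univ_mem]
  rintro z ⟨hz, y, hy, σ, -, h2⟩
  have hye : (y : X) ∈ e.source := by rw [hy]; exact e.map_target hz
  have hez : e y = z := by rw [hy, e.right_inv hz]
  obtain ⟨φ', h3, h4⟩ := key (γ.trans σ) hye
  have h5 := h2.eventuallyEq h3 hye
  rw [hez] at h4 h5
  obtain ⟨ι, F, hι, hF, h6, h7⟩ := h4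
  exact ⟨ι, F, hι, hF, h5.trans h6, h7⟩

lemma IsDevelopingMap.isSphereAnalytic (hf : g.IsDevelopingMap f) : IsSphereAnalytic f := by
  intro x γ
  obtain ⟨φ, h1, h2⟩ := hf.exists_represents γ (chart_mem_atlas ℂ (x : X)) (mem_chart_source ℂ _)
  exact ⟨φ, h1, h2.self_of_nhds.sphereAnalyticAt⟩

/-- The hypothesis on `df / f` only concerns finite nonzero values. Zeros and poles of `f` are
isolated by local univalence, and elements in the chart at infinity are inverted away from them. -/
lemma IsDevelopingMap.exists_logGerm (hf : g.IsDevelopingMap f) (hη : HasLogDifferential f η)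
    {x : g.Regular} (γ : Path y₀ x) (he : e ∈ atlas ℂ X) (hx : (x : X) ∈ e.source) :
    ∃ φ, Represents f γ e φ ∧ (∀ᶠ z in 𝓝 (e x), HasSphereDensity φ z (g.density e z)) ∧
      LogGerm (η.coeff e) φ (e x) := by
  obtain ⟨φ, h1, h2⟩ := hf.exists_represents γ he hx
  refine ⟨φ, h1, h2, h2.self_of_nhds.sphereAnalyticAt, ?_⟩
  obtain ⟨ι, F, hι, hF, h3, h4, -⟩ := h2.self_of_nhds
  have h0 : ∀ᶠ z in 𝓝[≠] (e x), F z ≠ 0 := by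
    have := hF.differentiableAt.hasDerivAt.tendsto_nhdsNE h4
    by_cases hz : F (e x) = 0
    · filter_upwards [this.eventually self_mem_nhdsWithin] with z hz'
      simpa [hz] using hz'
    · exact nhdsWithin_le_nhds (hF.continuousAt.eventually_ne hz)
  filter_upwards [h0, nhdsWithin_le_nhds (h1.eventually_trans hx univ_mem),
    nhdsWithin_le_nhds hF.eventually_analyticAt, nhdsWithin_le_nhds h3.eventually_nhds]
  rintro z hz0 ⟨hz, y, hy, σ, -, h5⟩ hFz h6
  have hye : (y : X) ∈ e.source := by rw [hy]; exact e.map_target hz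
  have hez : e y = z := by rw [hy, e.right_inv hz]
  have key : ∀ G : ℂ → ℂ, AnalyticAt ℂ G z → G z ≠ 0 →
      (∀ᶠ w in 𝓝 z, φ w = (G w : OnePoint ℂ)) → LogSol (η.coeff e) φ z := by
    intro G hG hG0 hGe
    have h7 := hη y (γ.trans σ) e he hye G ⟨by rwa [hez],
      h5.congr (ψ := fun w => ((G w : ℂ) : OnePoint ℂ)) hye
        (by rw [hez]; exact hGe.mono fun w hw => hw.symm)⟩ (by rwa [hez])
    rw [hez] at h7
    refine ⟨G, hGe, hG0, hG.differentiableAt.hasDerivAt.congr_deriv ?_⟩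
    rw [h7, div_mul_cancel₀ _ hG0]
  rcases hι with rfl | rfl
  · exact key F hFz hz0 h6
  · refine key _ (hFz.inv hz0) (inv_ne_zero hz0) ?_
    filter_upwards [h6, hFz.continuousAt.eventually_ne hz0] with w hw hw0
    rw [hw, recip_eq_some_inv hw0]
    rfl

/-- The equation holds on a punctured neighbourhood. Both sides are in meromorphic normal form, so
it holds at the centre too. -/
lemma hasLogDifferential_of_logGerm
    (h : ∀ (x : g.Regular) (γ : Path y₀ x), ∀ e ∈ atlas ℂ X, (x : X) ∈ e.source →
      ∃ φ, Represents f γ e φ ∧ LogGerm (η.coeff e) φ (e x)) : HasLogDifferential f η := by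
  intro x γ e he hx F hF hF0
  obtain ⟨φ, h1, h2⟩ := h x γ e he hx
  have h3 : LogGerm (η.coeff e) (fun z => ((F z : ℂ) : OnePoint ℂ)) (e x) :=
    h2.congr (Represents.eventuallyEq hF.2 h1 hx)
  have hq : AnalyticAt ℂ (fun z => deriv F z / F z) (e x) := hF.1.deriv.div hF.1 hF0
  have h4 : η.coeff e =ᶠ[𝓝[≠] (e x)] fun z => deriv F z / F z := by
    filter_upwards [h3.2] with z hz
    obtain ⟨-, h5, h6⟩ := hz.finitePart_spec
    simp only [finitePart_some] at h5 h6
    rw [h6.deriv, mul_div_cancel_right₀ _ h5]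
  exact (((η.meromorphicNFAt he hx).eventuallyEq_nhdsNE_iff_eventuallyEq_nhds
    hq.meromorphicNFAt).1 h4).self_of_nhds

/-- A developing map with a given logarithmic differential is unique up to a unit factor. -/
lemma IsDevelopingMap.exists_unit_mul (hf : g.IsDevelopingMap f) (hη : HasLogDifferential f η)
    (hf' : g.IsDevelopingMap f') (hη' : HasLogDifferential f' η) :
    ∃ u : ℂ, ‖u‖ = 1 ∧ ∀ (y : g.Regular) (γ : Path y₀ y),
      f'.toFun γ = OnePoint.map (fun w => u * w) (f.toFun γ) := by
  have he := chart_mem_atlas ℂ (y₀ : X)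
  have hx := mem_chart_source ℂ (y₀ : X)
  obtain ⟨φ, h1, h2, h3⟩ := hf.exists_logGerm hη (Path.refl y₀) he hx
  obtain ⟨φ', h1', h2', h3'⟩ := hf'.exists_logGerm hη' (Path.refl y₀) he hx
  obtain ⟨c, hc, h4⟩ := h3.exists_const_mul h3'
  refine ⟨c, norm_eq_one_of_hasSphereDensity hc h2 ?_, fun y γ => ?_⟩
  · filter_upwards [h2', h4.eventually_nhds] with z h5 h6
    obtain ⟨ι, F, hι, hF, h7, h8⟩ := h5
    exact ⟨ι, F, hι, hF, EventuallyEq.trans (h6.mono fun w hw => hw.symm) h7, h8⟩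
  · refine hf'.isSphereAnalytic.eq (f' := f.comp (OnePoint.map fun w => c * w)) ?_ h1'
      (h1.comp _) hx h4 γ
    intro x γ
    obtain ⟨ψ, h5, h6⟩ := hf.isSphereAnalytic x γ
    exact ⟨_, h5.comp _, h6.map_mul hc⟩

/-- Two developing maps differ by a fractional linear transformation. -/
lemma IsDevelopingMap.exists_gl (hf : g.IsDevelopingMap f) (hf' : g.IsDevelopingMap f') :
    ∃ A : GL (Fin 2) ℂ, ∀ (y : g.Regular) (γ : Path y₀ y), f.toFun γ = A • f'.toFun γ := by
  have he := chart_mem_atlas ℂ (y₀ : X)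
  have hx := mem_chart_source ℂ (y₀ : X)
  obtain ⟨φ, h1, h2⟩ := hf.exists_represents (Path.refl y₀) he hx
  obtain ⟨φ', h1', h2'⟩ := hf'.exists_represents (Path.refl y₀) he hx
  obtain ⟨A, hA⟩ := exists_gl_of_hasSphereDensity h2 h2'
  refine ⟨A, fun y γ => hf.isSphereAnalytic.eq (f' := f'.comp (A • ·)) ?_ h1 (h1'.comp _) hx hA γ⟩
  intro x γ
  obtain ⟨ψ, h5, h6⟩ := hf'.isSphereAnalytic x γ
  exact ⟨_, h5.comp _, h6.smul A⟩

end SphericalMetric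

/-! ### Integrals along paths -/

lemma eventually_sub_eq_of_hasFDerivAt {E : Type*} [NormedAddCommGroup E] [NormedSpace ℝ E]
    {f g : ℂ → E} {f' : ℂ → ℂ →L[ℝ] E} {z : ℂ} (hf : ∀ᶠ w in 𝓝 z, HasFDerivAt f (f' w) w)
    (hg : ∀ᶠ w in 𝓝 z, HasFDerivAt g (f' w) w) : ∀ᶠ w in 𝓝 z, f w - g w = f z - g z := by
  obtain ⟨ε, hε, h⟩ := Metric.eventually_nhds_iff_ball.1 (hf.and hg)
  filter_upwards [Metric.ball_mem_nhds z hε] with w hw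
  have h1 : ∀ x ∈ Metric.ball z ε, HasFDerivAt (fun w => f w - g w) (0 : ℂ →L[ℝ] E) x :=
    fun x hx => by simpa using (h x hx).1.fun_sub (h x hx).2
  exact (convex_ball z ε).is_const_of_fderivWithin_eq_zero (𝕜 := ℝ)
    (f := fun w => f w - g w)
    (fun x hx => (h1 x hx).differentiableAt.differentiableWithinAt)
    (fun x hx => by
      rw [fderivWithin_of_isOpen Metric.isOpen_ball hx, (h1 x hx).fderiv])
    hw (Metric.mem_ball_self hε)

lemma eventually_sub_eq_of_hasDerivAt {f g f' : ℂ → ℂ} {z : ℂ}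
    (hf : ∀ᶠ w in 𝓝 z, HasDerivAt f (f' w) w) (hg : ∀ᶠ w in 𝓝 z, HasDerivAt g (f' w) w) :
    ∀ᶠ w in 𝓝 z, f w - g w = f z - g z :=
  eventually_sub_eq_of_hasFDerivAt (hf.mono fun _ h => h.hasFDerivAt.restrictScalars ℝ)
    (hg.mono fun _ h => h.hasFDerivAt.restrictScalars ℝ)

namespace MeromorphicForm

variable {X : Type*} [TopologicalSpace X] [ChartedSpace ℂ X] {η : MeromorphicForm X}
  {γ : unitInterval → X}

/-- `F` is a primitive of `η` along the path `γ`. -/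
def IsPrimitiveAlong (η : MeromorphicForm X) (γ : unitInterval → X) (F : unitInterval → ℂ) : Prop :=
  ∀ t, ∃ e ∈ atlas ℂ X, γ t ∈ e.source ∧ ∃ G : ℂ → ℂ,
    (∀ᶠ z in 𝓝 (e (γ t)), HasDerivAt G (η.coeff e z) z) ∧ ∀ᶠ s in 𝓝 t, F s = G (e (γ s))

/-- A function along `γ` that is locally the exponential of a primitive of `η` has a logarithm. -/
lemma exists_hasPathIntegral_of_exp (hγ : Continuous γ) {h : unitInterval → ℂ}
    (hh : ∀ t, ∃ e ∈ atlas ℂ X, γ t ∈ e.source ∧ ∃ K : ℂ → ℂ,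
      (∀ᶠ z in 𝓝 (e (γ t)), HasDerivAt K (η.coeff e z) z) ∧
        ∀ᶠ s in 𝓝 t, h s = Complex.exp (K (e (γ s)))) :
    ∃ I, η.HasPathIntegral γ I ∧ h 1 = h 0 * Complex.exp I := by
  have hne : ∀ t, h t ≠ 0 := by
    intro t
    obtain ⟨e, -, -, K, -, hK⟩ := hh t
    rw [hK.self_of_nhds]
    exact Complex.exp_ne_zero _
  have hc : Continuous h := by
    refine continuous_iff_continuousAt.2 fun t => ?_
    obtain ⟨e, -, ht, K, hK', hK⟩ := hh t
    refine ContinuousAt.congr ?_ (hK.mono fun s hs => hs.symm)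
    exact (ContinuousAt.comp (f := fun s => e (γ s)) (g := K)
      hK'.self_of_nhds.continuousAt ((e.continuousAt ht).comp hγ.continuousAt)).cexp
  let hC : C(unitInterval, {z : ℂ // z ≠ 0}) := ⟨fun t => ⟨h t, hne t⟩, by fun_prop⟩
  -- A continuous logarithm of `h` along the interval, by path lifting for the covering `exp`.
  set F := Complex.isCoveringMap_exp.liftPath hC (Complex.log (h 0))
    (Subtype.ext (Complex.exp_log (hne 0)).symm) with hFdef
  have hF : ∀ t, Complex.exp (F t) = h t := fun t => congrArg Subtype.val
    (congrFun (Complex.isCoveringMap_exp.liftPath_lifts hC (Complex.log (h 0))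
      (Subtype.ext (Complex.exp_log (hne 0)).symm)) t)
  refine ⟨F 1 - F 0, ⟨F, fun t => ?_, rfl⟩, ?_⟩
  · obtain ⟨e, he, ht, K, hK', hK⟩ := hh t
    refine ⟨e, he, ht, fun z => K z + (F t - K (e (γ t))), hK'.mono fun z hz => hz.add_const _, ?_⟩
    have h1 : ContinuousAt (fun s => F s - K (e (γ s))) t :=
      F.continuous.continuousAt.sub (ContinuousAt.comp (f := fun s => e (γ s)) (g := K)
        hK'.self_of_nhds.continuousAt ((e.continuousAt ht).comp hγ.continuousAt))
    have h2 : ∀ᶠ s in 𝓝 t, ∃ n : ℤ, F s - K (e (γ s)) = n * (2 * Real.pi * Complex.I) := by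
      filter_upwards [hK] with s hs
      rw [← hF s] at hs
      obtain ⟨n, hn⟩ := Complex.exp_eq_exp_iff_exists_int.1 hs
      exact ⟨n, by rw [hn]; ring⟩
    obtain ⟨m, hm⟩ := h2.self_of_nhds
    -- Both `F` and the local primitive are logarithms of `h`. Their difference is continuous with
    -- values in `2πiℤ`, and a variation below `1 < 2π` forces it to be constant.
    filter_upwards [h2, h1.eventually (Metric.ball_mem_nhds _ one_pos)] with s ⟨n, hn⟩ hs
    rw [dist_eq_norm, hn, hm, ← sub_mul, norm_mul] at hs
    have h3 : n = m := by
      by_contra hnm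
      have h4 : (1 : ℝ) ≤ ‖((n : ℂ) - m)‖ := by
        rw [← Int.cast_sub, Complex.norm_intCast]
        exact_mod_cast Int.one_le_abs (sub_ne_zero.2 hnm)
      have h5 : ‖(2 * Real.pi * Complex.I : ℂ)‖ = 2 * Real.pi := by
        simp [Real.pi_pos.le]
      rw [h5] at hs
      nlinarith [Real.pi_gt_three]
    rw [hm, ← h3, ← hn]
    ring
  · rw [← hF 1, ← hF 0, ← Complex.exp_add]
    congr 1
    ring

variable [IsManifold 𝓘(ℂ) ω X]

lemma IsPrimitiveAlong.sub_eq {F F' : unitInterval → ℂ} (hF : η.IsPrimitiveAlong γ F)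
    (hF' : η.IsPrimitiveAlong γ F') (hγ : Continuous γ) (s t : unitInterval) :
    F s - F' s = F t - F' t := by
  have h : IsLocallyConstant fun s => F s - F' s := by
    refine (IsLocallyConstant.iff_eventually_eq _).2 fun t => ?_
    obtain ⟨e, he, ht, G, hG, hFG⟩ := hF t
    obtain ⟨e', he', ht', G', hG', hFG'⟩ := hF' t
    have hz := e.map_source ht
    have hz' : e.symm (e (γ t)) ∈ e'.source := by rwa [e.left_inv ht]
    have h1 : ∀ᶠ w in 𝓝 (e (γ t)),
        HasDerivAt (fun w => G' (e' (e.symm w))) (η.coeff e w) w := by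
      have hc : Tendsto (fun w => e' (e.symm w)) (𝓝 (e (γ t))) (𝓝 (e' (γ t))) := by
        have := (analyticAt_transition he he' hz hz').continuousAt.tendsto
        rwa [e.left_inv ht] at this
      filter_upwards [hc.eventually hG', eventually_transition ht ht',
        η.coeff_eventually_eq he he' ht ht'] with w h2 h3 h4
      rw [h4]
      exact h2.comp w (analyticAt_transition he he' h3.1 h3.2).differentiableAt.hasDerivAt
    have h2 := eventually_sub_eq_of_hasDerivAt hG h1
    have h3 : Tendsto (fun s => e (γ s)) (𝓝 t) (𝓝 (e (γ t))) :=
      (e.continuousAt ht).tendsto.comp hγ.continuousAt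
    filter_upwards [hFG, hFG', h3.eventually h2,
      hγ.continuousAt.eventually (e.open_source.mem_nhds ht)] with s h4 h5 h6 h7
    rw [h4, h5, hFG.self_of_nhds, hFG'.self_of_nhds]
    simpa [e.left_inv h7, e.left_inv ht] using h6
  exact h.apply_eq_of_preconnectedSpace s t

lemma HasPathIntegral.unique {I I' : ℂ} (h : η.HasPathIntegral γ I) (h' : η.HasPathIntegral γ I')
    (hγ : Continuous γ) : I = I' := by
  obtain ⟨F, hF, rfl⟩ := h
  obtain ⟨F', hF', rfl⟩ := h'
  have := IsPrimitiveAlong.sub_eq hF hF' hγ 1 0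
  linear_combination this

lemma eventually_nhds_not_isPole {p : X} (h : ¬ η.IsPole p) :
    ∀ᶠ y in 𝓝 p, ¬ η.IsPole y := by
  filter_upwards [eventually_nhdsWithin_iff.1 (η.eventually_not_isPole p)] with y hy
  by_cases hyp : y = p
  · rwa [hyp]
  · exact hy hyp

/-- The real part of the integral depends only on the end points; hence `|f|` is single-valued. -/
lemma HasPathIntegral.re_eq {u : X → ℝ} (hu : η.IsRealPrimitive u) {I : ℂ}
    (h : η.HasPathIntegral γ I) (hγ : Continuous γ) (hp : ∀ t, ¬ η.IsPole (γ t)) :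
    I.re = u (γ 1) - u (γ 0) := by
  obtain ⟨F, hF, rfl⟩ := h
  have h : IsLocallyConstant fun s => (F s).re - u (γ s) := by
    refine (IsLocallyConstant.iff_eventually_eq _).2 fun t => ?_
    obtain ⟨e, he, ht, G, hG, hFG⟩ := hF t
    have h1 : ∀ᶠ w in 𝓝 (e (γ t)), HasFDerivAt (fun w => u (e.symm w))
        (Complex.reCLM.comp (ContinuousLinearMap.mul ℝ ℂ (η.coeff e w))) w := by
      filter_upwards [eventually_symm ht (eventually_nhds_not_isPole (hp t)),
        e.open_target.mem_nhds (e.map_source ht)] with w h2 h3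
      exact hu e he w h3 h2
    have h2 := eventually_sub_eq_of_hasFDerivAt
      (hG.mono fun w hw => hasFDerivAt_re_of_hasDerivAt hw) h1
    have h3 : Tendsto (fun s => e (γ s)) (𝓝 t) (𝓝 (e (γ t))) :=
      (e.continuousAt ht).tendsto.comp hγ.continuousAt
    filter_upwards [hFG, h3.eventually h2,
      hγ.continuousAt.eventually (e.open_source.mem_nhds ht)] with s h4 h6 h7
    rw [h4, hFG.self_of_nhds]
    simpa [e.left_inv h7, e.left_inv ht] using h6
  have := h.apply_eq_of_preconnectedSpace 1 0
  rw [Complex.sub_re]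
  linarith

/-- The integral over a small circle around a simple pole. -/
lemma exists_loop_hasPathIntegral {ρ : ℂ} {K : ℂ → ℂ} {e : OpenPartialHomeomorph X ℂ}
    (he : e ∈ atlas ℂ X) {p : X} (hp : p ∈ e.source)
    (h : HasSimplePoleExpansion (η.coeff e) ρ K (e p)) :
    ∃ (q : X) (γ : Path q q), (∀ t, ¬ η.IsPole (γ t)) ∧
      η.HasPathIntegral γ (2 * Real.pi * Complex.I * ρ) := by
  obtain ⟨hK, ha⟩ := h
  obtain ⟨ε, hε, hball⟩ := eventually_punctured_iff.1 (((((eventually_symm_punctured hp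
    (η.eventually_not_isPole p)).and (eventually_eventually_punctured ha)).and
    (nhdsWithin_le_nhds hK.eventually_analyticAt))).and
    (nhdsWithin_le_nhds (e.open_target.mem_nhds (e.map_source hp))))
  have hδ : ((ε / 2 : ℝ) : ℂ) ≠ 0 := by exact_mod_cast (half_pos hε).ne'
  set E : unitInterval → ℂ := fun t => Complex.exp (2 * Real.pi * Complex.I * (t : ℝ)) with hE
  set c : unitInterval → ℂ := fun t => e p + (ε / 2 : ℝ) * E t with hcdef
  have hc : Continuous c := by fun_prop
  have hnorm : ∀ t, ‖E t‖ = 1 := fun t => by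
    change ‖Complex.exp (2 * Real.pi * Complex.I * (t : ℝ))‖ = 1
    rw [show (2 * Real.pi * Complex.I * (t : ℝ) : ℂ) = ((2 * Real.pi * t : ℝ) : ℂ) * Complex.I by
      push_cast; ring]
    exact Complex.norm_exp_ofReal_mul_I _
  have hcb : ∀ t, c t ∈ Metric.ball (e p) ε \ {e p} := by
    intro t
    constructor
    · rw [Metric.mem_ball, dist_eq_norm, hcdef, add_sub_cancel_left, norm_mul, hnorm,
        Complex.norm_real, Real.norm_eq_abs, abs_of_pos (half_pos hε)]
      linarith
    · simpa [hcdef, hE] using hε.ne'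
  have hct : ∀ t, c t ∈ e.target := fun t => (hball _ (hcb t)).2
  have hγ : Continuous fun t => e.symm (c t) := e.continuousOn_symm.comp_continuous hc hct
  have h10 : c 1 = c 0 := by simp [hcdef, hE]
  let γ : Path (e.symm (c 0)) (e.symm (c 0)) :=
    { toFun := fun t => e.symm (c t)
      continuous_toFun := hγ
      source' := rfl
      target' := by simp only [h10] }
  refine ⟨_, γ, fun t => (hball _ (hcb t)).1.1.1,
    fun t => ρ * (2 * Real.pi * Complex.I * (t : ℝ)) + K (c t), fun t => ?_, ?_⟩
  · have het : e (γ t) = c t := e.right_inv (hct t)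
    have hne : c t - e p ≠ 0 := sub_ne_zero.2 (hcb t).2
    -- The logarithm is normalized at `c t`: its argument equals `1` there, so the principal branch
    -- is holomorphic nearby, and the angle already covered is added by hand.
    refine ⟨e, he, e.map_target (hct t), fun w => ρ * (Complex.log ((w - e p) / (c t - e p)) +
      2 * Real.pi * Complex.I * (t : ℝ)) + K w, ?_, ?_⟩
    · rw [het]
      have h1 : ∀ᶠ w in 𝓝 (c t), (w - e p) / (c t - e p) ∈ Complex.slitPlane := by
        have h2 : ContinuousAt (fun w => (w - e p) / (c t - e p)) (c t) := by fun_prop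
        refine h2.eventually (Complex.isOpen_slitPlane.mem_nhds ?_)
        simp only [div_self hne]
        exact Complex.one_mem_slitPlane
      filter_upwards [h1, (hball _ (hcb t)).1.1.2, (hball _ (hcb t)).1.2.eventually_analyticAt,
        (isOpen_ball_diff_center _ _).mem_nhds (hcb t)] with w h2 h3 h4 h5
      have hw : w - e p ≠ 0 := sub_ne_zero.2 h5.2
      rw [h3]
      have h6 := ((((hasDerivAt_id w).sub_const (e p)).div_const (c t - e p)).clog h2).add_const
        (2 * Real.pi * Complex.I * (t : ℝ) : ℂ)
      refine ((h6.const_mul ρ).add h4.differentiableAt.hasDerivAt).congr_deriv ?_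
      simp only [id]
      field_simp
    -- An angle below `π` in absolute value is what the principal logarithm returns unchanged.
    · have h1 : ∀ᶠ s : unitInterval in 𝓝 t, |2 * Real.pi * ((s : ℝ) - t)| < Real.pi := by
        have : ContinuousAt (fun s : unitInterval => |2 * Real.pi * ((s : ℝ) - t)|) t := by fun_prop
        refine this.eventually (gt_mem_nhds ?_)
        simp [Real.pi_pos]
      filter_upwards [h1] with s hs
      have hes : e (γ s) = c s := e.right_inv (hct s)
      rw [hes]
      have h2 : (c s - e p) / (c t - e p) =
          Complex.exp ((2 * Real.pi * ((s : ℝ) - t) : ℝ) * Complex.I) := by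
        simp only [hcdef, hE, add_sub_cancel_left]
        rw [mul_div_mul_left _ _ hδ, ← Complex.exp_sub]
        congr 1
        push_cast
        ring
      rw [h2, Complex.log_exp]
      · push_cast
        ring
      · simpa using (abs_lt.1 hs).1
      · simpa using (abs_lt.1 hs).2.le
  · simp only [h10]
    simp
    ring

end MeromorphicForm

/-! ### The cone angles -/

namespace MeromorphicForm

variable {X : Type*} [TopologicalSpace X] [ChartedSpace ℂ X] {η : MeromorphicForm X} {p : X}

open Classical in
/-- The coefficient at `p` of the divisor of a metric with character 1-form `η`. -/
def conicalOrder (η : MeromorphicForm X) (p : X) : ℝ :=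
  if η.IsPole p then |(η.residue p).re| - 1 else ((η.orderAt p).untop₀ : ℝ)

lemma conicalOrder_of_isPole (h : η.IsPole p) : η.conicalOrder p = |(η.residue p).re| - 1 :=
  if_pos h

lemma conicalOrder_of_not_isPole (h : ¬ η.IsPole p) :
    η.conicalOrder p = ((η.orderAt p).untop₀ : ℝ) := if_neg h

lemma conicalOrder_eq_zero {p : X} (h : η.orderAt p = 0) : η.conicalOrder p = 0 := by
  rw [conicalOrder_of_not_isPole fun h' => h'.orderAt_ne_zero h, h]
  simp

lemma IsRealPrimitive.exists_tendsto_log_expDensity [IsManifold 𝓘(ℂ) ω X] {u : X → ℝ} {C : ℝ}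
    (hu : η.IsRealPrimitive u) (hC : 0 < C) (h3 : η.IsThirdKind) {e : OpenPartialHomeomorph X ℂ}
    (he : e ∈ atlas ℂ X) (hp : p ∈ e.source)
    (hres : η.IsPole p → (η.residue p).im = 0 ∧ η.residue p ≠ 0) (htop : η.orderAt p ≠ ⊤) :
    ∃ l, Tendsto (fun z => Real.log (expDensity ‖η.coeff e z‖ (C * Real.exp (u (e.symm z)))) -
      η.conicalOrder p * Real.log ‖z - e p‖) (𝓝[≠] (e p)) (𝓝 l) := by
  have hexp : ∀ z, C * Real.exp (u (e.symm z)) = Real.exp (Real.log C + u (e.symm z)) := fun z => by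
    rw [Real.exp_add, Real.exp_log hC]
  simp only [hexp]
  by_cases hpole : η.IsPole p
  · obtain ⟨him, hne⟩ := hres hpole
    rw [conicalOrder_of_isPole hpole]
    have hρ : ((η.residue p).re : ℂ) = η.residue p := Complex.ext rfl (by simp [him])
    obtain ⟨K, hK⟩ := η.exists_expansion h3 he hp
    rw [← hρ] at hK
    obtain ⟨c, hc⟩ := hK.exists_re (hu.eventually_hasFDerivAt he hp)
    exact exists_tendsto_log_expDensity_pole (ρ := (η.residue p).re)
      (h := fun y => Real.log C + ((K y).re + c)) (fun h0 => hne (by rw [← hρ, h0]; simp)) hne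
      (η.tendsto_residue h3 he hp) (hc.mono fun y hy => by rw [hy]; ring)
      ((tendsto_const_nhds.add ((Complex.continuous_re.continuousAt.comp
        hK.1.continuousAt).tendsto.add tendsto_const_nhds)).mono_left nhdsWithin_le_nhds)
  · rw [conicalOrder_of_not_isPole hpole]
    refine RSurf.exists_tendsto_log_expDensity (η.meromorphicNFAt he hp).meromorphicAt ?_
      ((tendsto_const_nhds.add (hu.hasFDerivAt he hp hpole).continuousAt.tendsto).mono_left
        nhdsWithin_le_nhds)
    rw [← η.orderAt_eq he hp]
    exact (WithTop.coe_untop₀_of_ne_top htop).symm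

end MeromorphicForm

/-! ### Developing maps as exponentials of integrals -/

lemma continuous_coe_path {X : Type*} [TopologicalSpace X] {S : Finset X} {y y' : {x : X // x ∉ S}} (γ : Path y y') :
    Continuous fun t => (γ t : X) := continuous_subtype_val.comp γ.continuous

section LogElements

variable {X : Type*} [TopologicalSpace X] [ChartedSpace ℂ X] {S : Finset X}
  {y₀ : {x : X // x ∉ S}} {f : MultiFun {x : X // x ∉ S} y₀} {η : MeromorphicForm X}

/-- All function elements of `f` are meromorphic with logarithmic differential `η`. -/
def HasLogElements (f : MultiFun {x : X // x ∉ S} y₀) (η : MeromorphicForm X) : Prop :=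
  ∀ (x : {x : X // x ∉ S}) (γ : Path y₀ x), ∀ e ∈ atlas ℂ X, (x : X) ∈ e.source →
    ∃ φ, Represents f γ e φ ∧ LogGerm (η.coeff e) φ (e x)

lemma MultiFun.toFun_cast {Y : Type*} [TopologicalSpace Y] {y₀ : Y} (f : MultiFun Y y₀) {y y' : Y}
    (γ : Path y₀ y) (h : y' = y) : f.toFun (γ.cast rfl h) = f.toFun γ := by
  subst h; rfl

/-- Continuation along a path of a function element that is an exponential of a primitive. -/
lemma exists_hasPathIntegral_of_represents {y : {x : X // x ∉ S}} (γ : Path y₀ y)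
    (h : ∀ t, ∃ e ∈ atlas ℂ X, (γ t : X) ∈ e.source ∧ ∃ K : ℂ → ℂ,
      (∀ᶠ z in 𝓝 (e (γ t)), HasDerivAt K (η.coeff e z) z) ∧
      Represents f (pathPrefix γ t) e fun z => ((Complex.exp (K z) : ℂ) : OnePoint ℂ)) :
    ∃ I, η.HasPathIntegral (fun t => (γ t : X)) I ∧ ∃ c : ℂ, c ≠ 0 ∧
      f.toFun (Path.refl y₀) = c ∧ f.toFun γ = ((c * Complex.exp I : ℂ) : OnePoint ℂ) := by
  have hfin : ∀ t, ∃ c : ℂ, c ≠ 0 ∧ f.toFun (pathPrefix γ t) = c := by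
    intro t
    obtain ⟨e, -, -, K, -, hK⟩ := h t
    exact ⟨_, Complex.exp_ne_zero _, hK.apply⟩
  choose w hw0 hw using hfin
  obtain ⟨I, hI, h1⟩ := MeromorphicForm.exists_hasPathIntegral_of_exp (η := η) (h := w)
    (continuous_coe_path γ) (by
      intro t
      obtain ⟨e, he, ht, K, hK, hr⟩ := h t
      refine ⟨e, he, ht, K, hK, ?_⟩
      obtain ⟨U, hU, hr⟩ := hr
      filter_upwards [eventually_uIcc_subset γ (W := Subtype.val ⁻¹' U)
        (continuous_subtype_val.continuousAt hU)] with s hs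
      have h2 := hr (γ s) (γ.subpath t s) (subpath_mem γ (W := Subtype.val ⁻¹' U) hs)
      rw [f.homotopic _ _ (pathPrefix_trans_subpath γ t s), hw s] at h2
      exact OnePoint.coe_injective h2)
  refine ⟨I, hI, w 0, hw0 0, ?_, ?_⟩
  · rw [← hw 0, pathPrefix_zero, f.toFun_cast]
  · rw [← h1, ← hw 1, pathPrefix_one, f.toFun_cast]

variable [IsManifold 𝓘(ℂ) ω X]

lemma HasLogElements.exists_hasPathIntegral (hf : HasLogElements f η) {y : {x : X // x ∉ S}}
    (γ : Path y₀ y) (hγ : ∀ t, ¬ η.IsPole (γ t : X)) :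
    ∃ I, η.HasPathIntegral (fun t => (γ t : X)) I ∧ ∃ c : ℂ, c ≠ 0 ∧
      f.toFun (Path.refl y₀) = c ∧ f.toFun γ = ((c * Complex.exp I : ℂ) : OnePoint ℂ) := by
  refine exists_hasPathIntegral_of_represents γ fun t => ?_
  have he := chart_mem_atlas ℂ (γ t : X)
  have hx := mem_chart_source ℂ (γ t : X)
  obtain ⟨φ, h1, h2⟩ := hf _ (pathPrefix γ t) _ he hx
  obtain ⟨K, hK, h3⟩ := h2.exists_eq_exp (η.analyticAt_coeff he hx (hγ t))
  exact ⟨_, he, hx, K, hK, h1.congr hx (h3.mono fun z hz => hz.symm)⟩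

end LogElements

namespace SphericalMetric

variable {X : Type*} [TopologicalSpace X] [ChartedSpace ℂ X] {g g' : SphericalMetric X}
  {y₀ : g.Regular} {f f' : MultiFun g.Regular y₀} {e : OpenPartialHomeomorph X ℂ}
  {η : MeromorphicForm X} {u : X → ℝ} {C C' : ℝ}

lemma IsDevelopingMap.comp_mul (hf : g.IsDevelopingMap f) {c : ℂ} (hc : ‖c‖ = 1) :
    g.IsDevelopingMap (f.comp (OnePoint.map fun w => c * w)) := by
  refine isDevelopingMap_of_represents fun x γ e he hx => ?_
  obtain ⟨ι, F, hι, ⟨hF, h1⟩, h2, h3⟩ := hf x γ e he hx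
  exact ⟨_, Represents.comp (φ := fun z => ι (F z)) h1 _,
    HasSphereDensity.map_mul ⟨ι, F, hι, hF, EventuallyEq.rfl, h2, h3⟩ hc⟩

lemma IsExpIntegral.comp_mul {c : ℂ} (hf : IsExpIntegral f η c) (b : ℂ) :
    IsExpIntegral (f.comp (OnePoint.map fun w => b * w)) η (b * c) := by
  intro x γ hγ
  obtain ⟨I, hI, h⟩ := hf x γ hγ
  refine ⟨I, hI, ?_⟩
  change OnePoint.map _ (f.toFun γ) = _
  rw [h, mul_assoc]
  rfl

/-- Off the poles of `η = du + i (...)`, the metric is the pull-back of the standard one by a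
function of modulus `C * exp u` with logarithmic differential `η`. -/
def HasExpDensity (g : SphericalMetric X) (η : MeromorphicForm X) (u : X → ℝ) (C : ℝ) : Prop :=
  ∀ e ∈ atlas ℂ X, ∀ p ∈ e.source, p ∉ g.div.support → ¬ η.IsPole p →
    g.density e (e p) = expDensity ‖η.coeff e (e p)‖ (C * Real.exp (u p))

lemma continuousAt_density (g : SphericalMetric X) (he : e ∈ atlas ℂ X) {p : X}
    (hp : p ∈ e.source) (h : p ∉ g.div.support) : ContinuousAt (g.density e) (e p) :=
  (g.smooth e he _ (e.map_source hp) (by rwa [e.left_inv hp])).continuousAt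

lemma density_apply_pos (g : SphericalMetric X) (he : e ∈ atlas ℂ X) {p : X}
    (hp : p ∈ e.source) (h : p ∉ g.div.support) : 0 < g.density e (e p) :=
  g.density_pos e he _ (e.map_source hp) (by rwa [e.left_inv hp])

lemma HasLogElements.isExpIntegral [IsManifold 𝓘(ℂ) ω X] (hf : HasLogElements f η) (h0 : ¬ η.IsPole (y₀ : X)) :
    ∃ c : ℂ, c ≠ 0 ∧ f.toFun (Path.refl y₀) = c ∧ IsExpIntegral f η c := by
  obtain ⟨-, -, c, hc, h1, -⟩ := hf.exists_hasPathIntegral (Path.refl y₀) fun _ => h0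
  refine ⟨c, hc, h1, fun x γ hγ => ?_⟩
  obtain ⟨I, hI, c', -, h2, h3⟩ := hf.exists_hasPathIntegral γ hγ
  rw [h1] at h2
  rw [← OnePoint.coe_injective h2] at h3
  exact ⟨I, hI, h3⟩

/-- At a regular point the coefficient of the divisor is `0` and the density is continuous and
positive. The conical asymptotics thus hold everywhere, and exponents can be compared without
knowing where `g` is singular. -/
lemma exists_tendsto_log_density (g : SphericalMetric X) (he : e ∈ atlas ℂ X) {p : X}
    (hp : p ∈ e.source) :
    ∃ l : ℝ, Tendsto (fun z => Real.log (g.density e z) - g.div p * Real.log ‖z - e p‖)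
      (𝓝[≠] (e p)) (𝓝 l) := by
  by_cases h : p ∈ g.div.support
  · exact g.conical e he p hp h
  · rw [Finsupp.notMem_support_iff.1 h]
    refine ⟨Real.log (g.density e (e p)), ?_⟩
    simpa using ((g.continuousAt_density he hp h).log
      (g.density_apply_pos he hp h).ne').tendsto.mono_left nhdsWithin_le_nhds

variable [T1Space X]

lemma IsDevelopingMap.hasLogElements (hf : g.IsDevelopingMap f) (hη : HasLogDifferential f η) :
    HasLogElements f η := fun _ γ _ he hx =>
  let ⟨φ, h1, _, h2⟩ := hf.exists_logGerm hη γ he hx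
  ⟨φ, h1, h2⟩

variable [IsManifold 𝓘(ℂ) ω X]

lemma HasExpDensity.eventually (h : g.HasExpDensity η u C) (he : e ∈ atlas ℂ X) {p : X}
    (hp : p ∈ e.source) : ∀ᶠ z in 𝓝[≠] (e p), g.density e z =
      expDensity ‖η.coeff e z‖ (C * Real.exp (u (e.symm z))) := by
  filter_upwards [eventually_symm_punctured hp (η.eventually_not_isPole p),
    eventually_symm_punctured hp (eventually_notMem_finite g.div.support.finite_toSet p),
    nhdsWithin_le_nhds (e.open_target.mem_nhds (e.map_source hp))] with z h1 h2 h3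
  have := h e he (e.symm z) (e.map_target h3) h2 h1
  rwa [e.right_inv h3] at this

lemma HasExpDensity.div_eq (h : g.HasExpDensity η u C) (hC : 0 < C) (hu : η.IsRealPrimitive u)
    (h3 : η.IsThirdKind) {p : X} (hres : η.IsPole p → (η.residue p).im = 0 ∧ η.residue p ≠ 0)
    (htop : η.orderAt p ≠ ⊤) : g.div p = η.conicalOrder p := by
  have he := chart_mem_atlas ℂ p
  have hp := mem_chart_source ℂ p
  obtain ⟨l, hl⟩ := g.exists_tendsto_log_density he hp
  obtain ⟨l', hl'⟩ := hu.exists_tendsto_log_expDensity hC h3 he hp hres htop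
  refine exponent_unique hl (hl'.congr' ?_)
  filter_upwards [h.eventually he hp] with z hz
  rw [hz]

/-- The formula gives both densities on a punctured neighbourhood of every point. Continuity extends
the equality to the regular points that are poles of the form. -/
lemma HasExpDensity.same (h : g.HasExpDensity η u C) (h' : g'.HasExpDensity η u C) (hC : 0 < C)
    (hu : η.IsRealPrimitive u) (h3 : η.IsThirdKind)
    (hres : ∀ p, η.IsPole p → (η.residue p).im = 0 ∧ η.residue p ≠ 0)
    (htop : ∀ p, η.orderAt p ≠ ⊤) : g.Same g' := by
  have hdiv : g.div = g'.div := by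
    ext p
    rw [h.div_eq hC hu h3 (hres p) (htop p), h'.div_eq hC hu h3 (hres p) (htop p)]
  refine ⟨hdiv, fun e he z hz hzs => ?_⟩
  have hp := e.map_target hz
  have h1 := (g.continuousAt_density he hp hzs).tendsto.mono_left (nhdsWithin_le_nhds (s := {e (e.symm z)}ᶜ))
  have h2 := (g'.continuousAt_density he hp (hdiv ▸ hzs)).tendsto.mono_left
    (nhdsWithin_le_nhds (s := {e (e.symm z)}ᶜ))
  have h3 := tendsto_nhds_unique (h1.congr' ?_) h2
  · rwa [e.right_inv hz] at h3
  · filter_upwards [h.eventually he hp, h'.eventually he hp] with w h4 h5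
    rw [h4, h5]

/-- Cross-multiplication gives `(C - C') (1 - C C' e^{2u}) = 0`. If `C ≠ C'`, then `u` is constant
near `x`, so the coefficient of the form vanishes at `x`, against order zero. -/
lemma HasExpDensity.eq (h : g.HasExpDensity η u C) (h' : g.HasExpDensity η u C') (hC : 0 < C)
    (hC' : 0 < C') (hu : η.IsRealPrimitive u) {x : X} (hx : η.orderAt x = 0) : C = C' := by
  by_contra hne
  have he := chart_mem_atlas ℂ x
  have hp := mem_chart_source ℂ x
  have hx' : ¬ η.IsPole x := fun h => h.orderAt_ne_zero hx
  have h0 := (η.orderAt_eq_zero_iff he hp).1 hx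
  have hd := hu.hasFDerivAt he hp hx'
  have h1 : ∀ᶠ z in 𝓝[≠] (chartAt ℂ x x), u ((chartAt ℂ x).symm z) = -Real.log (C * C') / 2 := by
    filter_upwards [h.eventually he hp, h'.eventually he hp, nhdsWithin_le_nhds
      ((η.analyticAt_coeff he hp hx').continuousAt.eventually_ne h0)] with z h1 h2 h3
    rw [h1] at h2
    set E := Real.exp (u ((chartAt ℂ x).symm z)) with hE
    have hEp : 0 < E := Real.exp_pos _
    have hA : 0 < ‖η.coeff (chartAt ℂ x) z‖ := norm_pos_iff.2 h3
    simp only [expDensity] at h2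
    rw [div_eq_div_iff (by positivity) (by positivity)] at h2
    have h4 : 2 * ‖η.coeff (chartAt ℂ x) z‖ * E * (C - C') * (1 - C * C' * E ^ 2) = 0 := by
      linear_combination h2
    have h5 : C * C' * E ^ 2 = 1 := by
      have := (mul_eq_zero.1 h4).resolve_left
        (mul_ne_zero (by positivity) (sub_ne_zero.2 hne))
      linarith
    have h6 := congrArg Real.log h5
    rw [Real.log_mul (by positivity) (by positivity), Real.log_pow, hE, Real.log_exp,
      Real.log_one] at h6
    push_cast at h6
    linarith
  have h2 : u ((chartAt ℂ x).symm (chartAt ℂ x x)) = -Real.log (C * C') / 2 :=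
    tendsto_nhds_unique (hd.continuousAt.tendsto.mono_left nhdsWithin_le_nhds)
      (tendsto_const_nhds.congr' (h1.mono fun z hz => hz.symm))
  have h3 : (fun z => u ((chartAt ℂ x).symm z)) =ᶠ[𝓝 (chartAt ℂ x x)]
      fun _ => -Real.log (C * C') / 2 := by
    filter_upwards [eventually_nhdsWithin_iff.1 h1] with z hz
    by_cases hzx : z = chartAt ℂ x x
    · rw [hzx, h2]
    · exact hz hzx
  have h4 : HasFDerivAt (fun z => u ((chartAt ℂ x).symm z))
      (Complex.reCLM.comp (ContinuousLinearMap.mul ℝ ℂ 0)) (chartAt ℂ x x) := by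
    refine HasFDerivAt.congr_of_eventuallyEq ?_ h3
    simpa using hasFDerivAt_const (-Real.log (C * C') / 2) (chartAt ℂ x x)
  exact h0 (reCLM_comp_mul_injective (hd.unique h4))

/-- The density of a metric whose developing map is an exponential of the integral of `η`. -/
lemma IsDevelopingMap.hasExpDensity [PreconnectedSpace X] (hf : g.IsDevelopingMap f) {c : ℂ}
    (hc : c ≠ 0) (hη : IsExpIntegral f η c) (hu : η.IsRealPrimitive u)
    (hfin : {p | η.IsPole p}.Finite) (h0 : ¬ η.IsPole (y₀ : X)) :
    g.HasExpDensity η u (‖c‖ * Real.exp (-u y₀)) := by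
  intro e he p hp hreg hpole
  set x : g.Regular := ⟨p, hreg⟩ with hx
  obtain ⟨γ, hγ⟩ := exists_path_avoiding hfin.toFinset (a := y₀) (b := x) (by simpa using h0)
    (by simpa using hpole)
  have hγ' : ∀ t, ¬ η.IsPole (γ t : X) := fun t => by simpa using hγ t
  obtain ⟨φ, h1, h2⟩ := hf.exists_represents γ he hp
  have h3 : ∀ᶠ z in 𝓝 (e p), ∃ w : ℂ, φ z = w ∧
      ‖w‖ = ‖c‖ * Real.exp (u (e.symm z) - u y₀) := by
    refine (h1.eventually_trans hp (MeromorphicForm.eventually_nhds_not_isPole hpole)).mono ?_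
    rintro z ⟨hz, y, hy, σ, hσ, h3⟩
    have h4 : ∀ t, ¬ η.IsPole ((γ.trans σ) t : X) :=
      trans_mem (W := fun x : g.Regular => ¬ η.IsPole (x : X)) hγ' hσ
    obtain ⟨I, hI, h5⟩ := hη y (γ.trans σ) h4
    rw [h3.apply, hy, e.right_inv hz] at h5
    refine ⟨_, h5, ?_⟩
    rw [norm_mul, Complex.norm_exp, hI.re_eq hu (continuous_coe_path _) h4]
    simp [hy]
  have hcn : 0 < ‖c‖ := norm_pos_iff.2 hc
  have key : ∃ F : ℂ → ℂ, AnalyticAt ℂ F (e p) ∧ ∀ᶠ z in 𝓝 (e p), φ z = (F z : OnePoint ℂ) := by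
    obtain ⟨ι, F, hι, hF, h4, -⟩ := h2.self_of_nhds
    obtain ⟨w, hw, hwn⟩ := h3.self_of_nhds
    rcases hι with rfl | rfl
    · exact ⟨F, hF, h4⟩
    · have h5 : F (e p) ≠ 0 := by
        intro h6
        rw [h4.self_of_nhds] at hw
        simp only [show F (e x) = 0 from h6] at hw
        simp [recip] at hw
      refine ⟨_, hF.inv h5, ?_⟩
      filter_upwards [h4, hF.continuousAt.eventually_ne h5] with z h6 h7
      rw [h6, recip_eq_some_inv h7]
      rfl
  obtain ⟨F, hF, h4⟩ := key
  have h5 : ∀ᶠ z in 𝓝 (e p), ‖F z‖ = ‖c‖ * Real.exp (u (e.symm z) - u y₀) := by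
    filter_upwards [h3, h4] with z ⟨w, hw, hwn⟩ h6
    rw [h6] at hw
    rwa [OnePoint.coe_injective hw]
  have hF0 : F (e p) ≠ 0 := by
    rw [← norm_pos_iff, h5.self_of_nhds]
    positivity
  have h6 := hasFDerivAt_log_norm hF.differentiableAt.hasDerivAt hF0
  -- The assumption on `f` gives only its values. The equation `dF / F = η` is recovered from `log
  -- |F| = u + const`, since a holomorphic form is determined by its real part.
  have h7 : HasFDerivAt (fun z => Real.log ‖F z‖)
      (Complex.reCLM.comp (ContinuousLinearMap.mul ℝ ℂ (η.coeff e (e p)))) (e p) := by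
    refine HasFDerivAt.congr_of_eventuallyEq ((hu.hasFDerivAt he hp hpole).add_const
      (Real.log ‖c‖ - u y₀)) ?_
    filter_upwards [h5] with z hz
    rw [hz, Real.log_mul hcn.ne' (Real.exp_pos _).ne', Real.log_exp]
    ring
  have h8 := reCLM_comp_mul_injective (h6.unique h7)
  rw [div_eq_iff hF0] at h8
  have h9 := (h2.self_of_nhds.eq_of_eventuallyEq (Or.inl rfl) h4).2
  rw [h9, sphereDensity_eq_expDensity h8, h5.self_of_nhds, e.left_inv hp, mul_assoc,
    ← Real.exp_add]
  congr 3
  ring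

/-- A developing map with logarithmic differential `η`, based at any regular point that is not a
pole. -/
lemma IsDevelopingMap.exists_isPullbackExp [PreconnectedSpace X] (hf : g.IsDevelopingMap f)
    (hη : HasLogDifferential f η) {x : X} (hx : ¬ η.IsPole x) (hx' : x ∉ g.div.support) :
    ∃ r : ℝ, 0 < r ∧ g.IsPullbackExp η x r := by
  obtain ⟨δ, -⟩ := exists_path_avoiding ∅ (a := y₀) (b := (⟨x, hx'⟩ : g.Regular)) (by simp) (by simp)
  have h1 := hf.shift δ
  obtain ⟨c, hc, -, h2⟩ := HasLogElements.isExpIntegral (h1.hasLogElements (hη.shift δ)) hx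
  have hcn : (‖c‖ : ℂ) ≠ 0 := by simpa using hc
  -- Multiplication by the unit number `|c| / c` keeps the metric and makes the constant positive.
  refine ⟨‖c‖, norm_pos_iff.2 hc, hx', _, h1.comp_mul (c := ‖c‖ / c) ?_, ?_⟩
  · simp [hc]
  · have := h2.comp_mul (‖c‖ / c)
    rwa [div_mul_cancel₀ _ hc] at this

lemma IsPullbackExp.hasExpDensity [PreconnectedSpace X] {x : X} {r : ℝ} (hr : 0 < r)
    (h : g.IsPullbackExp η x r) (hu : η.IsRealPrimitive u) (hfin : {p | η.IsPole p}.Finite)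
    (h0 : ¬ η.IsPole x) : g.HasExpDensity η u (r * Real.exp (-u x)) := by
  obtain ⟨hx, f, hf, hη⟩ := h
  have := hf.hasExpDensity (by exact_mod_cast hr.ne') hη hu hfin h0
  simpa [abs_of_pos hr] using this

/-- The base point of the given developing map may be a pole with residue `± 1`, so a nearby base
point is taken first. -/
lemma IsCharacterForm.exists_hasExpDensity [PreconnectedSpace X] (h : g.IsCharacterForm η)
    (hu : η.IsRealPrimitive u) (hfin : {p | η.IsPole p}.Finite) :
    ∃ C : ℝ, 0 < C ∧ g.HasExpDensity η u C := by
  obtain ⟨y₀, f, hf, -, hη⟩ := h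
  have := nhdsNE_neBot (y₀ : X)
  obtain ⟨x, h1, h2⟩ := (Filter.Eventually.and (η.eventually_not_isPole (y₀ : X))
    (eventually_notMem_finite g.div.support.finite_toSet (y₀ : X))).exists
  obtain ⟨r, hr, h3⟩ := hf.exists_isPullbackExp hη h1 h2
  exact ⟨_, by positivity, h3.hasExpDensity hr hu hfin h1⟩

end SphericalMetric

/-! ### Continuation in a locally constant system -/

/-- Parallel transport in the covering space given by a locally constant cocycle. -/
lemma exists_parallel_transport {Y G : Type*} [TopologicalSpace Y] [Monoid G] {U : Y → Set Y}
    (hU : ∀ y, IsOpen (U y)) (hmem : ∀ y, y ∈ U y) {c : Y → Y → Y → G}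
    (hself : ∀ i, ∀ y ∈ U i, c i i y = 1)
    (hloc : ∀ i j, ∀ y ∈ U i ∩ U j, ∀ᶠ y' in 𝓝 y, c i j y' = c i j y)
    (hcomp : ∀ i j k, ∀ y ∈ U i ∩ U j ∩ U k, c j k y * c i j y = c i k y) (y₀ : Y) :
    ∃ F : ∀ y, Path y₀ y → G, (∀ y (γ γ' : Path y₀ y), γ.Homotopic γ' → F y γ = F y γ') ∧
      ∀ x (γ : Path y₀ x) y (σ : Path x y), (∀ t, σ t ∈ U x) →
        F y (γ.trans σ) = c x y y * F x γ := by
  -- With discrete fibre, the bundle glued from the locally constant cocycle is a covering, and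
  -- transport is path lifting in it.
  let _ : TopologicalSpace G := ⊥
  have : DiscreteTopology G := ⟨rfl⟩
  let Z : FiberBundleCore Y Y G :=
    { baseSet := U
      isOpen_baseSet := hU
      indexAt := id
      mem_baseSet_at := hmem
      coordChange := fun i j y v => c i j y * v
      coordChange_self := fun i y hy v => by rw [hself i y hy, one_mul]
      continuousOn_coordChange := by
        rintro i j ⟨y, v⟩ hy
        refine ContinuousAt.continuousWithinAt ?_
        refine ContinuousAt.congr (f := fun p : Y × G => c i j y * p.2) ?_ ?_
        · exact (continuous_of_discreteTopology (f := fun v : G => c i j y * v)).continuousAt.comp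
            continuous_snd.continuousAt
        · filter_upwards [continuous_fst.continuousAt.eventually (hloc i j y hy.1)] with p hp
          rw [hp]
      coordChange_comp := fun i j k y hy v => by rw [← mul_assoc, hcomp i j k y hy] }
  have cov : IsCoveringMap (Bundle.TotalSpace.proj : Bundle.TotalSpace G Z.Fiber → Y) :=
    FiberBundle.isCoveringMap
  let snd : Bundle.TotalSpace G Z.Fiber → G := fun ε => ε.2
  have key : ∀ (x : Y) (ε : Bundle.TotalSpace G Z.Fiber) (hx : x = ε.proj) (y : Y) (σ : Path x y)
      (h : σ.toContinuousMap 0 = ε.proj), (∀ t, σ t ∈ U x) →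
      snd (cov.liftPath σ ε h 1) = c x y y * snd ε := by
    rintro x ⟨x', v⟩ hx y σ h hσ
    obtain rfl : x = x' := hx
    change G at v
    -- Inside one trivializing set the lift is constant in that trivialization; reading its end in
    -- the trivialization at `y` produces the factor `c x y y`.
    let Γ : unitInterval → Bundle.TotalSpace G Z.Fiber := fun t =>
      (Z.localTriv x).toOpenPartialHomeomorph.symm (σ t, v)
    have hΓ : Γ = cov.liftPath σ ⟨x, v⟩ h := by
      refine (cov.eq_liftPath_iff h).2 ⟨?_, rfl, ?_⟩
      · refine (Z.localTriv x).toOpenPartialHomeomorph.continuousOn_symm.comp_continuous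
          (by fun_prop) fun t => ?_
        exact (Z.mem_localTriv_target x (σ t, v)).2 (hσ t)
      · change (⟨σ 0, c x (σ 0) (σ 0) * v⟩ : Bundle.TotalSpace G Z.Fiber) = ⟨x, v⟩
        rw [σ.source, hself x x (hmem x), one_mul]
    rw [← hΓ]
    change c x (σ 1) (σ 1) * v = _
    rw [σ.target]
  let ε₀ : Bundle.TotalSpace G Z.Fiber := ⟨y₀, (1 : G)⟩
  refine ⟨fun y γ => snd (cov.liftPath γ ε₀ γ.source 1), fun y γ γ' h => ?_,
    fun x γ y σ hσ => ?_⟩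
  · exact congrArg snd (cov.liftPath_apply_one_eq_of_homotopicRel h ε₀ γ.source γ'.source)
  · have h1 : x = (cov.liftPath γ ε₀ γ.source 1).proj := by
      have := congrFun (cov.liftPath_lifts γ ε₀ γ.source) 1
      exact (this.trans γ.target).symm
    have h2 := cov.liftPath_trans (e := ε₀) rfl γ σ
    have h3 := congrArg (fun Γ : C(unitInterval, _) => snd (Γ 1)) h2
    refine h3.trans ?_
    rw [← key x _ h1 y σ (σ.source.trans h1) hσ]
    exact congrArg snd (Path.target _)

/-! ### The metric with a given character 1-form -/

lemma eventually_tendsto_of_eventuallyEq_punctured {m D : ℂ → ℝ} {z₀ : ℂ}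
    (h : ∀ᶠ z in 𝓝[≠] z₀, m z = D z) (hD : ∀ᶠ z in 𝓝 z₀, ContinuousAt D z) :
    ∀ᶠ z in 𝓝 z₀, Tendsto m (𝓝[≠] z) (𝓝 (D z)) := by
  filter_upwards [hD, eventually_nhdsWithin_iff.1 (eventually_eventually_punctured h)] with z h1 h2
  have h3 : m =ᶠ[𝓝[≠] z] D := by
    by_cases hz : z = z₀
    · rw [hz]; exact h
    · exact nhdsWithin_le_nhds (h2 hz)
  exact (h1.tendsto.mono_left nhdsWithin_le_nhds).congr' h3.symm

namespace MeromorphicForm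

variable {X : Type*} [TopologicalSpace X] [ChartedSpace ℂ X] {η : MeromorphicForm X} {p : X}
  {u : X → ℝ} {C : ℝ} {e e' : OpenPartialHomeomorph X ℂ}

/-- The hypotheses on a character 1-form; the real part of the form is `du`. -/
structure IsCharacter (η : MeromorphicForm X) (u : X → ℝ) : Prop where
  isThirdKind : η.IsThirdKind
  residue : ∀ p, η.IsPole p → (η.residue p).im = 0 ∧ η.residue p ≠ 0
  isRealPrimitive : η.IsRealPrimitive u
  orderAt_ne_top : ∀ p, η.orderAt p ≠ ⊤
  finite : {p | η.orderAt p ≠ 0}.Finite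

/-- The density of the pull-back of the round metric by a function of modulus `C * exp u` with
logarithmic differential `η`. -/
def rawDensity (η : MeromorphicForm X) (u : X → ℝ) (C : ℝ) (e : OpenPartialHomeomorph X ℂ)
    (z : ℂ) : ℝ := expDensity ‖η.coeff e z‖ (C * Real.exp (u (e.symm z)))

/-- The continuous extension of `rawDensity`. -/
def extDensity (η : MeromorphicForm X) (u : X → ℝ) (C : ℝ) (e : OpenPartialHomeomorph X ℂ)
    (z : ℂ) : ℝ := limUnder (𝓝[≠] z) (η.rawDensity u C e)

lemma IsCharacter.finite_isPole (h : η.IsCharacter u) : {p | η.IsPole p}.Finite :=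
  h.finite.subset fun _ hp => IsPole.orderAt_ne_zero hp

lemma IsCharacter.orderAt_eq_zero (h : η.IsCharacter u) (hpole : ¬ η.IsPole p)
    (h0 : η.conicalOrder p = 0) : η.orderAt p = 0 := by
  rw [conicalOrder_of_not_isPole hpole] at h0
  rw [← WithTop.coe_untop₀_of_ne_top (h.orderAt_ne_top p), Int.cast_eq_zero.1 h0]
  rfl

lemma extDensity_eq {z : ℂ} {d : ℝ} (h : Tendsto (η.rawDensity u C e) (𝓝[≠] z) (𝓝 d)) :
    η.extDensity u C e z = d := h.limUnder_eq

lemma IsCharacter.neg_one_lt_conicalOrder (h : η.IsCharacter u) : -1 < η.conicalOrder p := by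
  by_cases hpole : η.IsPole p
  · rw [conicalOrder_of_isPole hpole]
    obtain ⟨h1, h2⟩ := h.residue p hpole
    have h3 : (η.residue p).re ≠ 0 := fun h3 => h2 (Complex.ext h3 h1)
    linarith [abs_pos.2 h3]
  · rw [conicalOrder_of_not_isPole hpole]
    have h1 : (0 : ℤ) ≤ (η.orderAt p).untop₀ := by
      have h2 := not_lt.1 hpole
      rw [← WithTop.coe_untop₀_of_ne_top (h.orderAt_ne_top p)] at h2
      exact_mod_cast h2
    have : (0 : ℝ) ≤ ((η.orderAt p).untop₀ : ℝ) := by exact_mod_cast h1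
    linarith

lemma IsCharacter.finite_support (h : η.IsCharacter u) : (Function.support η.conicalOrder).Finite := by
  refine h.finite.subset fun p hp h0 => hp ?_
  have hpole : ¬ η.IsPole p := fun h => h.orderAt_ne_zero h0
  rw [conicalOrder_of_not_isPole hpole, h0]
  simp

variable [IsManifold 𝓘(ℂ) ω X]

lemma IsCharacter.exists_model_of_not_isPole (h : η.IsCharacter u) (hC : 0 < C)
    (he : e ∈ atlas ℂ X) (hp : p ∈ e.source) (hpole : ¬ η.IsPole p) (h0 : η.orderAt p = 0) :
    ∃ F : ℂ → ℂ, AnalyticAt ℂ F (e p) ∧ deriv F (e p) ≠ 0 ∧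
      LogGerm (η.coeff e) (fun w => ((F w : ℂ) : OnePoint ℂ)) (e p) ∧
      ∀ᶠ z in 𝓝 (e p), η.rawDensity u C e z = 2 * ‖deriv F z‖ / (1 + ‖F z‖ ^ 2) := by
  obtain ⟨K, hKa, hK⟩ := exists_primitive_of_analyticAt (η.analyticAt_coeff he hp hpole)
  have hu : ∀ᶠ z in 𝓝 (e p), HasFDerivAt (fun w => u (e.symm w))
      (Complex.reCLM.comp (ContinuousLinearMap.mul ℝ ℂ (η.coeff e z))) z := by
    filter_upwards [eventually_symm hp (eventually_nhds_not_isPole hpole),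
      e.open_target.mem_nhds (e.map_source hp)] with z h1 h2
    exact h.isRealPrimitive e he z h2 h1
  have h1 := eventually_sub_eq_of_hasFDerivAt (hK.mono fun z hz => hasFDerivAt_re_of_hasDerivAt hz) hu
  -- Near `p` one has `Re K - k = u`, so adding `log C - k` to the primitive makes its exponential
  -- have modulus `C * exp u`.
  set k : ℝ := (K (e p)).re - u (e.symm (e p))
  have hK' : ∀ᶠ z in 𝓝 (e p), HasDerivAt (fun z => K z + ((Real.log C - k : ℝ) : ℂ)) (η.coeff e z) z :=
    hK.mono fun z hz => hz.add_const _
  have hd : ∀ᶠ z in 𝓝 (e p), deriv (fun z => Complex.exp (K z + ((Real.log C - k : ℝ) : ℂ))) z =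
      η.coeff e z * Complex.exp (K z + ((Real.log C - k : ℝ) : ℂ)) :=
    hK'.mono fun z hz => by rw [hz.cexp.deriv, mul_comm]
  refine ⟨fun z => Complex.exp (K z + ((Real.log C - k : ℝ) : ℂ)),
    (hKa.add analyticAt_const).cexp, ?_, logGerm_exp hK', ?_⟩
  · rw [hd.self_of_nhds]
    exact mul_ne_zero ((η.orderAt_eq_zero_iff he hp).1 h0) (Complex.exp_ne_zero _)
  · filter_upwards [hd, h1] with z h2 h3
    rw [sphereDensity_eq_expDensity h2, rawDensity, Complex.norm_exp]
    congr 1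
    rw [← Real.exp_log hC, ← Real.exp_add, Real.exp_log hC]
    congr 1
    simp only [Complex.add_re, Complex.ofReal_re]
    linarith

lemma IsCharacter.exists_model_of_isPole (h : η.IsCharacter u) (hC : 0 < C)
    (he : e ∈ atlas ℂ X) (hp : p ∈ e.source) (hpole : η.IsPole p)
    (h0 : |(η.residue p).re| = 1) :
    ∃ (ι : ℂ → OnePoint ℂ) (F : ℂ → ℂ), (ι = OnePoint.some ∨ ι = recip) ∧
      AnalyticAt ℂ F (e p) ∧ deriv F (e p) ≠ 0 ∧
      LogGerm (η.coeff e) (fun w => ι (F w)) (e p) ∧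
      ∀ᶠ z in 𝓝[≠] (e p), η.rawDensity u C e z = 2 * ‖deriv F z‖ / (1 + ‖F z‖ ^ 2) := by
  obtain ⟨K, hK⟩ := η.exists_expansion h.isThirdKind he hp
  have hρ : ((η.residue p).re : ℂ) = η.residue p := Complex.ext rfl (by simp [(h.residue p hpole).1])
  rw [← hρ] at hK
  obtain ⟨c, hc⟩ := hK.exists_re (h.isRealPrimitive.eventually_hasFDerivAt he hp)
  have hpos : ∀ z, z ≠ e p → 0 < ‖z - e p‖ := fun z hz => norm_pos_iff.2 (sub_ne_zero.2 hz)
  rcases (abs_eq zero_le_one).1 h0 with h1 | h1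
  · rw [h1] at hK hc
    have hB : ((C * Real.exp c : ℝ) : ℂ) ≠ 0 := by exact_mod_cast (by positivity : C * Real.exp c ≠ 0)
    -- Here `u = log |y - p| + Re K + c`, so this constant gives the model modulus `C * exp u`.
    refine ⟨_, fun y => ((C * Real.exp c : ℝ) : ℂ) * ((y - e p) * Complex.exp (K y)), Or.inl rfl,
      analyticAt_mul_exp hK.1, ?_, HasSimplePoleExpansion.logGerm_one (by exact_mod_cast hK) hB, ?_⟩
    · rw [deriv_mul_exp_center hK.1]
      exact mul_ne_zero hB (Complex.exp_ne_zero _)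
    · filter_upwards [hc, hK.2, self_mem_nhdsWithin, nhdsWithin_le_nhds hK.1.eventually_analyticAt]
        with z h2 h3 h4 h5
      have h6 := (hasDerivAt_mul_exp (C := ((C * Real.exp c : ℝ) : ℂ))
        h5.differentiableAt.hasDerivAt h4).deriv
      rw [Complex.ofReal_one] at h3
      rw [← h3] at h6
      rw [sphereDensity_eq_expDensity h6, rawDensity]
      congr 1
      rw [norm_mul, norm_mul, Complex.norm_exp, Complex.norm_real, h2, Real.norm_eq_abs,
        abs_of_pos (by positivity), one_mul, Real.exp_add, Real.exp_add, Real.exp_log (hpos z h4)]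
      ring
  · rw [h1] at hK hc
    have hB : (((C * Real.exp c)⁻¹ : ℝ) : ℂ) ≠ 0 := by
      exact_mod_cast (by positivity : (C * Real.exp c)⁻¹ ≠ 0)
    -- The chart expression is the reciprocal of the solution and has modulus `(C * exp u)⁻¹`;
    -- `expDensity_inv` shows that the density is the same.
    refine ⟨_, fun y => (((C * Real.exp c)⁻¹ : ℝ) : ℂ) * ((y - e p) * Complex.exp (-K y)),
      Or.inr rfl, analyticAt_mul_exp hK.1.neg, ?_,
      HasSimplePoleExpansion.logGerm_neg_one (by exact_mod_cast hK) hB, ?_⟩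
    · rw [deriv_mul_exp_center (K := fun y => -K y) hK.1.neg]
      exact mul_ne_zero hB (Complex.exp_ne_zero _)
    · filter_upwards [hc, hK.2, self_mem_nhdsWithin, nhdsWithin_le_nhds hK.1.eventually_analyticAt]
        with z h2 h3 h4 h5
      have h6 := (hasDerivAt_mul_exp (C := (((C * Real.exp c)⁻¹ : ℝ) : ℂ))
        h5.differentiableAt.hasDerivAt.neg h4).deriv
      have h7 : 1 / (z - e p) + -deriv K z = -η.coeff e z := by
        rw [h3]; push_cast; ring
      simp only [Pi.neg_apply] at h6
      rw [h7] at h6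
      rw [sphereDensity_eq_expDensity h6, rawDensity, norm_neg, ← expDensity_inv _ (by positivity)]
      congr 1
      rw [norm_mul, norm_mul, Complex.norm_exp, Complex.norm_real, h2, Real.norm_eq_abs,
        abs_of_pos (by positivity), Real.exp_add, Real.exp_add, neg_one_mul, Real.exp_neg,
        Real.exp_log (hpos z h4), Complex.neg_re, Real.exp_neg]
      have := (hpos z h4).ne'
      have := hC.ne'
      field_simp

/-- The local form of the function element and of the metric at a regular point. -/
lemma IsCharacter.exists_model (h : η.IsCharacter u) (hC : 0 < C)
    (he : e ∈ atlas ℂ X) (hp : p ∈ e.source) (h0 : η.conicalOrder p = 0) :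
    ∃ (ι : ℂ → OnePoint ℂ) (F : ℂ → ℂ), (ι = OnePoint.some ∨ ι = recip) ∧
      AnalyticAt ℂ F (e p) ∧ deriv F (e p) ≠ 0 ∧
      LogGerm (η.coeff e) (fun w => ι (F w)) (e p) ∧
      ∀ᶠ z in 𝓝 (e p), Tendsto (η.rawDensity u C e) (𝓝[≠] z)
        (𝓝 (2 * ‖deriv F z‖ / (1 + ‖F z‖ ^ 2))) := by
  have key : ∃ (ι : ℂ → OnePoint ℂ) (F : ℂ → ℂ), (ι = OnePoint.some ∨ ι = recip) ∧
      AnalyticAt ℂ F (e p) ∧ deriv F (e p) ≠ 0 ∧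
      LogGerm (η.coeff e) (fun w => ι (F w)) (e p) ∧
      ∀ᶠ z in 𝓝[≠] (e p), η.rawDensity u C e z = 2 * ‖deriv F z‖ / (1 + ‖F z‖ ^ 2) := by
    by_cases hpole : η.IsPole p
    · rw [conicalOrder_of_isPole hpole, sub_eq_zero] at h0
      exact h.exists_model_of_isPole hC he hp hpole h0
    · obtain ⟨F, h1, h2, h3, h4⟩ :=
        h.exists_model_of_not_isPole hC he hp hpole (h.orderAt_eq_zero hpole h0)
      exact ⟨_, F, Or.inl rfl, h1, h2, h3, nhdsWithin_le_nhds h4⟩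
  obtain ⟨ι, F, hι, hF, h1, h2, h3⟩ := key
  refine ⟨ι, F, hι, hF, h1, h2, eventually_tendsto_of_eventuallyEq_punctured h3 ?_⟩
  filter_upwards [hF.eventually_analyticAt, hF.deriv.continuousAt.eventually_ne h1] with z h4 h5
  exact (contDiffAt_sphereDensity h4 h5).continuousAt

lemma IsCharacter.tendsto_rawDensity (h : η.IsCharacter u) (hC : 0 < C)
    (he : e ∈ atlas ℂ X) (hp : p ∈ e.source) (h0 : η.conicalOrder p = 0) :
    Tendsto (η.rawDensity u C e) (𝓝[≠] (e p)) (𝓝 (η.extDensity u C e (e p))) := by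
  obtain ⟨ι, F, -, -, -, -, h1⟩ := h.exists_model hC he hp h0
  rw [extDensity_eq h1.self_of_nhds]
  exact h1.self_of_nhds

lemma IsCharacter.extDensity_eq_rawDensity (h : η.IsCharacter u) (he : e ∈ atlas ℂ X)
    (hp : p ∈ e.source) (hpole : ¬ η.IsPole p) :
    η.extDensity u C e (e p) = η.rawDensity u C e (e p) := by
  refine extDensity_eq (ContinuousAt.tendsto ?_ |>.mono_left nhdsWithin_le_nhds)
  have h1 := (η.analyticAt_coeff he hp hpole).continuousAt
  have h2 := (h.isRealPrimitive.hasFDerivAt he hp hpole).continuousAt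
  refine ContinuousAt.div₀ ((continuousAt_const.mul h1.norm).mul (continuousAt_const.mul h2.rexp))
    (continuousAt_const.add ((continuousAt_const.mul h2.rexp).pow 2)) ?_
  positivity

/-- The metric with density `rawDensity`. -/
def IsCharacter.metric (h : η.IsCharacter u) (hC : 0 < C) [T1Space X] : SphericalMetric X where
  density := η.extDensity u C
  div := Finsupp.ofSupportFinite η.conicalOrder h.finite_support
  neg_one_lt_div _ := h.neg_one_lt_conicalOrder
  transform e he e' he' z hz hz' hreg := by
    rw [Finsupp.notMem_support_iff] at hreg
    replace hreg : η.conicalOrder (e.symm z) = 0 := hreg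
    have h1 := h.tendsto_rawDensity hC he (e.map_target hz) hreg
    have h2 := h.tendsto_rawDensity hC he' hz' hreg
    rw [e.right_inv hz] at h1
    have h3 := analyticAt_transition he he' hz hz'
    have h4 := h3.differentiableAt.hasDerivAt.tendsto_nhdsNE (deriv_transition_ne_zero he he' hz hz')
    have h5 : Tendsto (fun w => ‖deriv (fun w => e' (e.symm w)) w‖) (𝓝[≠] z)
        (𝓝 ‖deriv (fun w => e' (e.symm w)) z‖) :=
      h3.deriv.continuousAt.norm.tendsto.mono_left nhdsWithin_le_nhds
    -- The raw densities transform by `|τ'|` because `u` does not depend on the chart; the rule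
    -- passes to the limit at poles with residue `± 1`.
    refine tendsto_nhds_unique h1 (((h2.comp h4).mul h5).congr' ?_)
    have h6 := eventually_transition (e.map_target hz) hz'
    rw [e.right_inv hz] at h6
    filter_upwards [nhdsWithin_le_nhds h6] with w h7
    simp only [rawDensity, Function.comp_apply, expDensity]
    rw [η.transform e he e' he' w h7.1 h7.2, norm_mul, e'.left_inv h7.2]
    ring
  density_pos e he z hz hreg := by
    rw [Finsupp.notMem_support_iff] at hreg
    obtain ⟨ι, F, -, -, h1, -, h2⟩ := h.exists_model hC he (e.map_target hz) hreg
    rw [e.right_inv hz] at h1 h2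
    rw [extDensity_eq h2.self_of_nhds]
    have := norm_pos_iff.2 h1
    positivity
  smooth e he z hz hreg := by
    rw [Finsupp.notMem_support_iff] at hreg
    obtain ⟨ι, F, -, hF, h1, -, h2⟩ := h.exists_model hC he (e.map_target hz) hreg
    rw [e.right_inv hz] at h1 h2 hF
    exact (contDiffAt_sphereDensity hF h1).congr_of_eventuallyEq
      (h2.mono fun w hw => extDensity_eq hw)
  curvature_eq_one e he z hz hreg := by
    rw [Finsupp.notMem_support_iff] at hreg
    obtain ⟨ι, F, -, hF, h1, -, h2⟩ := h.exists_model hC he (e.map_target hz) hreg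
    rw [e.right_inv hz] at h1 h2 hF
    have h3 : (fun w => Real.log (η.extDensity u C e w)) =ᶠ[𝓝 z]
        fun w => Real.log (2 * ‖deriv F w‖ / (1 + ‖F w‖ ^ 2)) :=
      h2.mono fun w hw => by simp only [extDensity_eq hw]
    rw [(InnerProductSpace.laplacian_congr_nhds h3).self_of_nhds, extDensity_eq h2.self_of_nhds]
    exact curvature_sphereDensity hF h1
  conical e he p hp hreg := by
    obtain ⟨l, hl⟩ := h.isRealPrimitive.exists_tendsto_log_expDensity hC h.isThirdKind he hp
      (h.residue p) (h.orderAt_ne_top p)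
    refine ⟨l, hl.congr' ?_⟩
    filter_upwards [eventually_symm_punctured hp (η.eventually_not_isPole p),
      nhdsWithin_le_nhds (e.open_target.mem_nhds (e.map_source hp))] with z h1 h2
    have h3 := h.extDensity_eq_rawDensity (C := C) he (e.map_target h2) h1
    rw [e.right_inv h2] at h3
    rw [h3]
    rfl

variable [T1Space X]

lemma IsCharacter.metric_hasExpDensity (h : η.IsCharacter u) (hC : 0 < C) :
    (h.metric hC).HasExpDensity η u C := by
  intro e he p hp _ hpole
  have := h.extDensity_eq_rawDensity (C := C) he hp hpole
  rwa [rawDensity, e.left_inv hp] at this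

end MeromorphicForm

/-! ### Admissible function elements of the constructed metric -/

namespace SphericalMetric

variable {X : Type*} [TopologicalSpace X] [ChartedSpace ℂ X] {η : MeromorphicForm X}
  {e e' : OpenPartialHomeomorph X ℂ} {z : ℂ} {φ ψ : ℂ → OnePoint ℂ}

/-- `φ` is a possible function element of a developing map of `g` with character 1-form `η`. -/
def IsElement (g : SphericalMetric X) (η : MeromorphicForm X) (e : OpenPartialHomeomorph X ℂ)
    (φ : ℂ → OnePoint ℂ) (z : ℂ) : Prop :=
  LogGerm (η.coeff e) φ z ∧ ∀ᶠ w in 𝓝 z, HasSphereDensity φ w (g.density e w)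

end SphericalMetric

lemma MeromorphicForm.IsCharacter.exists_isElement {X : Type*} [TopologicalSpace X]
    [ChartedSpace ℂ X] [IsManifold 𝓘(ℂ) ω X] [T1Space X] {η : MeromorphicForm X} {u : X → ℝ}
    {C : ℝ} (h : η.IsCharacter u) (hC : 0 < C) {e : OpenPartialHomeomorph X ℂ}
    (he : e ∈ atlas ℂ X) {p : X} (hp : p ∈ e.source) (hreg : p ∉ (h.metric hC).div.support) :
    ∃ φ, (h.metric hC).IsElement η e φ (e p) := by
  rw [Finsupp.notMem_support_iff] at hreg
  obtain ⟨ι, F, hι, hF, h1, h2, h3⟩ := h.exists_model hC he hp hreg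
  refine ⟨_, h2, ?_⟩
  filter_upwards [h3, hF.eventually_analyticAt, hF.deriv.continuousAt.eventually_ne h1]
    with w h4 h5 h6
  exact ⟨ι, F, hι, h5, EventuallyEq.rfl, h6, MeromorphicForm.extDensity_eq h4⟩

/-! ### Existence of developing maps -/

lemma HasSphereDensity.comp {φ : ℂ → OnePoint ℂ} {τ : ℂ → ℂ} {z : ℂ} {d : ℝ}
    (h : HasSphereDensity φ (τ z) d) (hτ : AnalyticAt ℂ τ z) (hτ' : deriv τ z ≠ 0) :
    HasSphereDensity (fun w => φ (τ w)) z (d * ‖deriv τ z‖) := by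
  obtain ⟨ι, F, hι, hF, e, h1, rfl⟩ := h
  have h2 : deriv (fun w => F (τ w)) z = deriv F (τ z) * deriv τ z :=
    (hF.differentiableAt.hasDerivAt.comp z hτ.differentiableAt.hasDerivAt).deriv
  refine ⟨ι, fun w => F (τ w), hι, hF.comp hτ, hτ.continuousAt.eventually e, ?_, ?_⟩
  · rw [h2]; exact mul_ne_zero h1 hτ'
  · rw [h2, norm_mul]; ring

/-- The constant ratio of two function elements is unique. -/
lemma LogGerm.const_unique {a : ℂ → ℂ} {φ : ℂ → OnePoint ℂ} {z : ℂ} (h : LogGerm a φ z)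
    {c c' : ℂ} (h' : ∀ᶠ w in 𝓝 z, OnePoint.map (fun x => c * x) (φ w) =
      OnePoint.map (fun x => c' * x) (φ w)) : c = c' := by
  obtain ⟨w, h1, h2⟩ := (h.2.and (nhdsWithin_le_nhds h')).exists
  obtain ⟨h3, h4, -⟩ := h1.finitePart_spec
  rw [h3] at h2
  exact mul_right_cancel₀ h4 (OnePoint.coe_injective h2)

lemma Represents.transition {X : Type*} [TopologicalSpace X] {S : Finset X}
    {y₀ x : {x : X // x ∉ S}} {f : MultiFun {x : X // x ∉ S} y₀} {γ : Path y₀ x}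
    {e e' : OpenPartialHomeomorph X ℂ} {φ : ℂ → OnePoint ℂ} (h : Represents f γ e' φ)
    (hx : (x : X) ∈ e.source) : Represents f γ e fun z => φ (e' (e.symm z)) := by
  obtain ⟨U, hU, h⟩ := h
  refine ⟨U ∩ e.source, inter_mem hU (e.open_source.mem_nhds hx), fun y σ hσ => ?_⟩
  have hy : (y : X) ∈ e.source := by simpa using (hσ 1).2
  simp only [e.left_inv hy]
  exact h y σ fun t => (hσ t).1

namespace SphericalMetric

variable {X : Type*} [TopologicalSpace X] [ChartedSpace ℂ X] {g : SphericalMetric X}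
  {η : MeromorphicForm X} {e e' : OpenPartialHomeomorph X ℂ} {z : ℂ} {φ ψ : ℂ → OnePoint ℂ}

namespace IsElement

lemma eventually (h : g.IsElement η e φ z) : ∀ᶠ w in 𝓝 z, g.IsElement η e φ w :=
  h.1.eventually.and h.2.eventually_nhds

lemma map_mul (h : g.IsElement η e φ z) {c : ℂ} (hc : ‖c‖ = 1) :
    g.IsElement η e (fun w => OnePoint.map (fun x => c * x) (φ w)) z :=
  ⟨h.1.map_mul (by rintro rfl; simp at hc), h.2.mono fun _ hw => hw.map_mul hc⟩

lemma exists_unit_mul (h : g.IsElement η e φ z) (h' : g.IsElement η e ψ z) :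
    ∃ c : ℂ, ‖c‖ = 1 ∧ ∀ᶠ w in 𝓝 z, ψ w = OnePoint.map (fun x => c * x) (φ w) := by
  obtain ⟨c, hc, h1⟩ := h.1.exists_const_mul h'.1
  refine ⟨c, norm_eq_one_of_hasSphereDensity hc h.2 ?_, h1⟩
  filter_upwards [h'.2, h1.eventually_nhds] with w h5 h6
  obtain ⟨ι, F, hι, hF, h7, h8⟩ := h5
  exact ⟨ι, F, hι, hF, EventuallyEq.trans (h6.mono fun w hw => hw.symm) h7, h8⟩

lemma transition [IsManifold 𝓘(ℂ) ω X] [T1Space X] {p : X} (h : g.IsElement η e' φ (e' p))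
    (he : e ∈ atlas ℂ X) (he' : e' ∈ atlas ℂ X) (hp : p ∈ e.source) (hp' : p ∈ e'.source)
    (hreg : p ∉ g.div.support) : g.IsElement η e (fun z => φ (e' (e.symm z))) (e p) := by
  have hz := e.map_source hp
  have hz' : e.symm (e p) ∈ e'.source := by rwa [e.left_inv hp]
  have hτ := analyticAt_transition he he' hz hz'
  have hτ' := deriv_transition_ne_zero he he' hz hz'
  rw [← e.left_inv hp] at h
  refine ⟨LogGerm.comp (g := fun w => e' (e.symm w)) h.1 hτ hτ'
    (η.coeff_eventually_eq he he' hp hp'), ?_⟩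
  have h1 : ∀ᶠ y in 𝓝 p, y ∉ g.div.support :=
    g.div.support.finite_toSet.isClosed.isOpen_compl.mem_nhds hreg
  filter_upwards [hτ.continuousAt.eventually h.2, eventually_transition hp hp',
    eventually_symm hp h1] with w h2 h3 h4
  have h5 := h2.comp (τ := fun w => e' (e.symm w)) (analyticAt_transition he he' h3.1 h3.2)
    (deriv_transition_ne_zero he he' h3.1 h3.2)
  rwa [← g.transform e he e' he' w h3.1 h3.2 h4] at h5

end IsElement

variable [IsManifold 𝓘(ℂ) ω X] [T1Space X]

/-- Local function elements can be continued to a multi-valued function. -/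
lemma exists_multiFun_isElement
    (h : ∀ x : g.Regular, ∃ φ, g.IsElement η (chartAt ℂ (x : X)) φ (chartAt ℂ (x : X) x))
    (y₀ : g.Regular) : ∃ f : MultiFun g.Regular y₀, ∀ (x : g.Regular) (γ : Path y₀ x),
      ∀ e ∈ atlas ℂ X, (x : X) ∈ e.source →
        ∃ φ, Represents f γ e φ ∧ g.IsElement η e φ (e x) := by
  choose φ hφ using h
  let ch : g.Regular → OpenPartialHomeomorph X ℂ := fun x => chartAt ℂ (x : X)
  have hch : ∀ x, ch x ∈ atlas ℂ X := fun x => chart_mem_atlas ℂ (x : X)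
  have hsrc : ∀ x : g.Regular, (x : X) ∈ (ch x).source := fun x => mem_chart_source ℂ (x : X)
  let ψ : g.Regular → X → OnePoint ℂ := fun x y => φ x (ch x y)
  -- The open set on which the element chosen at `x` remains admissible.
  let V : g.Regular → Set X := fun x =>
    interior {y | y ∈ (ch x).source ∧ g.IsElement η (ch x) (φ x) (ch x y)}
  have hV : ∀ x : g.Regular, V x ∈ 𝓝 (x : X) := fun x => interior_mem_nhds.2
    (inter_mem ((ch x).open_source.mem_nhds (hsrc x))
      (eventually_chart (hsrc x) (hφ x).eventually))
  have hVs : ∀ {x : g.Regular} {y : X}, y ∈ V x →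
      y ∈ (ch x).source ∧ g.IsElement η (ch x) (φ x) (ch x y) := fun {x} {y} h => by
    simpa using interior_subset h
  -- The ratio of two chosen elements near `y`. It exists and has modulus one because both induce
  -- the metric; its uniqueness makes it a locally constant cocycle in `U(1)`.
  let R : g.Regular → g.Regular → g.Regular → Circle → Prop := fun i j y c =>
    ∀ᶠ x in 𝓝 (y : X), ψ i x = OnePoint.map (fun w => (c : ℂ) * w) (ψ j x)
  have hex : ∀ i j (y : g.Regular), (y : X) ∈ V i → (y : X) ∈ V j → ∃ c, R i j y c := by
    intro i j y hi hj
    obtain ⟨hi1, hi2⟩ := hVs hi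
    obtain ⟨hj1, hj2⟩ := hVs hj
    have h1 := hi2.transition (hch j) (hch i) hj1 hi1 y.2
    obtain ⟨c, hc, h2⟩ := hj2.exists_unit_mul h1
    refine ⟨⟨c, mem_sphere_zero_iff_norm.2 hc⟩, ?_⟩
    filter_upwards [eventually_chart hj1 h2, (ch j).open_source.mem_nhds hj1] with x h3 h4
    rw [(ch j).left_inv h4] at h3
    exact h3
  have huniq : ∀ i j (y : g.Regular) c c', (y : X) ∈ V j → R i j y c → R i j y c' → c = c' := by
    intro i j y c c' hj h1 h2
    obtain ⟨hj1, hj2⟩ := hVs hj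
    refine Circle.coe_injective (hj2.1.const_unique ?_)
    filter_upwards [eventually_symm hj1 h1, eventually_symm hj1 h2,
      (ch j).open_target.mem_nhds ((ch j).map_source hj1)] with w h3 h4 h5
    simp only [ψ, (ch j).right_inv h5] at h3 h4
    rw [← h3, ← h4]
  have hc : ∃ c : g.Regular → g.Regular → g.Regular → Circle, ∀ i j (y : g.Regular),
      (y : X) ∈ V i → (y : X) ∈ V j → R i j y (c i j y) := by
    classical
    refine ⟨fun i j y => if h : ∃ c, R i j y c then h.choose else 1, fun i j y hi hj => ?_⟩
    simp only [dif_pos (hex i j y hi hj)]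
    exact (hex i j y hi hj).choose_spec
  obtain ⟨c, hc⟩ := hc
  obtain ⟨F, hF, hFσ⟩ := exists_parallel_transport (U := fun x => Subtype.val ⁻¹' V x) (c := c)
    (fun x => isOpen_interior.preimage continuous_subtype_val) (fun x => mem_of_mem_nhds (s := V x) (hV x))
    (fun i y hy => huniq i i y _ _ hy (hc i i y hy hy)
      (Eventually.of_forall fun x => by rw [Circle.coe_one, map_one_mul]))
    (fun i j y hy => by
      have h1 := (hc i j y hy.1 hy.2).eventually_nhds
      filter_upwards [continuous_subtype_val.continuousAt.eventually h1,
        continuous_subtype_val.continuousAt.eventually (isOpen_interior.mem_nhds hy.1),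
        continuous_subtype_val.continuousAt.eventually (isOpen_interior.mem_nhds hy.2)]
        with y' h2 h3 h4
      exact huniq i j y' _ _ h4 (hc i j y' h3 h4) h2)
    (fun i j k y hy => by
      refine huniq i k y _ _ hy.2 ?_ (hc i k y hy.1.1 hy.2)
      filter_upwards [hc i j y hy.1.1 hy.1.2, hc j k y hy.1.2 hy.2] with x h1 h2
      rw [h1, h2, map_mul_map_mul, mul_comm, Circle.coe_mul, mul_comm (c j k y : ℂ)]) y₀
  -- The transported factor times the element chosen at the end point. Transport multiplies the
  -- factor by exactly the ratio needed for the values to continue the element at `x`.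
  let f : MultiFun g.Regular y₀ :=
    { toFun := fun {y} γ => OnePoint.map (fun w => (F y γ : ℂ) * w) (ψ y y)
      homotopic := fun γ γ' h => by rw [hF _ γ γ' h] }
  refine ⟨f, fun x γ e he hx => ?_⟩
  have h1 : Represents f γ (ch x) fun z => OnePoint.map (fun w => (F x γ : ℂ) * w) (φ x z) := by
    refine ⟨V x, hV x, fun y σ hσ => ?_⟩
    have hy : (y : X) ∈ V x := by simpa using hσ 1
    have h2 := (hc x y y hy (mem_of_mem_nhds (hV y))).self_of_nhds
    change OnePoint.map (fun w => (F y (γ.trans σ) : ℂ) * w) (ψ y y) =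
      OnePoint.map (fun w => (F x γ : ℂ) * w) (ψ x y)
    rw [h2, map_mul_map_mul, hFσ x γ y σ hσ, Circle.coe_mul, mul_comm (c x y y : ℂ)]
  exact ⟨_, h1.transition hx, ((hφ x).map_mul (Circle.norm_coe _)).transition he (hch x) hx
    (hsrc x) x.2⟩

end SphericalMetric

/-! ### Monodromy -/

/-- The diagonal rotations form a group. -/
def diagonalSubgroup : Subgroup (Equiv.Perm (OnePoint ℂ)) where
  carrier := diagonalRotations
  mul_mem' := by
    rintro L M ⟨u, hu, hL⟩ ⟨v, hv, hM⟩
    exact ⟨u * v, by simp [hu, hv], fun w => by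
      rw [Equiv.Perm.mul_apply, hM, hL, map_mul_map_mul]⟩
  one_mem' := ⟨1, by simp, fun w => (map_one_mul w).symm⟩
  inv_mem' := by
    rintro L ⟨u, hu, hL⟩
    have hu0 : u ≠ 0 := by rintro rfl; simp at hu
    refine ⟨u⁻¹, by simp [hu], fun w => ?_⟩
    rw [Equiv.Perm.inv_eq_iff_eq, hL, map_mul_map_mul, mul_inv_cancel₀ hu0, map_one_mul]

lemma diagonalSubgroup_comm : ∀ a ∈ diagonalSubgroup, ∀ b ∈ diagonalSubgroup, a * b = b * a := by
  rintro L ⟨u, -, hL⟩ M ⟨v, -, hM⟩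
  ext w
  rw [Equiv.Perm.mul_apply, Equiv.Perm.mul_apply, hM, hL, hL, hM, map_mul_map_mul,
    map_mul_map_mul, mul_comm]

lemma diagonalRotations_subset_rotations : diagonalRotations ⊆ rotations := by
  rintro L ⟨u, hu, hL⟩
  -- A square root is needed for determinant one: `w ↦ u w` is the action of `diag (v, v⁻¹)` with
  -- `v² = u`.
  obtain ⟨v, hv⟩ := IsAlgClosed.exists_pow_nat_eq u (n := 2) two_pos
  have hvn : ‖v‖ = 1 := by
    rw [← hv, norm_pow] at hu
    exact (pow_eq_one_iff_of_nonneg (norm_nonneg v) two_ne_zero).1 hu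
  have hv0 : v ≠ 0 := by rintro rfl; simp at hvn
  have hvc : (starRingEnd ℂ) v = v⁻¹ := (Complex.inv_eq_conj hvn).symm
  refine ⟨Matrix.GeneralLinearGroup.mkOfDetNeZero !![v, 0; 0, v⁻¹] (by simp [hv0]), ?_, fun w => ?_⟩
  · rw [Matrix.mem_specialUnitaryGroup_iff, Matrix.mem_unitaryGroup_iff]
    constructor
    · ext i j
      fin_cases i <;> fin_cases j <;>
        simp [Matrix.GeneralLinearGroup.mkOfDetNeZero, Matrix.mul_apply, Fin.sum_univ_two, hvc, hv0]
    · simp [Matrix.GeneralLinearGroup.mkOfDetNeZero, hv0]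
  · rw [hL]
    induction w using OnePoint.rec with
    | infty =>
      rw [OnePoint.smul_infty_eq_ite]
      simp [Matrix.GeneralLinearGroup.mkOfDetNeZero]
    | coe w =>
      rw [OnePoint.smul_some_eq_ite]
      simp [Matrix.GeneralLinearGroup.mkOfDetNeZero, hv0, ← hv]
      ring

lemma exists_mem_diagonalRotations {u : ℂ} (hu : ‖u‖ = 1) :
    ∃ L ∈ diagonalRotations, ∀ w, L w = OnePoint.map (fun x => u * x) w := by
  have hu0 : u ≠ 0 := by rintro rfl; simp at hu
  have h : ∀ w, MulAction.toPerm (diagGL u hu0) w = OnePoint.map (fun x => u * x) w :=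
    diagGL_smul u hu0
  exact ⟨_, ⟨u, hu, h⟩, h⟩

namespace SphericalMetric

variable {X : Type*} [TopologicalSpace X] [ChartedSpace ℂ X] [T1Space X]
  {g : SphericalMetric X} {y₀ : g.Regular} {f : MultiFun g.Regular y₀} {η : MeromorphicForm X}
  {u : X → ℝ}

lemma IsDevelopingMap.exists_monodromy (hf : g.IsDevelopingMap f) (hη : HasLogDifferential f η)
    (δ : Path y₀ y₀) : ∃ u : ℂ, ‖u‖ = 1 ∧ ∀ (y : g.Regular) (γ : Path y₀ y),
      f.toFun (δ.trans γ) = OnePoint.map (fun w => u * w) (f.toFun γ) :=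
  hf.exists_unit_mul hη (hf.shift δ) (hη.shift δ)

/-- A developing map with a logarithmic differential is multiplicative. -/
lemma IsDevelopingMap.monodromyIn_diagonalRotations (hf : g.IsDevelopingMap f)
    (hη : HasLogDifferential f η) : f.MonodromyIn diagonalRotations := by
  intro δ
  obtain ⟨u, hu, h⟩ := hf.exists_monodromy hη δ
  obtain ⟨L, hL, hL'⟩ := exists_mem_diagonalRotations hu
  exact ⟨L, hL, fun y γ => by rw [h, hL']⟩

lemma IsDevelopingMap.isAbelian (hf : g.IsDevelopingMap f) (hη : HasLogDifferential f η) :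
    g.IsAbelian :=
  ⟨y₀, f, hf, diagonalSubgroup, diagonalRotations_subset_rotations, diagonalSubgroup_comm,
    hf.monodromyIn_diagonalRotations hη⟩

variable [IsManifold 𝓘(ℂ) ω X]

/-- The metric is trivial if the integrals over loops are multiples of `2πi`. -/
lemma IsDevelopingMap.isTrivial (hf : g.IsDevelopingMap f) (hη : HasLogDifferential f η)
    (hfin : {p | η.IsPole p}.Finite) (h0 : ¬ η.IsPole (y₀ : X))
    (h : ∀ (p : X) (γ : Path p p), (∀ t, ¬ η.IsPole (γ t)) →
        ∃ n : ℤ, η.HasPathIntegral γ (2 * Real.pi * Complex.I * n)) : g.IsTrivial := by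
  refine ⟨y₀, f, hf, fun δ => ⟨1, rfl, fun y γ => ?_⟩⟩
  obtain ⟨u, -, hu⟩ := hf.exists_monodromy hη δ
  -- A loop of regular points may pass through poles with residue `± 1`, where `η` has no integral;
  -- it is deformed off them first.
  obtain ⟨δ', hδ, hδ'⟩ := exists_homotopic_avoiding hfin.toFinset (by simpa using h0)
    (by simpa using h0) δ
  have hδ'' : ∀ t, ¬ η.IsPole (δ' t : X) := fun t => by simpa using hδ' t
  obtain ⟨I, hI, c, hc, h1, h2⟩ :=
    HasLogElements.exists_hasPathIntegral (hf.hasLogElements hη) δ' hδ''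
  obtain ⟨n, hn⟩ := h _ (δ'.map continuous_subtype_val) hδ''
  have h3 : I = 2 * Real.pi * Complex.I * n := hI.unique hn (continuous_coe_path δ')
  have h4 : Complex.exp I = 1 := Complex.exp_eq_one_iff.2 ⟨n, by rw [h3]; ring⟩
  have h5 := hu y₀ (Path.refl y₀)
  rw [f.toFun_trans_refl, ← f.homotopic _ _ hδ, h2, h1, h4, mul_one] at h5
  have h6 : c = u * c := OnePoint.coe_injective h5
  have h7 : u = 1 := mul_right_cancel₀ hc (by rw [← h6, one_mul])
  rw [hu, h7, map_one_mul]
  rfl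

/-- A single-valued developing map with logarithmic differential `η` extends to a solution of
`E' = η E` off the poles. -/
lemma exists_hasPathIntegral_of_single_valued {E : g.Regular → OnePoint ℂ}
    (hf : HasLogElements f η) (hE : ∀ (y : g.Regular) (γ : Path y₀ y), f.toFun γ = E y)
    (hconn : ∀ y : g.Regular, Nonempty (Path y₀ y)) {p q : X} (γ : Path p q)
    (hγ : ∀ t, ¬ η.IsPole (γ t)) :
    ∃ (Ê : X → ℂ) (I : ℂ), η.HasPathIntegral γ I ∧ Ê p ≠ 0 ∧ Ê q = Ê p * Complex.exp I := by
  classical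
  let E₁ : X → ℂ := fun y => if h : y ∉ g.div.support then finitePart (E ⟨y, h⟩) else 0
  let E₂ : X → ℂ := fun y => limUnder (𝓝[≠] y) E₁
  have hlocal : ∀ {e : OpenPartialHomeomorph X ℂ}, e ∈ atlas ℂ X → ∀ y : g.Regular,
      (y : X) ∈ e.source → ¬ η.IsPole (y : X) →
        LogSol (η.coeff e) (fun w => ((E₁ (e.symm w) : ℂ) : OnePoint ℂ)) (e y) := by
    intro e he y hy hpole
    obtain ⟨γ⟩ := hconn y
    obtain ⟨ψ, h1, h2⟩ := hf y γ e he hy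
    obtain ⟨K, hK, h3⟩ := h2.exists_eq_exp (η.analyticAt_coeff he hy hpole)
    refine (logSol_exp hK.self_of_nhds).congr ?_
    filter_upwards [h1.eventually_trans hy univ_mem, h3]
    rintro w ⟨hw, y', hy', σ, -, h4⟩ h5
    have h6 := h4.apply
    rw [hE, hy', e.right_inv hw, h5] at h6
    have h7 : e.symm w ∉ g.div.support := hy' ▸ y'.2
    have h8 : E₁ (e.symm w) = Complex.exp (K w) := by
      have h9 : (⟨e.symm w, h7⟩ : g.Regular) = y' := Subtype.ext hy'.symm
      simp only [E₁, dif_pos h7, h9, h6, finitePart_some]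
    rw [h8]
  have key : ∀ x : X, ¬ η.IsPole x → ∃ K : ℂ → ℂ,
      (∀ᶠ z in 𝓝 (chartAt ℂ x x), HasDerivAt K (η.coeff (chartAt ℂ x) z) z) ∧
      ∀ᶠ y in 𝓝 x, E₂ y = Complex.exp (K (chartAt ℂ x y)) := by
    intro x hx
    set e := chartAt ℂ x
    have he : e ∈ atlas ℂ X := chart_mem_atlas ℂ x
    have hxe : x ∈ e.source := mem_chart_source ℂ x
    obtain ⟨K, -, hK⟩ := exists_primitive_of_analyticAt (η.analyticAt_coeff he hxe hx)
    have h1 : ∀ᶠ z in 𝓝[≠] (e x),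
        LogSol (η.coeff e) (fun w => ((E₁ (e.symm w) : ℂ) : OnePoint ℂ)) z := by
      filter_upwards [eventually_symm_punctured hxe (η.eventually_not_isPole x),
        eventually_symm_punctured hxe (eventually_notMem_finite g.div.support.finite_toSet x),
        nhdsWithin_le_nhds (e.open_target.mem_nhds (e.map_source hxe))] with z h1 h2 h3
      have := hlocal he ⟨e.symm z, h2⟩ (e.map_target h3) h1
      rwa [e.right_inv h3] at this
    -- Single-valuedness makes `E₁` a solution on a full punctured neighbourhood, hence a multiple
    -- of `exp K`, which extends across `x`.
    obtain ⟨c, hc, h2⟩ := LogSol.exists_const_mul_punctured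
      (nhdsWithin_le_nhds (hK.mono fun z hz => logSol_exp hz)) h1
    have hK' : ∀ᶠ z in 𝓝 (e x), HasDerivAt (fun z => K z + Complex.log c) (η.coeff e z) z :=
      hK.mono fun z hz => hz.add_const _
    refine ⟨_, hK', ?_⟩
    have h3 : ∀ᶠ y in 𝓝[≠] x, E₁ y = Complex.exp (K (e y) + Complex.log c) := by
      filter_upwards [eventually_chart_punctured hxe h2,
        nhdsWithin_le_nhds (e.open_source.mem_nhds hxe)] with y h3 h4
      rw [e.left_inv h4] at h3
      rw [Complex.exp_add, Complex.exp_log hc, mul_comm]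
      exact OnePoint.coe_injective h3
    filter_upwards [eventually_nhdsWithin_iff.1 (eventually_eventually_nhdsWithin.2 h3),
      e.open_source.mem_nhds hxe, eventually_chart hxe hK'] with y h4 h5 h6
    have := nhdsNE_neBot y
    refine Tendsto.limUnder_eq ?_
    have h7 : ContinuousAt (fun y => Complex.exp (K (e y) + Complex.log c)) y :=
      (ContinuousAt.comp (f := e) (g := fun z => K z + Complex.log c) h6.continuousAt
        (e.continuousAt h5)).cexp
    refine (h7.tendsto.mono_left nhdsWithin_le_nhds).congr' ?_
    by_cases hyx : y = x
    · rw [hyx]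
      exact h3.mono fun _ h => h.symm
    · have h8 := h4 hyx
      rw [isOpen_compl_singleton.nhdsWithin_eq hyx] at h8
      exact nhdsWithin_le_nhds (h8.mono fun _ h => h.symm)
  have hne : ∀ x, ¬ η.IsPole x → E₂ x ≠ 0 := by
    intro x hx
    obtain ⟨K, -, h⟩ := key x hx
    rw [h.self_of_nhds]
    exact Complex.exp_ne_zero _
  obtain ⟨I, hI, h1⟩ := MeromorphicForm.exists_hasPathIntegral_of_exp (η := η) γ.continuous
    (h := fun t => E₂ (γ t)) fun t => by
      obtain ⟨K, hK, h⟩ := key (γ t) (hγ t)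
      exact ⟨_, chart_mem_atlas ℂ _, mem_chart_source ℂ _, K, hK,
        γ.continuous.continuousAt.eventually h⟩
  refine ⟨E₂, I, hI, ?_, ?_⟩
  · have := hne _ (hγ 0)
    rwa [γ.source] at this
  · simpa using h1

/-- The integrals over loops are multiples of `2πi` if the metric is trivial. -/
lemma IsTrivial.exists_hasPathIntegral [PreconnectedSpace X] (h : g.IsTrivial)
    (hη : g.IsCharacterForm η) {p : X} (γ : Path p p) (hγ : ∀ t, ¬ η.IsPole (γ t)) :
    ∃ n : ℤ, η.HasPathIntegral γ (2 * Real.pi * Complex.I * n) := by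
  obtain ⟨z₀, k, hk, hmono⟩ := h
  obtain ⟨y₀, f, hf, -, hη⟩ := hη
  have hconn : ∀ y y' : g.Regular, Nonempty (Path y y') := fun y y' =>
    let ⟨σ, _⟩ := exists_path_avoiding ∅ (a := y) (b := y') (by simp) (by simp)
    ⟨σ⟩
  obtain ⟨δ⟩ := hconn y₀ z₀
  -- Trivial monodromy is given for `k` only; as `f = A • k` after a change of base point, `f` is
  -- single-valued as well.
  obtain ⟨A, hA⟩ := (hf.shift δ).exists_gl hk
  have hk1 : ∀ (δ : Path z₀ z₀) (y : g.Regular) (γ : Path z₀ y),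
      k.toFun (δ.trans γ) = k.toFun γ := by
    intro δ y γ
    obtain ⟨L, rfl, hL⟩ := hmono δ
    exact hL y γ
  have hk2 : ∀ (y : g.Regular) (γ γ' : Path z₀ y), k.toFun γ = k.toFun γ' := by
    intro y γ γ'
    rw [← hk1 (γ.trans γ'.symm) y γ', k.toFun_assoc, ← k.toFun_trans_refl γ]
    exact k.homotopic _ _ ((Path.Homotopic.refl γ).hcomp ⟨Path.Homotopy.reflSymmTrans γ'⟩)
  have σ : ∀ y, Path z₀ y := fun y => (hconn z₀ y).some
  obtain ⟨E, I, hI, h1, h2⟩ := exists_hasPathIntegral_of_single_valued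
    ((hf.shift δ).hasLogElements (hη.shift δ)) (E := fun y => A • k.toFun (σ y))
    (fun y γ => by rw [hA, hk2 y γ]) (hconn z₀) γ hγ
  have h3 : Complex.exp I = 1 := by
    have : E p * Complex.exp I = E p * 1 := by rw [← h2, mul_one]
    exact mul_left_cancel₀ h1 this
  obtain ⟨n, hn⟩ := Complex.exp_eq_one_iff.1 h3
  exact ⟨n, by rwa [hn, mul_comm] at hI⟩

/-- The period over a small circle about `p` is `2πi` times the residue, and it lies in `2πiℤ`. -/
lemma IsTrivial.exists_residue_eq [PreconnectedSpace X] (h : g.IsTrivial)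
    (hη : g.IsCharacterForm η) (h3 : η.IsThirdKind) (p : X) : ∃ n : ℤ, η.residue p = n := by
  obtain ⟨K, hK⟩ := η.exists_expansion h3 (chart_mem_atlas ℂ p) (mem_chart_source ℂ p)
  obtain ⟨q, γ, hγ, h1⟩ := MeromorphicForm.exists_loop_hasPathIntegral (chart_mem_atlas ℂ p)
    (mem_chart_source ℂ p) hK
  obtain ⟨n, hn⟩ := h.exists_hasPathIntegral hη γ hγ
  exact ⟨n, mul_left_cancel₀ Complex.two_pi_I_ne_zero (h1.unique hn γ.continuous)⟩

end SphericalMetric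

/-! ### Existence of the metric with prescribed constant -/

namespace MeromorphicForm

variable {X : Type*} [TopologicalSpace X] [ChartedSpace ℂ X] [T1Space X] [IsManifold 𝓘(ℂ) ω X]
  {η : MeromorphicForm X} {u : X → ℝ}

/-- Existence of the metric with given character 1-form and modulus at the base point. -/
lemma IsCharacter.exists_metric [PreconnectedSpace X] (h : η.IsCharacter u) {x₀ : X}
    (hx₀ : η.orderAt x₀ = 0) {r : ℝ} (hr : 0 < r) :
    ∃ g : SphericalMetric X, g.IsAbelian ∧ g.IsCharacterForm η ∧ g.IsPullbackExp η x₀ r := by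
  -- The constant for which `C * exp u` takes the value `r` at `x₀`.
  have hC : 0 < r * Real.exp (-u x₀) := by positivity
  have hpole : ¬ η.IsPole x₀ := fun h => h.orderAt_ne_zero hx₀
  set g := h.metric hC with hg
  have hreg : x₀ ∉ g.div.support := by
    rw [Finsupp.notMem_support_iff]
    exact conicalOrder_eq_zero hx₀
  obtain ⟨f, hf⟩ := g.exists_multiFun_isElement (η := η) (fun x =>
    h.exists_isElement hC (chart_mem_atlas ℂ (x : X)) (mem_chart_source ℂ (x : X)) x.2) ⟨x₀, hreg⟩
  have hdev : g.IsDevelopingMap f := SphericalMetric.isDevelopingMap_of_represents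
    fun x γ e he hx =>
      let ⟨φ, h1, h2⟩ := hf x γ e he hx
      ⟨φ, h1, h2.2.self_of_nhds⟩
  have hlog : SphericalMetric.HasLogDifferential f η :=
    SphericalMetric.hasLogDifferential_of_logGerm fun x γ e he hx =>
      let ⟨φ, h1, h2⟩ := hf x γ e he hx
      ⟨φ, h1, h2.1⟩
  refine ⟨g, hdev.isAbelian hlog, ⟨_, f, hdev, fun _ => hdev.monodromyIn_diagonalRotations hlog,
    hlog⟩, ?_⟩
  -- The continued map has some positive constant `s`; since the metric determines its constant, `s
  -- = r`.
  obtain ⟨s, hs, h1⟩ := hdev.exists_isPullbackExp hlog hpole hreg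
  have h2 := (h1.hasExpDensity hs h.isRealPrimitive h.finite_isPole hpole).eq
    (h.metric_hasExpDensity hC) (by positivity) hC h.isRealPrimitive hx₀
  rwa [mul_right_cancel₀ (Real.exp_pos _).ne' h2] at h1

end MeromorphicForm

end RSurf

end

/-! ### The classification of metrics with a given character 1-form -/

theorem theorem1p3 {X : Type*} [TopologicalSpace X] [T2Space X] [CompactSpace X] [ConnectedSpace X]
    [ChartedSpace ℂ X] [IsManifold 𝓘(ℂ) ω X]
    (η : RSurf.MeromorphicForm X)
    (hthird : η.IsThirdKind)
    (hpole : ∃ p, η.IsPole p)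
    (hres : ∀ p, η.IsPole p → (η.residue p).im = 0 ∧ η.residue p ≠ 0)
    (hexact : η.RealPartExact)
    -- the base point of the integral, neither a zero nor a pole
    (x₀ : X) (hx₀ : η.orderAt x₀ = 0) :
    -- existence and uniqueness, for each modulus `r` of the multiplicative constant of `f`
    (∀ r : ℝ, 0 < r →
      ∃ g : RSurf.SphericalMetric X,
        (g.IsAbelian ∧ g.IsCharacterForm η ∧ g.IsPullbackExp η x₀ r) ∧
        ∀ g' : RSurf.SphericalMetric X,
          g'.IsAbelian → g'.IsCharacterForm η → g'.IsPullbackExp η x₀ r → g'.Same g) ∧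
    (∀ g : RSurf.SphericalMetric X, g.IsAbelian → g.IsCharacterForm η →
      -- every abelian metric with character 1-form `η` is one of these, for exactly one `r`
      (∃! r : ℝ, 0 < r ∧ g.IsPullbackExp η x₀ r) ∧
      -- a developing map with `df / f = η` is unique up to a unit complex factor
      (∀ (y₀ : g.Regular) (f f' : RSurf.MultiFun g.Regular y₀),
        g.IsDevelopingMap f → RSurf.SphericalMetric.HasLogDifferential f η →
        g.IsDevelopingMap f' → RSurf.SphericalMetric.HasLogDifferential f' η →
        ∃ u : ℂ, ‖u‖ = 1 ∧ ∀ (y : g.Regular) (γ : Path y₀ y),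
          f'.toFun γ = OnePoint.map (fun w => u * w) (f.toFun γ)) ∧
      -- the divisor of `g`
      (∀ p, η.IsPole p → g.div p = |(η.residue p).re| - 1) ∧
      (∀ p, ¬ η.IsPole p → g.div p = ((η.orderAt p).untop₀ : ℝ)) ∧
      -- triviality
      (g.IsTrivial ↔ ∀ (p : X) (γ : Path p p), (∀ t, ¬ η.IsPole (γ t)) →
        ∃ n : ℤ, η.HasPathIntegral γ (2 * Real.pi * Complex.I * n)) ∧
      (g.IsTrivial → ∀ p, η.IsPole p → ∃ n : ℤ, η.residue p = n)) := by
  obtain ⟨u, hu⟩ := hexact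
  have htop := fun p => η.orderAt_ne_top (x₀ := x₀) (by rw [hx₀]; simp) p
  have h : η.IsCharacter u :=
    ⟨hthird, hres, hu, htop, η.finite_orderAt_ne_zero (htop x₀)⟩
  have hx₀' : ¬ η.IsPole x₀ := fun h => h.orderAt_ne_zero hx₀
  refine ⟨fun r hr => ?_, fun g _ hη => ?_⟩
  · obtain ⟨g, hg⟩ := h.exists_metric hx₀ hr
    refine ⟨g, hg, fun g' _ _ h' => ?_⟩
    exact (h'.hasExpDensity hr hu h.finite_isPole hx₀').same
      (hg.2.2.hasExpDensity hr hu h.finite_isPole hx₀') (by positivity) hu hthird hres htop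
  · obtain ⟨C, hC, hgC⟩ := hη.exists_hasExpDensity hu h.finite_isPole
    have hdiv : ∀ p, g.div p = η.conicalOrder p := fun p =>
      hgC.div_eq hC hu hthird (hres p) (htop p)
    have hreg : x₀ ∉ g.div.support := by
      rw [Finsupp.notMem_support_iff, hdiv, RSurf.MeromorphicForm.conicalOrder_eq_zero hx₀]
    obtain ⟨y₀, f, hf, -, hf'⟩ := id hη
    refine ⟨?_, fun y₀ f f' hf hη hf' hη' => hf.exists_unit_mul hη hf' hη', fun p hp => ?_,
      fun p hp => ?_, ⟨fun ht p γ hγ => ht.exists_hasPathIntegral hη γ hγ, fun hloop => ?_⟩,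
      fun ht p _ => ht.exists_residue_eq hη hthird p⟩
    · obtain ⟨r, hr, h1⟩ := hf.exists_isPullbackExp hf' hx₀' hreg
      refine ⟨r, ⟨hr, h1⟩, fun s ⟨hs, h2⟩ => ?_⟩
      have h3 := (h2.hasExpDensity hs hu h.finite_isPole hx₀').eq
        (h1.hasExpDensity hr hu h.finite_isPole hx₀') (by positivity) (by positivity) hu hx₀
      exact mul_right_cancel₀ (Real.exp_pos _).ne' h3
    · rw [hdiv, RSurf.MeromorphicForm.conicalOrder_of_isPole hp]
    · rw [hdiv, RSurf.MeromorphicForm.conicalOrder_of_not_isPole hp]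
    -- The loop criterion requires a base point that is not a pole, so the developing map is rebased
    -- at `x₀`.
    · obtain ⟨δ, -⟩ := RSurf.exists_path_avoiding ∅ (a := y₀) (b := (⟨x₀, hreg⟩ : g.Regular))
        (by simp) (by simp)
      exact (hf.shift δ).isTrivial (hf'.shift δ) h.finite_isPole hx₀' hloop
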